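/- **Setting.** Two players, a sender $\mathsf A$ and a receiver $\mathsf B$, both know $k\in\mathbb N$. All probability distributions are discrete. For a bit $X$ and a random variable $Y$ let $\mathrm{PredAdv}(X\mid Y):=2\max_f\Pr[f(Y)=X]-1$, where $f$ ranges over all $\{0,1\}$-valued functions. *Weak oblivious transfer, semi-honest model.* A system (without inputs) outputs bits $(X_0,X_1)$ to $\mathsf A$ and $(C,Y)$ to $\mathsf B$; in addition it gives an auxiliary output $U$ to $\mathsf A$ if $\mathsf A$ is passively corrupted, or $V$ to $\mathsf B$ if $\mathsf B$ is passively corrupted. Let $E:=X_C\oplus Y$. The system implements $\mathrm{WOT}(p,q)$ (i.e. with error $\varepsilon=0$) if $\Pr[E=1]=0$ when nobody is corrupted, $\mathrm{PredAdv}(X_{1-C}\mid C,Y,V,E)\le q$ when $\mathsf B$ is passively corrupted, and $\mathrm{PredAdv}(C\mid X_0,X_1,U,E)\le p$ when $\mathsf A$ is passively corrupted. *Weak oblivious transfer, malicious model.* A system implements $\mathrm{WOT}(p,q)$ if (i) when nobody is corrupted, it outputs uniform independent bits $X_0,X_1$ to $\mathsf A$ and $(C,X_C)$ to $\mathsf B$,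 with $C$ uniform and independent of $(X_0,X_1)$; (ii) for every strategy by which an actively corrupted $\mathsf B$ interacts with the system, the output $(X_0,X_1)$ that the honest $\mathsf A$ gets after the interaction satisfies $\mathrm{PredAdv}(X_0\oplus X_1\mid V)\le q$, where $V$ is the transcript of the interaction; (iii) for every strategy by which an actively corrupted $\mathsf A$ interacts with the system, the output $(C,Y)$ that the honest $\mathsf B$ gets after the interaction satisfies $\mathrm{PredAdv}(C\mid U)\le p$, where $U$ is the transcript. *Protocols.* A protocol uses $n$ independent instances of weak oblivious transfer in parallel and a noiseless two-way communication channel; the players may toss coins. It is itself regarded as a system. In the semi-honest model a passively corrupted player follows the protocol, and his auxiliary output is his whole view: outputs and auxiliary outputs of the instances, coins, and messages. In the malicious model an actively corrupted player has arbitrary, concurrent and adaptive access to all his interfaces of the instances and of the channel. Corrupted players are computationally unbounded. **Theorem.** Let $p,q:\mathbb N\to[0,1]$ be functions computable in time $\mathrm{poly}(k)$ (as real numbers: an approximation up to $2^{-m}$ is found in time $\mathrm{poly}(k+m)$) such that $p(k)+q(k)<1$ for all $k$. Then there is a uniform family of protocols, one for each $k$, the same for both models, which uses a number $$n(k)\le\frac{2\,k^2}{(1-p(k)-q(k))^4}$$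 of instances of weak oblivious transfer such that, for every $k$: * if all instances implement $\mathrm{WOT}(p(k),q(k))$ in the semi-honest model, then the protocol implements $\mathrm{WOT}(2^{-k},2^{-k})$ in the semi-honest model; * if all instances implement $\mathrm{WOT}(p(k),q(k))$ in the malicious model, then the protocol implements $\mathrm{WOT}(2^{-k},2^{-k})$ in the malicious model. The family is efficient: fixed programs (the same for all $k$) compute $n(k)$, the number of rounds, the number of coins, and all messages and outputs of the honest players, in time polynomial in $k+n(k)$. (Hence the protocol runs in time $\mathrm{poly}(k)$ whenever $1/(1-p(k)-q(k))$ is polynomially bounded.) -/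

import Mathlib

namespace WeakOT

noncomputable section

/-! ## A machine model with a step count

A random access machine with the usual arithmetic instructions and *logarithmic* cost: each
instruction is charged the bit length of the numbers it reads.  Since every number that is written
is at most as long as the total cost spent so far plus the input, polynomial time on this machine is
the same as polynomial time on a Turing machine. -/

/-- Structured programs over registers `0, 1, 2, …` which hold natural numbers. -/
inductive Prog : Type
  /-- `r x := c` -/
  | const (x c : ℕ)
  /-- `r x := r y + r z` -/
  | add (x y z : ℕ)
  /-- `r x := r y - r z`, truncated at `0` -/
  | sub (x y z : ℕ)
  /-- `r x := r y * r z` -/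
  | mul (x y z : ℕ)
  /-- `r x := r y / r z`, rounded down -/
  | div (x y z : ℕ)
  /-- first `P`, then `Q` -/
  | seq (P Q : Prog)
  /-- if `r x ≠ 0` then `P` else `Q` -/
  | branch (x : ℕ) (P Q : Prog)
  /-- while `r x ≠ 0` do `P` -/
  | loop (x : ℕ) (P : Prog)

/-- `P.Runs s s' t`: started with register contents `s`, the program `P` halts with register
contents `s'` at total cost `t`.  (`Nat.size` is the bit length.) -/
inductive Prog.Runs : Prog → (ℕ → ℕ) → (ℕ → ℕ) → ℕ → Prop
  | const (x c : ℕ) (s : ℕ → ℕ) :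
      Prog.Runs (.const x c) s (Function.update s x c) (1 + Nat.size c)
  | add (x y z : ℕ) (s : ℕ → ℕ) :
      Prog.Runs (.add x y z) s (Function.update s x (s y + s z))
        (1 + Nat.size (s y) + Nat.size (s z))
  | sub (x y z : ℕ) (s : ℕ → ℕ) :
      Prog.Runs (.sub x y z) s (Function.update s x (s y - s z))
        (1 + Nat.size (s y) + Nat.size (s z))
  | mul (x y z : ℕ) (s : ℕ → ℕ) :
      Prog.Runs (.mul x y z) s (Function.update s x (s y * s z))
        (1 + Nat.size (s y) + Nat.size (s z))
  | div (x y z : ℕ) (s : ℕ → ℕ) :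
      Prog.Runs (.div x y z) s (Function.update s x (s y / s z))
        (1 + Nat.size (s y) + Nat.size (s z))
  | seq {P Q : Prog} {s s' s'' : ℕ → ℕ} {t t' : ℕ} (h : Prog.Runs P s s' t)
      (h' : Prog.Runs Q s' s'' t') : Prog.Runs (.seq P Q) s s'' (t + t')
  | branch_pos {x : ℕ} {P Q : Prog} {s s' : ℕ → ℕ} {t : ℕ} (hx : s x ≠ 0)
      (h : Prog.Runs P s s' t) : Prog.Runs (.branch x P Q) s s' (1 + Nat.size (s x) + t)
  | branch_zero {x : ℕ} {P Q : Prog} {s s' : ℕ → ℕ} {t : ℕ} (hx : s x = 0)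
      (h : Prog.Runs Q s s' t) : Prog.Runs (.branch x P Q) s s' (1 + t)
  | loop_stop {x : ℕ} {P : Prog} {s : ℕ → ℕ} (hx : s x = 0) : Prog.Runs (.loop x P) s s 1
  | loop_step {x : ℕ} {P : Prog} {s s' s'' : ℕ → ℕ} {t t' : ℕ} (hx : s x ≠ 0)
      (h : Prog.Runs P s s' t) (h' : Prog.Runs (.loop x P) s' s'' t') :
      Prog.Runs (.loop x P) s s'' (1 + Nat.size (s x) + t + t')

/-- On the given input (in registers `0, 1, …`, all other registers being `0`) the program halts
at cost at most `time` with `output` in register `0`. -/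
def Prog.Computes (P : Prog) (input : List ℕ) (output time : ℕ) : Prop :=
  ∃ (s : ℕ → ℕ) (t : ℕ), P.Runs (fun i => input.getD i 0) s t ∧ s 0 = output ∧ t ≤ time

/-- A bit string as a natural number: its bits, least significant first, below a leading `1`. -/
def encodeBits : List Bool → ℕ
  | [] => 1
  | b :: l => 2 * encodeBits l + b.toNat

/-- A list of pairs of bits as a natural number. -/
def encodePairs (l : List (Bool × Bool)) : ℕ :=
  encodeBits (l.flatMap fun x => [x.1, x.2])

/-- A function `p : ℕ → ℝ` with nonnegative values is computable in time `poly(k)`: some program,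
given `k` and a precision `m`, finds in time polynomial in `k + m` a dyadic number `a / 2 ^ m` at
distance at most `2 ^ (-m)` from `p k`. -/
def PolyTimeComputable (p : ℕ → ℝ) : Prop :=
  ∃ (P : Prog) (poly : Polynomial ℕ), ∀ k m : ℕ, ∃ a : ℕ,
    P.Computes [k, m] a (poly.eval (k + m)) ∧ |(a : ℝ) / 2 ^ m - p k| ≤ 1 / 2 ^ m

/-! ## Discrete probability -/

/-- The probability of an event, as a real number. -/
def prob {α : Type} (μ : PMF α) (s : Set α) : ℝ := (μ.toOuterMeasure s).toReal

/-- The maximal bit-prediction advantage of the bit `X` from `Y`,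
`2 * max_f Pr[f(Y) = X] - 1`, where `X` and `Y` are random variables on the probability space `μ`. -/
def predAdv {α β : Type} (μ : PMF α) (X : α → Bool) (Y : α → β) : ℝ :=
  2 * (⨆ f : β → Bool, prob μ {a | f (Y a) = X a}) - 1

/-- The product distribution of `n` distributions: independent samples. -/
def prodPMF : {n : ℕ} → {α : Fin n → Type} → ((j : Fin n) → PMF (α j)) → PMF ((j : Fin n) → α j)
  | 0, _, _ => PMF.pure fun j => j.elim0
  | _ + 1, _, μ => (μ 0).bind fun x => (prodPMF fun j => μ j.succ).map fun y => Fin.cons x y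

/-- `n` independent uniform bits, as a list. -/
def coins (n : ℕ) : PMF (List Bool) :=
  (PMF.uniformOfFintype (Fin n → Bool)).map List.ofFn

/-! ## Weak oblivious transfer in the semi-honest model -/

/-- The joint output `((x₀, x₁), (c, y))`: the sender `A` gets `(x₀, x₁)`, the receiver `B` gets
`(c, y)`. -/
abbrev Output : Type := (Bool × Bool) × (Bool × Bool)

/-- `x_c` -/
def sel (x : Bool × Bool) (c : Bool) : Bool := bif c then x.2 else x.1

/-- The error bit `e = x_c ⊕ y`. -/
def err (o : Output) : Bool := xor (sel o.1 o.2.1) o.2.2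

/-- A collection of systems (without inputs) in the semi-honest model.  If a player is passively
corrupted, the system gives him an additional auxiliary output. -/
structure SemiHonestSystem : Type 1 where
  /-- auxiliary outputs to a passively corrupted `A` -/
  AuxA : Type
  /-- auxiliary outputs to a passively corrupted `B` -/
  AuxB : Type
  /-- nobody is corrupted -/
  honest : PMF Output
  /-- `A` is passively corrupted -/
  corruptA : PMF (Output × AuxA)
  /-- `B` is passively corrupted -/
  corruptB : PMF (Output × AuxB)

/-- The system implements weak oblivious transfer `WOT(p, q, ε)` in the semi-honest model.
The view of a corrupted player consists of his regular and his auxiliary output. -/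
structure SemiHonestSystem.IsWOT (F : SemiHonestSystem) (p q ε : ℝ) : Prop where
  correct : prob F.honest {o | err o = true} ≤ ε
  secureA : predAdv F.corruptB (fun w => sel w.1.1 (!w.1.2.1))
    (fun w => ((w.1.2, w.2), err w.1)) ≤ q
  secureB : predAdv F.corruptA (fun w => w.1.2.1)
    (fun w => ((w.1.1, w.2), err w.1)) ≤ p

/-! ## Interactive systems and weak oblivious transfer in the malicious model -/

/-- An interactive system facing an actively corrupted player, which finally gives an output in `R`
to the honest player, after the last message from the corrupted player.  `S` is the type of its
current hidden internal state.  The choice between sending and receiving and the message alphabets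
may depend on all messages exchanged so far. -/
inductive Sys (R : Type) : Type → Type 1
  /-- The interaction is over; give an output to the honest player. -/
  | result {S : Type} (out : S → PMF R) : Sys R S
  /-- Send a message from `O` to the corrupted player and move to a new internal state in `T`. -/
  | send {S : Type} (O T : Type) (step : S → PMF (O × T)) (next : O → Sys R T) : Sys R S
  /-- Wait for a message from `I` from the corrupted player. -/
  | recv {S : Type} (I : Type) (ne : Nonempty I) (next : I → Sys R S) : Sys R S

namespace Sys

/-- The possible transcripts of the complete interaction with the corrupted player. -/
def Transcript {R : Type} : {S : Type} → Sys R S → Type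
  | _, result _ => Unit
  | _, send O _ _ next => Σ o : O, Transcript (next o)
  | _, recv I _ next => Σ i : I, Transcript (next i)

/-- The (computationally unbounded, randomized) strategies of the corrupted player: each of his
messages may depend on everything exchanged so far. -/
def Strategy {R : Type} : {S : Type} → Sys R S → Type
  | _, result _ => Unit
  | _, send O _ _ next => (o : O) → Strategy (next o)
  | _, recv I _ next => PMF I × ((i : I) → Strategy (next i))

/-- The joint distribution of the transcript and of the honest player's output, if the corrupted
player follows the strategy `σ` and the internal state is `s` at the beginning. -/
def run {R : Type} : {S : Type} → (F : Sys R S) → F.Strategy → S → PMF (F.Transcript × R)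
  | _, result out, _, s => (out s).map fun r => ((), r)
  | _, send _ _ step next, σ, s =>
      (step s).bind fun x => ((next x.1).run (σ x.1) x.2).map fun w => (⟨x.1, w.1⟩, w.2)
  | _, recv _ _ next, σ, s =>
      σ.1.bind fun i => ((next i).run (σ.2 i) s).map fun w => (⟨i, w.1⟩, w.2)

/-- Draw the internal state at random from an element of `S'`. -/
def pre {R : Type} {S S' : Type} (h : S' → PMF S) : Sys R S → Sys R S'
  | result out => result fun s => (h s).bind out
  | send O T step next => send O T (fun s => (h s).bind step) next
  | recv I ne next => recv I ne fun i => pre h (next i)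

/-- Run `F`; its output is not given away but becomes the internal state in which `G` starts. -/
def andThen {R R' : Type} (G : Sys R' R) : {S : Type} → Sys R S → Sys R' S
  | _, result out => G.pre out
  | _, send O T step next => send O T step fun o => andThen G (next o)
  | _, recv I ne next => recv I ne fun i => andThen G (next i)

/-- Parallel composition of a system that waits for a message (`ih i` being its parallel composition
with other systems after the message `i`) with a second system. -/
def parRecv {R₁ R₂ S₁ : Type} (I₁ : Type) (ne₁ : Nonempty I₁)
    (ih : I₁ → (S₂ : Type) → Sys R₂ S₂ → Sys (R₁ × R₂) (S₁ × S₂)) :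
    {S₂ : Type} → Sys R₂ S₂ → Sys (R₁ × R₂) (S₁ × S₂)
  | S₂, result out => recv I₁ ne₁ fun i => ih i S₂ (result out)
  | _, send O T step next =>
      send O (S₁ × T) (fun s => (step s.2).map fun x => (x.1, (s.1, x.2)))
        fun o => parRecv I₁ ne₁ ih (next o)
  | S₂, recv I₂ ne₂ next =>
      recv (I₁ ⊕ I₂) ⟨Sum.inl ne₁.some⟩
        (Sum.elim (fun i => ih i S₂ (recv I₂ ne₂ next)) fun i => parRecv I₁ ne₁ ih (next i))

/-- Parallel composition of a system that has finished with a second system. -/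
def parResult {R₁ R₂ S₁ : Type} (out₁ : S₁ → PMF R₁) :
    {S₂ : Type} → Sys R₂ S₂ → Sys (R₁ × R₂) (S₁ × S₂)
  | _, result out₂ => result fun s => (out₁ s.1).bind fun r₁ => (out₂ s.2).map fun r₂ => (r₁, r₂)
  | _, send O T step next =>
      send O (S₁ × T) (fun s => (step s.2).map fun x => (x.1, (s.1, x.2)))
        fun o => parResult out₁ (next o)
  | _, recv I ne next => recv I ne fun i => parResult out₁ (next i)

/-- Parallel composition: the two systems do not interact with each other, and use independent
randomness.  Both send their messages as soon as possible; whenever both wait for a message, the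
corrupted player decides which of them gets the next one. -/
def par {R₁ R₂ : Type} :
    {S₁ : Type} → Sys R₁ S₁ → (S₂ : Type) → Sys R₂ S₂ → Sys (R₁ × R₂) (S₁ × S₂)
  | _, result out, _, G => parResult out G
  | _, send O T step next, S₂, G =>
      send O (T × S₂) (fun s => (step s.1).map fun x => (x.1, (x.2, s.2)))
        fun o => par (next o) S₂ G
  | _, recv I ne next, _, G => parRecv I ne (fun i => par (next i)) G

/-- Parallel composition of `n` systems. -/
def parAll {R : Type} : {n : ℕ} → (Fin n → Sys R Unit) → Sys (Fin n → R) Unit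
  | 0, _ => result fun _ => PMF.pure fun j => j.elim0
  | _ + 1, F =>
      andThen (result fun r : R × _ => PMF.pure (Fin.cons r.1 r.2))
        (pre (fun _ => PMF.pure ((), ())) (par (F 0) Unit (parAll fun j => F j.succ)))

end Sys

/-- A collection of systems (without inputs for honest players) in the malicious model. -/
structure MaliciousSystem : Type 1 where
  /-- nobody is corrupted -/
  honest : PMF Output
  /-- `A` is corrupted; the honest player `B` gets `(c, y)` -/
  corruptA : Sys (Bool × Bool) Unit
  /-- `B` is corrupted; the honest player `A` gets `(x₀, x₁)` -/
  corruptB : Sys (Bool × Bool) Unit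

/-- The output of randomized oblivious transfer: `x₀, x₁, c` are uniform and independent, and
`y = x_c`. -/
def rot : PMF Output :=
  (PMF.uniformOfFintype ((Bool × Bool) × Bool)).map fun w => (w.1, (w.2, sel w.1 w.2))

/-- The system implements weak oblivious transfer `WOT(p, q)` in the malicious model. -/
structure MaliciousSystem.IsWOT (F : MaliciousSystem) (p q : ℝ) : Prop where
  correct : F.honest = rot
  secureA : ∀ σ : F.corruptB.Strategy,
    predAdv (F.corruptB.run σ ()) (fun w => xor w.2.1 w.2.2) (fun w => w.1) ≤ q
  secureB : ∀ σ : F.corruptA.Strategy,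
    predAdv (F.corruptA.run σ ()) (fun w => w.2.1) (fun w => w.1) ≤ p

/-! ## Two-party protocols -/

/-- A (uniform family of) two-party protocols that use `numWOT k` instances of weak oblivious
transfer and a communication channel.  Both players know `k`, toss their coins, and wait for their
outputs from all instances.  Then they talk over the channel: in each of the `rounds k` rounds first
`A` sends a bit to `B`, then `B` sends a bit to `A`.  All messages and outputs of a player are
functions of `k`, his outputs from the instances of weak oblivious transfer, his coins, and the
messages that he received so far. -/
structure Protocol : Type where
  numWOT : ℕ → ℕ
  rounds : ℕ → ℕ
  coinsA : ℕ → ℕ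
  coinsB : ℕ → ℕ
  msgA : (k : ℕ) → (wots : List (Bool × Bool)) → (coins received : List Bool) → Bool
  msgB : (k : ℕ) → (wots : List (Bool × Bool)) → (coins received : List Bool) → Bool
  outA : (k : ℕ) → (wots : List (Bool × Bool)) → (coins received : List Bool) → Bool × Bool
  outB : (k : ℕ) → (wots : List (Bool × Bool)) → (coins received : List Bool) → Bool × Bool

namespace Protocol

/-- The functions of a player are evaluated by one program for all `k`, at cost at most `time k`.
(`nw`, `nc`, `nr` are the numbers of the available outputs of weak oblivious transfers, of coins and
of rounds; the value `f` is given as a number by `enc`.) -/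
def PlayerComputable {γ : Type} (enc : γ → ℕ) (nw nc nr time : ℕ → ℕ)
    (f : ℕ → List (Bool × Bool) → List Bool → List Bool → γ) : Prop :=
  ∃ P : Prog, ∀ (k : ℕ) (wots : List (Bool × Bool)) (coins received : List Bool),
    wots.length = nw k → coins.length = nc k → received.length ≤ nr k →
      P.Computes [k, encodePairs wots, encodeBits coins, encodeBits received]
        (enc (f k wots coins received)) (time k)

/-- The protocol is efficient: it is executed by fixed programs (the same for all `k`) in time
polynomial in `k` and in the number of instances of weak oblivious transfer it uses. -/
def Efficient (P : Protocol) : Prop :=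
  ∃ poly : Polynomial ℕ,
    let time : ℕ → ℕ := fun k => poly.eval (k + P.numWOT k)
    (∀ k, P.rounds k ≤ time k ∧ P.coinsA k ≤ time k ∧ P.coinsB k ≤ time k) ∧
    (∃ Q : Prog, ∀ k, Q.Computes [k] (P.numWOT k) (time k)) ∧
    (∃ Q : Prog, ∀ k, Q.Computes [k] (P.rounds k) (time k)) ∧
    (∃ Q : Prog, ∀ k, Q.Computes [k] (P.coinsA k) (time k)) ∧
    (∃ Q : Prog, ∀ k, Q.Computes [k] (P.coinsB k) (time k)) ∧
    PlayerComputable Bool.toNat P.numWOT P.coinsA P.rounds time P.msgA ∧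
    PlayerComputable Bool.toNat P.numWOT P.coinsB P.rounds time P.msgB ∧
    PlayerComputable (fun x => encodePairs [x]) P.numWOT P.coinsA P.rounds time P.outA ∧
    PlayerComputable (fun x => encodePairs [x]) P.numWOT P.coinsB P.rounds time P.outB

/-- The messages (received by `A`, received by `B`) in the first `m` rounds between two honest
players with next-message functions `fA` and `fB`. -/
def talk (fA fB : List Bool → Bool) : ℕ → List Bool × List Bool
  | 0 => ([], [])
  | m + 1 =>
      let h := talk fA fB m
      let toB := h.2 ++ [fA h.1]
      (h.1 ++ [fB toB], toB)

variable (P : Protocol) (k : ℕ)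

/-- The messages between honest players with given outputs of the instances of weak oblivious
transfer and given coins. -/
def messages (w : Fin (P.numWOT k) → Output) (rA rB : List Bool) : List Bool × List Bool :=
  talk (P.msgA k (List.ofFn fun j => (w j).1) rA) (P.msgB k (List.ofFn fun j => (w j).2) rB)
    (P.rounds k)

/-- The outputs of honest players with given outputs of the instances of weak oblivious transfer
and given coins. -/
def play (w : Fin (P.numWOT k) → Output) (rA rB : List Bool) : Output :=
  (P.outA k (List.ofFn fun j => (w j).1) rA (P.messages k w rA rB).1,
   P.outB k (List.ofFn fun j => (w j).2) rB (P.messages k w rA rB).2)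

/-- The joint output of the protocol if nobody is corrupted, where `F j` is the distribution of the
outputs of the `j`th instance of weak oblivious transfer. -/
def honestRun (F : Fin (P.numWOT k) → PMF Output) : PMF Output :=
  (prodPMF F).bind fun w => (coins (P.coinsA k)).bind fun rA =>
    (coins (P.coinsB k)).map fun rB => P.play k w rA rB

/-- The protocol as a system in the semi-honest model.  A passively corrupted player follows the
protocol.  His auxiliary output consists of the outputs and auxiliary outputs that he gets from the
instances of weak oblivious transfer, of his coins, and of all messages. -/
def semiHonest (F : Fin (P.numWOT k) → SemiHonestSystem) : SemiHonestSystem where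
  AuxA := ((j : Fin (P.numWOT k)) → (Bool × Bool) × (F j).AuxA) × List Bool ×
    (List Bool × List Bool)
  AuxB := ((j : Fin (P.numWOT k)) → (Bool × Bool) × (F j).AuxB) × List Bool ×
    (List Bool × List Bool)
  honest := P.honestRun k fun j => (F j).honest
  corruptA :=
    (prodPMF fun j => (F j).corruptA).bind fun w => (coins (P.coinsA k)).bind fun rA =>
      (coins (P.coinsB k)).map fun rB =>
        (P.play k (fun j => (w j).1) rA rB,
          (fun j => ((w j).1.1, (w j).2), rA, P.messages k (fun j => (w j).1) rA rB))
  corruptB :=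
    (prodPMF fun j => (F j).corruptB).bind fun w => (coins (P.coinsA k)).bind fun rA =>
      (coins (P.coinsB k)).map fun rB =>
        (P.play k (fun j => (w j).1) rA rB,
          (fun j => ((w j).1.2, (w j).2), rB, P.messages k (fun j => (w j).1) rA rB))

/-- The honest player `A` in the last `m` rounds, after receiving the messages `h`; the internal
state consists of the outputs of the instances of weak oblivious transfer and the coins. -/
def roundsA : (m : ℕ) → (h : List Bool) → Sys (Bool × Bool) (List (Bool × Bool) × List Bool)
  | 0, h => .result fun s => PMF.pure (P.outA k s.1 s.2 h)
  | m + 1, h =>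
      .send Bool _ (fun s => PMF.pure (P.msgA k s.1 s.2 h, s)) fun _ =>
        .recv Bool ⟨true⟩ fun b => roundsA m (h ++ [b])

/-- The honest player `B` in the last `m` rounds, after receiving the messages `h`. -/
def roundsB : (m : ℕ) → (h : List Bool) → Sys (Bool × Bool) (List (Bool × Bool) × List Bool)
  | 0, h => .result fun s => PMF.pure (P.outB k s.1 s.2 h)
  | m + 1, h =>
      .recv Bool ⟨true⟩ fun a =>
        .send Bool _ (fun s => PMF.pure (P.msgB k s.1 s.2 (h ++ [a]), s)) fun _ =>
          roundsB m (h ++ [a])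

/-- The protocol as a system in the malicious model.  An actively corrupted player has direct access
to the interfaces of all the instances of weak oblivious transfer and of the channel. -/
def malicious (F : Fin (P.numWOT k) → MaliciousSystem) : MaliciousSystem where
  honest := P.honestRun k fun j => (F j).honest
  corruptA :=
    Sys.andThen
      (Sys.pre (fun w => (coins (P.coinsB k)).map fun r => (List.ofFn w, r))
        (P.roundsB k (P.rounds k) []))
      (Sys.parAll fun j => (F j).corruptA)
  corruptB :=
    Sys.andThen
      (Sys.pre (fun w => (coins (P.coinsA k)).map fun r => (List.ofFn w, r))
        (P.roundsA k (P.rounds k) []))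
      (Sys.parAll fun j => (F j).corruptB)

end Protocol

end

end WeakOT

open scoped ENNReal
namespace WeakOT

/-! ## Prediction advantage as a sum of biases -/

/-! Write `s_A = x₀ ⊕ x₁`, `z_A = x₀` for the sender and `s_B = c`, `z_B = y` for the receiver. A
transfer is free of errors iff `z_A ⊕ z_B = s_A s_B`; security says that `s_A` is hidden from the
receiver (advantage at most `q`) and `s_B` from the sender (advantage at most `p`). Two transfers
are combined into one: one player announces the difference of his two bits `s` and keeps the first
of them, the other player takes the exclusive or of his, and a correction of `z` by the announcement
restores the product relation. If the sender announces, `(p, q)` becomes `(p², 1 - (1 - q)²)`; if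
the receiver does, the roles are exchanged. The instances are combined along a balanced binary tree,
and on each level the player announces for whom the larger of the two advantages gets squared. The
gap `δ = 1 - p - q` is then multiplied by `1 + |p - q|`, and two levels square `1 - δ²`
(`one_sub_gap_sq_le`). After `2j` levels `p + q` is at most `exp (-δ² 2^j)`, so `4^j` of order `k² /
δ⁴` instances suffice. The constant is `4 (log 2)² < 2`, and the slack pays for replacing `p`, `q`
by dyadic upper bounds (`Approx.two_pow_numLevels_le`). For security, the advantage is written as a
sum of biases (`predAdv_eq`). A bit of bias at most `b` and weight at most `b + u` is treated as
known with weight `b` and uniform with weight `u` (`Dom`). Combining bits then becomes combining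
such items, and the final leakage is at most `gval`, which is linear and monotone in each item
separately (`multi_gval`, `leak_le`). This is what makes concurrent adaptive attacks harmless: a
message of one instance changes one item only, and neither its bias nor its weight grows when summed
over the possible messages, so no multilinear function grows (`Sys.bdd_par`, `Sys.Bdd.val_le`). In
the rounds that follow, the bits `s` of the honest player do not depend on what he receives
(`map_fst_qstep`), so cheating on the channel is useless too. In the semi-honest model the hidden
bits are independent given the views of the instances (`wsum_prodPMF`), and the error of the
protocol is the exclusive or of the errors of the instances (`err_play`), so that revealing it
reveals nothing beyond those. For efficiency, explicit programs are analysed. The essential point is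
that the precision needed for `p` and `q` exceeds the number of levels by at most 11
(`Approx.prec_le`), so all numbers have length polynomial in `k` and the number of instances. For `k
= 0` no instance may be used and security is void, but correct outputs are still required; a plain
exchange of coins provides them. -/

/-- The absolute difference of two extended nonnegative reals. -/
noncomputable def bias (t f : ℝ≥0∞) : ℝ≥0∞ := (t - f) + (f - t)

theorem bias_le_iff {t f b : ℝ≥0∞} : bias t f ≤ b ↔ t ≤ f + b ∧ f ≤ t + b := by
  unfold bias
  rcases le_total t f with h | h
  · rw [tsub_eq_zero_of_le h, zero_add, tsub_le_iff_left]
    exact ⟨fun h' => ⟨h.trans le_self_add, h'⟩, fun h' => h'.2⟩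
  · rw [tsub_eq_zero_of_le h, add_zero, tsub_le_iff_left]
    exact ⟨fun h' => ⟨h', h.trans le_self_add⟩, fun h' => h'.1⟩

theorem bias_comm (t f : ℝ≥0∞) : bias t f = bias f t := add_comm _ _

/-- A best guess between weights `t` and `f` is right with weight `max t f`; this identity converts
it into a bias. -/
theorem two_mul_max (t f : ℝ≥0∞) : 2 * max t f = t + f + bias t f := by
  unfold bias
  rcases le_total t f with h | h
  · rw [max_eq_right h, tsub_eq_zero_of_le h, zero_add, add_right_comm, add_tsub_cancel_of_le h,
      two_mul]
  · rw [max_eq_left h, tsub_eq_zero_of_le h, add_zero, add_assoc, add_tsub_cancel_of_le h, two_mul]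

theorem bias_le_add (t f : ℝ≥0∞) : bias t f ≤ t + f :=
  bias_le_iff.2 ⟨by rw [← add_assoc, add_comm f t, add_assoc]; exact le_self_add,
    le_add_self.trans le_add_self⟩

/-- Only an inequality: for `c = ⊤` both products can be `⊤`, and then their bias is `0`. -/
theorem bias_mul_le (c t f : ℝ≥0∞) : bias (c * t) (c * f) ≤ c * bias t f := by
  have h := bias_le_iff.1 (le_refl (bias t f))
  refine bias_le_iff.2 ⟨?_, ?_⟩ <;> rw [← mul_add]
  · exact mul_le_mul_right h.1 c
  · exact mul_le_mul_right h.2 c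

theorem bias_add_le (t f t' f' : ℝ≥0∞) : bias (t + t') (f + f') ≤ bias t f + bias t' f' := by
  have h := bias_le_iff.1 (le_refl (bias t f))
  have h' := bias_le_iff.1 (le_refl (bias t' f'))
  refine bias_le_iff.2 ⟨?_, ?_⟩
  · exact (add_le_add h.1 h'.1).trans_eq (by ring)
  · exact (add_le_add h.2 h'.2).trans_eq (by ring)

theorem bias_tsum_le {ι : Type*} (t f : ι → ℝ≥0∞) :
    bias (∑' i, t i) (∑' i, f i) ≤ ∑' i, bias (t i) (f i) := by
  refine bias_le_iff.2 ⟨?_, ?_⟩ <;> rw [← ENNReal.tsum_add]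
  · exact ENNReal.tsum_le_tsum fun i => (bias_le_iff.1 le_rfl).1
  · exact ENNReal.tsum_le_tsum fun i => (bias_le_iff.1 le_rfl).2

/-- The weight of the event that `X = x` and `Y = y`. -/
noncomputable def jointW {α β : Type} (μ : α → ℝ≥0∞) (X : α → Bool) (Y : α → β) (x : Bool) (y : β) :
    ℝ≥0∞ := by
  classical exact ∑' a, if X a = x ∧ Y a = y then μ a else 0

/-- The total bias of the bit `X` given `Y`. -/
noncomputable def advW {α β : Type} (μ : α → ℝ≥0∞) (X : α → Bool) (Y : α → β) : ℝ≥0∞ :=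
  ∑' y, bias (jointW μ X Y true y) (jointW μ X Y false y)

section
variable {α β : Type} (μ : PMF α) (X : α → Bool) (Y : α → β)

theorem prob_eq_tsum_jointW (f : β → Bool) :
    prob μ {a | f (Y a) = X a} = (∑' y, jointW μ X Y (f y) y).toReal := by
  classical
  unfold prob jointW
  rw [PMF.toOuterMeasure_apply, ENNReal.tsum_comm]
  congr 1
  refine tsum_congr fun a => ?_
  rw [tsum_eq_single (Y a) (fun y hy => by simp [hy.symm])]
  simp [Set.indicator_apply, eq_comm]

theorem tsum_jointW_add : ∑' y, (jointW μ X Y true y + jointW μ X Y false y) = 1 := by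
  classical
  unfold jointW
  simp_rw [← ENNReal.tsum_add]
  rw [ENNReal.tsum_comm, ← μ.tsum_coe]
  refine tsum_congr fun a => ?_
  rw [tsum_eq_single (Y a) (fun y hy => by simp [hy.symm])]
  cases X a <;> simp

theorem two_mul_tsum_max : 2 * ∑' y, max (jointW μ X Y true y) (jointW μ X Y false y)
    = 1 + advW μ X Y := by
  rw [← ENNReal.tsum_mul_left]
  simp_rw [two_mul_max]
  rw [ENNReal.tsum_add, tsum_jointW_add]; rfl

theorem advW_le_one : advW μ X Y ≤ 1 := by
  rw [← tsum_jointW_add μ X Y]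
  exact ENNReal.tsum_le_tsum fun y => bias_le_add _ _

/-- The supremum over predictors is attained by guessing the likelier value for each `y` separately.
-/
theorem predAdv_eq : predAdv μ X Y = (advW μ X Y).toReal := by
  classical
  have hfin : advW μ X Y ≠ ⊤ := ne_top_of_le_ne_top ENNReal.one_ne_top (advW_le_one μ X Y)
  have h2 := two_mul_tsum_max μ X Y
  set S := ∑' y, max (jointW μ X Y true y) (jointW μ X Y false y) with hS
  have hSfin : S ≠ ⊤ := by
    intro h
    rw [h] at h2
    have : (1 + advW μ X Y) ≠ ⊤ := ENNReal.add_ne_top.2 ⟨ENNReal.one_ne_top, hfin⟩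
    exact this (by rw [← h2]; simp)
  have hle : ∀ f : β → Bool, prob μ {a | f (Y a) = X a} ≤ S.toReal := by
    intro f
    rw [prob_eq_tsum_jointW]
    refine ENNReal.toReal_mono hSfin (ENNReal.tsum_le_tsum fun y => ?_)
    cases f y
    · exact le_max_right _ _
    · exact le_max_left _ _
  have hsup : (⨆ f : β → Bool, prob μ {a | f (Y a) = X a}) = S.toReal := by
    refine le_antisymm (ciSup_le hle) ?_
    refine le_ciSup_of_le ⟨S.toReal, by rintro _ ⟨f, rfl⟩; exact hle f⟩
      (fun y => decide (jointW μ X Y false y ≤ jointW μ X Y true y)) ?_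
    rw [prob_eq_tsum_jointW μ X Y fun y => decide (jointW μ X Y false y ≤ jointW μ X Y true y), hS]
    refine (congrArg ENNReal.toReal ?_).le
    refine tsum_congr fun y => ?_
    by_cases h : jointW μ X Y false y ≤ jointW μ X Y true y
    · simp [h]
    · simp [h, le_of_not_ge h]
  unfold predAdv
  rw [hsup]
  have h3 := congrArg ENNReal.toReal h2
  rw [ENNReal.toReal_mul, ENNReal.toReal_add ENNReal.one_ne_top hfin] at h3
  simp at h3
  linarith

theorem predAdv_le_iff {q : ℝ} (hq : 0 ≤ q) :
    predAdv μ X Y ≤ q ↔ advW μ X Y ≤ ENNReal.ofReal q := by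
  rw [predAdv_eq, ENNReal.le_ofReal_iff_toReal_le
    (ne_top_of_le_ne_top ENNReal.one_ne_top (advW_le_one μ X Y)) hq]

theorem predAdv_le_one : predAdv μ X Y ≤ 1 :=
  (predAdv_le_iff μ X Y zero_le_one).2 (by simpa using advW_le_one μ X Y)

end

/-- Less information gives a smaller advantage, and a bit that is masked by known information is as
hard to predict as the bit itself. -/
theorem advW_le_of_comp {α β γ : Type} (μ : α → ℝ≥0∞) (X X' : α → Bool) (Y : α → β) (Z : α → γ)
    (h : γ → β) (e : γ → Bool) (hY : ∀ a, μ a ≠ 0 → Y a = h (Z a))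
    (hX : ∀ a, μ a ≠ 0 → X a = xor (X' a) (e (Z a))) :
    advW μ X Y ≤ advW μ X' Z := by
  classical
  -- A value of `Y` collects whole cells of `Z`, and inside a cell the mask `e` is constant. Merging
  -- cells can only cancel biases, and a mask only exchanges the two values, under which the bias is
  -- symmetric.
  have key : ∀ (x : Bool) (y : β),
      jointW μ X Y x y = ∑' z, if h z = y then jointW μ X' Z (xor x (e z)) z else 0 := by
    intro x y
    have : ∀ z, (if h z = y then jointW μ X' Z (xor x (e z)) z else 0)
        = ∑' a, if h z = y ∧ X' a = xor x (e z) ∧ Z a = z then μ a else 0 := by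
      intro z; unfold jointW; by_cases hz : h z = y <;> simp [hz]
    simp_rw [this]
    rw [ENNReal.tsum_comm]
    unfold jointW
    refine tsum_congr fun a => ?_
    rw [tsum_eq_single (Z a) (fun z hz => by simp [hz.symm])]
    by_cases ha : μ a = 0
    · simp [ha]
    · rw [hY a ha, hX a ha]
      refine if_congr ?_ rfl rfl
      cases X' a <;> cases e (Z a) <;> cases x <;> simp
  unfold advW
  simp_rw [key]
  calc _ ≤ ∑' y, ∑' z, bias (if h z = y then jointW μ X' Z (xor true (e z)) z else 0)
        (if h z = y then jointW μ X' Z (xor false (e z)) z else 0) :=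
        ENNReal.tsum_le_tsum fun y => bias_tsum_le _ _
    _ = _ := by
        rw [ENNReal.tsum_comm]
        refine tsum_congr fun z => ?_
        rw [tsum_eq_single (h z) (fun y hy => by simp [hy.symm, bias])]
        cases e z <;> simp [bias_comm]

end WeakOT

open scoped ENNReal
namespace WeakOT

/-! ## Combining bits whose biases are bounded -/

/-- A pair `(b, u)` stands for a bit which is known with weight `b` and uniform with weight `u`. -/
abbrev Item : Type := ℝ≥0∞ × ℝ≥0∞

/-- The weights of the two values of a bit are at least as balanced as the item `x` tells. -/
structure Dom (ν : Bool → ℝ≥0∞) (x : Item) : Prop where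
  bias_le : bias (ν true) (ν false) ≤ x.1
  mass_le : ν true + ν false ≤ x.1 + x.2

/-- The item of the bit that results from two bits: the first bit if their exclusive or is
announced, and otherwise their exclusive or. -/
noncomputable def Item.comb (ann : Bool) (x y : Item) : Item :=
  bif ann then (x.1 * y.1 + x.1 * y.2 + x.2 * y.1, x.2 * y.2)
  else (x.1 * y.1, x.1 * y.2 + x.2 * y.1 + x.2 * y.2)

theorem Item.comb_mass (ann : Bool) (x y : Item) :
    (Item.comb ann x y).1 + (Item.comb ann x y).2 = (x.1 + x.2) * (y.1 + y.2) := by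
  cases ann <;> simp only [Item.comb, cond_true, cond_false] <;> ring

/-- A linear function of an item, nondecreasing in the bias and in the total weight. -/
def Lin (h : Item → ℝ≥0∞) : Prop :=
  ∃ α β : ℝ≥0∞, ∀ x, h x = α * x.1 + β * (x.1 + x.2)

/-- A linear function sees a family of items only through the sums of their biases and of their
weights. This replaces the conditional expectation of a potential. -/
theorem Lin.tsum_le {h : Item → ℝ≥0∞} (hh : Lin h) {ι : Type*} (y : ι → Item) (x : Item)
    (h₁ : ∑' i, (y i).1 ≤ x.1) (h₂ : ∑' i, ((y i).1 + (y i).2) ≤ x.1 + x.2) :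
    ∑' i, h (y i) ≤ h x := by
  obtain ⟨α, β, hαβ⟩ := hh
  simp_rw [hαβ]
  rw [ENNReal.tsum_add, ENNReal.tsum_mul_left, ENNReal.tsum_mul_left]
  gcongr

/-- Weights multiply under `Item.comb`. The new bias is `x.1 * y.1` without an announcement, and
`x.1 * (y.1 + y.2) + x.2 * y.1` with one; both have nonnegative coefficients in the bias and weight
of `y`. -/
theorem Lin.comb_right {h : Item → ℝ≥0∞} (hh : Lin h) (ann : Bool) (x : Item) :
    Lin fun y => h (Item.comb ann x y) := by
  obtain ⟨α, β, hαβ⟩ := hh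
  cases ann
  · refine ⟨α * x.1, β * (x.1 + x.2), fun y => ?_⟩
    simp only [hαβ, Item.comb_mass]; simp only [Item.comb, cond_false]; ring
  · refine ⟨α * x.2, α * x.1 + β * (x.1 + x.2), fun y => ?_⟩
    simp only [hαβ, Item.comb_mass]; simp only [Item.comb, cond_true]; ring

theorem Item.comb_comm (ann : Bool) (x y : Item) : Item.comb ann x y = Item.comb ann y x := by
  cases ann <;> simp only [Item.comb, cond_true, cond_false, Prod.mk.injEq] <;>
    constructor <;> ring

theorem Lin.comb_left {h : Item → ℝ≥0∞} (hh : Lin h) (ann : Bool) (y : Item) :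
    Lin fun x => h (Item.comb ann x y) := by
  simp_rw [Item.comb_comm ann _ y]
  exact hh.comb_right ann y

/-- `G` is linear and monotone in each of the `n` entries of a list. -/
def Multi : ℕ → (List Item → ℝ≥0∞) → Prop
  | 0, _ => True
  | n + 1, G => (∀ x, Multi n fun xs => G (x :: xs)) ∧
      ∀ xs : List Item, xs.length = n → Lin fun x => G (x :: xs)

/-- `Multi` peels entries off the front, whereas the queue receives its new entry at the back. -/
theorem Multi.snoc : ∀ {n : ℕ} {G : List Item → ℝ≥0∞}, Multi (n + 1) G →
    (∀ c, Multi n fun r => G (r ++ [c])) ∧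
      ∀ r : List Item, r.length = n → Lin fun c => G (r ++ [c])
  | 0, G, h => ⟨fun _ => trivial, fun r hr => by
      rw [List.length_eq_zero_iff.1 hr]; exact h.2 [] rfl⟩
  | n + 1, G, h => by
      refine ⟨fun c => ⟨fun x => ((h.1 x).snoc).1 c, fun xs hxs => ?_⟩, fun r hr => ?_⟩
      · exact h.2 (xs ++ [c]) (by simp [hxs])
      · match r, hr with
        | x :: r, hr => exact (h.1 x).snoc.2 r (by simpa using hr)

/-- The weight with which the final bit is known, if the bits in a queue are combined one after the
other as told by `γ`. -/
noncomputable def gval : (ℕ → Bool) → ℕ → List Item → ℝ≥0∞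
  | _, 0, X => (X.headD 0).1
  | γ, m + 1, x :: y :: r => gval (fun i => γ (i + 1)) m (r ++ [Item.comb (γ 0) x y])
  | _, _ + 1, _ => 0

/-- The first two items enter only through the combined item at the end of the queue, in which the
rest is linear by induction. -/
theorem multi_gval : ∀ (m : ℕ) (γ : ℕ → Bool), Multi (m + 1) (gval γ m)
  | 0, γ => ⟨fun _ => trivial, fun xs _ => ⟨1, 0, fun x => by simp [gval]⟩⟩
  | m + 1, γ => by
      have ih := (multi_gval m fun i => γ (i + 1)).snoc
      refine ⟨fun x => ⟨fun y => ih.1 _, fun r hr => (ih.2 r hr).comb_right (γ 0) x⟩,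
        fun xs hxs => ?_⟩
      match xs, hxs with
      | y :: r, hr => exact (ih.2 r (by simpa using hr)).comb_left (γ 0) y

/-! ## Expectations with respect to product weights -/

/-- The sum of the values of `f` at the lists with entries weighted by the given weights. -/
noncomputable def eprod {R : Type} : List (R → ℝ≥0∞) → (List R → ℝ≥0∞) → ℝ≥0∞
  | [], f => f []
  | ν :: r, f => ∑' s, ν s * eprod r fun l => f (s :: l)

theorem eprod_snoc {R : Type} (ν : R → ℝ≥0∞) : ∀ (r : List (R → ℝ≥0∞)) (f : List R → ℝ≥0∞),
    eprod (r ++ [ν]) f = eprod r fun l => ∑' s, ν s * f (l ++ [s])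
  | [], f => rfl
  | ρ :: r, f => by
      change ∑' s, ρ s * eprod (r ++ [ν]) _ = ∑' s, ρ s * eprod r _
      simp_rw [eprod_snoc ν r]; rfl

theorem eprod_tsum {R : Type} {ι : Type*} : ∀ (r : List (R → ℝ≥0∞)) (f : ι → List R → ℝ≥0∞),
    eprod r (fun l => ∑' i, f i l) = ∑' i, eprod r (f i)
  | [], f => rfl
  | ρ :: r, f => by
      change ∑' s, ρ s * eprod r _ = ∑' i, ∑' s, ρ s * eprod r _
      rw [ENNReal.tsum_comm]
      simp_rw [eprod_tsum r, ENNReal.tsum_mul_left]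

theorem eprod_mul {R : Type} : ∀ (r : List (R → ℝ≥0∞)) (c : ℝ≥0∞) (f : List R → ℝ≥0∞),
    eprod r (fun l => c * f l) = c * eprod r f
  | [], c, f => rfl
  | ρ :: r, c, f => by
      change ∑' s, ρ s * eprod r _ = c * ∑' s, ρ s * eprod r _
      rw [← ENNReal.tsum_mul_left]
      simp_rw [eprod_mul r, mul_left_comm c]

/-- The weights of the values of the bit `β`. -/
noncomputable def bitW {R : Type} (β : R → Bool) (ν : R → ℝ≥0∞) (b : Bool) : ℝ≥0∞ :=
  ∑' r, if β r = b then ν r else 0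

theorem eprod_map {R : Type} (β : R → Bool) : ∀ (νs : List (R → ℝ≥0∞)) (f : List Bool → ℝ≥0∞),
    eprod νs (fun l => f (l.map β)) = eprod (νs.map (bitW β)) f
  | [], f => rfl
  | ν :: νs, f => by
      change ∑' s, ν s * eprod νs (fun l => f (β s :: l.map β)) = ∑' b, bitW β ν b * _
      simp_rw [fun s => eprod_map β νs fun l => f (β s :: l), bitW, ← ENNReal.tsum_mul_right]
      rw [ENNReal.tsum_comm]
      refine tsum_congr fun s => ?_
      rw [tsum_eq_single (β s) (fun b hb => by simp [hb.symm])]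
      simp

/-! ## Leaking the differences of bits -/

/-- The announced difference of the first two bits in the queue. -/
def smsg (ann : Bool) : List Bool → Bool
  | s :: t :: _ => ann && xor s t
  | _ => false

/-- The first two bits in the queue are combined, and the new bit is put at the end. -/
def sstep (ann : Bool) : List Bool → List Bool
  | s :: t :: r => r ++ [bif ann then s else xor s t]
  | l => l

/-- The total bias of the final bit after `m` announcements, where `L` gives the expectations with
respect to the weight of the queue. -/
noncomputable def leak : (ℕ → Bool) → ℕ → ((List Bool → ℝ≥0∞) → ℝ≥0∞) → ℝ≥0∞
  | _, 0, L => bias (L fun l => if l.headD false = true then 1 else 0)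
      (L fun l => if l.headD false = false then 1 else 0)
  | γ, m + 1, L => ∑' d : Bool, leak (fun i => γ (i + 1)) m fun f =>
      L fun l => if smsg (γ 0) l = d then f (sstep (γ 0) l) else 0

/-- The weight of the new bit if `d` is announced. -/
noncomputable def combW (ann : Bool) (ν ρ : Bool → ℝ≥0∞) (d s : Bool) : ℝ≥0∞ :=
  bif ann then ν s * ρ (xor s d)
  else bif d then 0 else ν true * ρ (!s) + ν false * ρ s

theorem bias_dest {t f b : ℝ≥0∞} (h : bias t f ≤ b) (hft : f ≤ t) : ∃ e ≤ b, t = f + e :=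
  ⟨t - f, tsub_le_iff_left.2 (bias_le_iff.1 h).1, (add_tsub_cancel_of_le hft).symm⟩

/-- The difference of the two weights of an exclusive or is the product `(t - f) (t' - f')` up to
sign. By symmetry `f ≤ t` and `f' ≤ t'` may be assumed, which avoids truncated differences. -/
theorem bias_xor_le {t f b t' f' b' : ℝ≥0∞} (h : bias t f ≤ b) (h' : bias t' f' ≤ b') :
    bias (t * f' + f * t') (t * t' + f * f') ≤ b * b' := by
  wlog hft : f ≤ t generalizing t f
  · have := this (t := f) (f := t) (by rwa [bias_comm]) (le_of_not_ge hft)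
    rwa [bias_comm, add_comm (f * t'), add_comm (f * f')] at this
  wlog hft' : f' ≤ t' generalizing t' f'
  · have := this (t' := f') (f' := t') (by rwa [bias_comm]) (le_of_not_ge hft')
    rwa [bias_comm] at this
  obtain ⟨e, he, rfl⟩ := bias_dest h hft
  obtain ⟨e', he', rfl⟩ := bias_dest h' hft'
  have hee : e * e' ≤ b * b' := mul_le_mul' he he'
  refine bias_le_iff.2 ⟨?_, ?_⟩
  · calc (f + e) * f' + f * (f' + e') ≤ (f + e) * f' + f * (f' + e') + (e * e' + b * b') :=
          le_self_add
      _ = _ := by ring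
  · calc (f + e) * (f' + e') + f * f' = (f + e) * f' + f * (f' + e') + e * e' := by ring
      _ ≤ _ := by gcongr

/-- The two summands belong to the announcements "equal" and "different". With `t = f + e` and `t' =
f' + e'` the biases are `f e' + e f' + e e'` and `|e f' - f e'|`, whose sum is the maximum of `e (t'
+ f')` and `(t + f) e'`: the announced difference reduces the pair to whichever bit is known better.
-/
theorem bias_or_le {t f b m t' f' b' m' : ℝ≥0∞} (h : bias t f ≤ b) (h' : bias t' f' ≤ b')
    (hm : t + f ≤ m) (hm' : t' + f' ≤ m') {B : ℝ≥0∞} (hB : b * m' ≤ B) (hB' : m * b' ≤ B) :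
    bias (t * t') (f * f') + bias (t * f') (f * t') ≤ B := by
  wlog hft : f ≤ t generalizing t f
  · have := this (t := f) (f := t) (by rwa [bias_comm]) (by rwa [add_comm]) (le_of_not_ge hft)
    rwa [bias_comm (f * t'), bias_comm (f * f'), add_comm] at this
  wlog hft' : f' ≤ t' generalizing t' f'
  · have := this (t' := f') (f' := t') (by rwa [bias_comm]) (by rwa [add_comm]) (le_of_not_ge hft')
    rwa [add_comm] at this
  obtain ⟨e, he, rfl⟩ := bias_dest h hft
  obtain ⟨e', he', rfl⟩ := bias_dest h' hft'
  have h1 : bias ((f + e) * (f' + e')) (f * f') ≤ f * e' + e * f' + e * e' :=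
    bias_le_iff.2 ⟨by ring_nf; exact le_rfl, by
      calc f * f' ≤ f * f' + ((f * e' + e * f' + e * e') + (f * e' + e * f' + e * e')) :=
            le_self_add
        _ = _ := by ring⟩
  have h2 : bias ((f + e) * f') (f * (f' + e')) ≤ bias (e * f') (f * e') := by
    have := bias_add_le (f * f') (f * f') (e * f') (f * e')
    rw [show bias (f * f') (f * f') = 0 by simp [bias], zero_add] at this
    rwa [add_mul, mul_add]
  refine (add_le_add h1 h2).trans ?_
  rcases le_total (f * e') (e * f') with hle | hle
  · obtain ⟨g, hg⟩ := exists_add_of_le hle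
    have h3 : bias (e * f') (f * e') ≤ g := bias_le_iff.2 ⟨hg.le, hle.trans le_self_add⟩
    calc _ ≤ f * e' + e * f' + e * e' + g := by gcongr
      _ = e * f' + (f * e' + g) + e * e' := by ring
      _ = e * (f' + e' + f') := by rw [← hg]; ring
      _ ≤ b * m' := by gcongr
      _ ≤ B := hB
  · obtain ⟨g, hg⟩ := exists_add_of_le hle
    have h3 : bias (e * f') (f * e') ≤ g := bias_le_iff.2 ⟨hle.trans le_self_add, hg.le⟩
    calc _ ≤ f * e' + e * f' + e * e' + g := by gcongr
      _ = f * e' + (e * f' + g) + e * e' := by ring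
      _ = (f + e + f) * e' := by rw [← hg]; ring
      _ ≤ m * b' := by gcongr
      _ ≤ B := hB'

/-- An item that describes given weights exactly. -/
noncomputable def itemOf (t f : ℝ≥0∞) : Item := (bias t f, 2 * min t f)

theorem itemOf_mass (t f : ℝ≥0∞) : (itemOf t f).1 + (itemOf t f).2 = t + f := by
  unfold itemOf bias
  rcases le_total t f with h | h
  · simp only [min_eq_left h, tsub_eq_zero_of_le h, zero_add]
    conv_rhs => rw [← add_tsub_cancel_of_le h]
    ring
  · simp only [min_eq_right h, tsub_eq_zero_of_le h, add_zero]
    conv_rhs => rw [← add_tsub_cancel_of_le h]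
    ring

theorem dom_itemOf (ν : Bool → ℝ≥0∞) : Dom ν (itemOf (ν true) (ν false)) :=
  ⟨le_rfl, (itemOf_mass _ _).ge⟩

/-- An announced pair is bounded as if it were known as soon as one of its bits is; an exclusive or
is known only if both are. -/
theorem combW_bias {ν ρ : Bool → ℝ≥0∞} {x y : Item} (hx : Dom ν x) (hy : Dom ρ y) (ann : Bool) :
    ∑' d, bias (combW ann ν ρ d true) (combW ann ν ρ d false) ≤ (Item.comb ann x y).1 := by
  rw [tsum_bool]
  cases ann
  · simpa [combW, Item.comb, bias] using bias_xor_le hx.bias_le hy.bias_le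
  · simp only [combW, Item.comb, cond_true, Bool.xor_false, Bool.xor_true, Bool.not_true,
      Bool.not_false]
    refine bias_or_le hx.bias_le hy.bias_le hx.mass_le hy.mass_le ?_ ?_
    · rw [mul_add]; exact le_self_add
    · rw [add_mul, add_right_comm]; exact le_self_add

theorem combW_mass {ν ρ : Bool → ℝ≥0∞} {x y : Item} (hx : Dom ν x) (hy : Dom ρ y) (ann : Bool) :
    ∑' d, (combW ann ν ρ d true + combW ann ν ρ d false) ≤
      (Item.comb ann x y).1 + (Item.comb ann x y).2 := by
  rw [Item.comb_mass, tsum_bool]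
  refine le_trans (le_of_eq ?_) (mul_le_mul' hx.mass_le hy.mass_le)
  cases ann <;> simp [combW] <;> ring

/-- Restricting to an announcement `d` touches only the first two factors, so the queue still has a
product weight, now with the combined bit as its last factor. -/
theorem eprod_combW (ann : Bool) (ν ρ : Bool → ℝ≥0∞) (r : List (Bool → ℝ≥0∞)) (d : Bool)
    (f : List Bool → ℝ≥0∞) :
    eprod (ν :: ρ :: r) (fun l => if smsg ann l = d then f (sstep ann l) else 0)
      = eprod (r ++ [combW ann ν ρ d]) f := by
  rw [eprod_snoc]
  change ∑' s, ν s * ∑' t, ρ t * eprod r (fun l =>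
    if (ann && xor s t) = d then f (l ++ [bif ann then s else xor s t]) else 0) = _
  simp only [tsum_bool, mul_add]
  have hadd : ∀ f g : List Bool → ℝ≥0∞, eprod r (fun l => f l + g l) = eprod r f + eprod r g := by
    intro f g
    have := eprod_tsum r fun (b : Bool) l => bif b then f l else g l
    simpa [tsum_bool, add_comm] using this
  have h0 : eprod r (fun _ => 0) = 0 := by simpa using eprod_mul r 0 fun _ => 0
  rw [hadd]
  cases ann <;> cases d <;> simp [combW, eprod_mul, h0] <;> ring

/-- Each value of the first announcement leaves a product weight, to which induction applies. The
combined bit is described exactly by `itemOf`; linearity of `gval` in the last entry then merges the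
two values. -/
theorem leak_le : ∀ (m : ℕ) (γ : ℕ → Bool) (νs : List (Bool → ℝ≥0∞)) (X : List Item),
    νs.length = m + 1 → List.Forall₂ Dom νs X → leak γ m (eprod νs) ≤ gval γ m X
  | 0, γ, [ν], [x], _, .cons h .nil => by
      simpa [leak, gval, eprod, tsum_bool] using h.bias_le
  | m + 1, γ, ν :: ρ :: r, x :: y :: X, hl, .cons hx (.cons hy h) => by
      have hlX := h.length_eq
      simp only [List.length_cons, add_left_inj] at hl
      simp only [leak, eprod_combW]
      refine le_trans (ENNReal.tsum_le_tsum fun d => leak_le m _ _ _ (by simp [hl])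
        (List.rel_append h (.cons (dom_itemOf (combW (γ 0) ν ρ d)) .nil))) ?_
      -- The item at the end is the only one that depends on the announcement.
      refine ((multi_gval m fun i => γ (i + 1)).snoc.2 X (by omega)).tsum_le _ _ ?_ ?_
      · exact combW_bias hx hy _
      · simp_rw [itemOf_mass]; exact combW_mass hx hy _

end WeakOT

open scoped ENNReal
namespace WeakOT

/-! ## Weights -/

/-- The weight of the result of a random step. -/
noncomputable def wbind {S T : Type} (μ : S → ℝ≥0∞) (h : S → PMF T) (t : T) : ℝ≥0∞ :=
  ∑' s, μ s * h s t

/-- The weight of the new state if `o` is sent. -/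
noncomputable def wstep {S O T : Type} (μ : S → ℝ≥0∞) (step : S → PMF (O × T)) (o : O) (t : T) :
    ℝ≥0∞ :=
  ∑' s, μ s * step s (o, t)

/-- The weighted sum of `f`. -/
noncomputable def wsum {S : Type} (μ : S → ℝ≥0∞) (f : S → ℝ≥0∞) : ℝ≥0∞ := ∑' s, μ s * f s

/-- The product of two weights. -/
noncomputable def wprod {S T : Type} (μ : S → ℝ≥0∞) (ρ : T → ℝ≥0∞) (x : S × T) : ℝ≥0∞ :=
  μ x.1 * ρ x.2

theorem PMF.map_apply_of_injective {α β : Type} (f : α → β) (hf : Function.Injective f) (μ : PMF α)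
    (a : α) : (μ.map f) (f a) = μ a := by
  classical
  rw [PMF.map_apply, tsum_eq_single a (fun b hb => if_neg fun h => hb (hf h).symm), if_pos rfl]

theorem PMF.map_apply_eq_zero {α β : Type} (f : α → β) (μ : PMF α) (b : β) (h : ∀ a, f a ≠ b) :
    (μ.map f) b = 0 := by
  classical
  rw [PMF.map_apply]
  simp [fun a => (h a).symm]

theorem wbind_wbind {S T U : Type} (μ : S → ℝ≥0∞) (h : S → PMF T) (g : T → PMF U) :
    wbind (wbind μ h) g = wbind μ fun s => (h s).bind g := by
  funext u
  simp only [wbind, PMF.bind_apply, ← ENNReal.tsum_mul_right, ← ENNReal.tsum_mul_left]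
  rw [ENNReal.tsum_comm]
  simp only [mul_assoc]

theorem wstep_wbind {S T U O : Type} (μ : S → ℝ≥0∞) (h : S → PMF T) (g : T → PMF (O × U)) :
    wstep (wbind μ h) g = wstep μ fun s => (h s).bind g := by
  funext o u
  exact congrFun (wbind_wbind μ h g) (o, u)

theorem wsum_wbind {S T : Type} (μ : S → ℝ≥0∞) (h : S → PMF T) (f : T → ℝ≥0∞) :
    wsum (wbind μ h) f = wsum μ fun s => wsum (h s) f := by
  simp only [wsum, wbind, ← ENNReal.tsum_mul_right, ← ENNReal.tsum_mul_left]
  rw [ENNReal.tsum_comm]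
  simp only [mul_assoc]

theorem wsum_pure {S : Type} (s : S) (f : S → ℝ≥0∞) : wsum (PMF.pure s) f = f s := by
  classical
  unfold wsum
  rw [tsum_eq_single s (fun b hb => by simp [hb])]
  simp

theorem wsum_map {S T : Type} (μ : PMF S) (h : S → T) (f : T → ℝ≥0∞) :
    wsum (μ.map h) f = wsum μ fun s => f (h s) := by
  have : (μ.map h : T → ℝ≥0∞) = wbind μ fun s => PMF.pure (h s) := by
    funext t
    exact PMF.bind_apply _ _ _
  rw [this, wsum_wbind]
  simp only [wsum_pure]

theorem wsum_bind {S T : Type} (μ : PMF S) (h : S → PMF T) (f : T → ℝ≥0∞) :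
    wsum (μ.bind h) f = wsum μ fun s => wsum (h s) f := by
  have : (μ.bind h : T → ℝ≥0∞) = wbind μ h := by funext t; exact PMF.bind_apply _ _ _
  rw [this, wsum_wbind]

theorem wsum_wprod {S T : Type} (μ : S → ℝ≥0∞) (ρ : T → ℝ≥0∞) (f : S × T → ℝ≥0∞) :
    wsum (wprod μ ρ) f = wsum μ fun s => wsum ρ fun t => f (s, t) := by
  simp only [wsum, wprod]
  rw [ENNReal.tsum_prod']
  simp only [← ENNReal.tsum_mul_left, mul_assoc]

theorem tsum_wbind {S T : Type} (μ : S → ℝ≥0∞) (h : S → PMF T) :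
    ∑' t, wbind μ h t = ∑' s, μ s := by
  unfold wbind
  rw [ENNReal.tsum_comm]
  simp [ENNReal.tsum_mul_left, PMF.tsum_coe]

theorem tsum_wstep {S O T : Type} (μ : S → ℝ≥0∞) (step : S → PMF (O × T)) :
    ∑' o, ∑' t, wstep μ step o t = ∑' s, μ s := by
  rw [← tsum_wbind μ step, ENNReal.tsum_prod']
  rfl

theorem PMF.ext_wsum {S : Type} {μ ρ : PMF S} (h : ∀ f, wsum μ f = wsum ρ f) : μ = ρ := by
  classical
  ext s
  have key : ∀ μ : PMF S, wsum μ (fun t => if t = s then 1 else 0) = μ s := by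
    intro μ
    unfold wsum
    rw [tsum_eq_single s (fun b hb => by simp [hb])]
    simp
  rw [← key, ← key ρ, h]

namespace Sys

/-! ## The value of an interactive system for the corrupted player -/

/-- The largest total value of `Φ` that the corrupted player can achieve, if `μ` is the weight of
the internal state and `Φ` evaluates the weight of the honest player's output. -/
noncomputable def val {R : Type} :
    {S : Type} → Sys R S → ((R → ℝ≥0∞) → ℝ≥0∞) → (S → ℝ≥0∞) → ℝ≥0∞
  | _, result out, Φ, μ => Φ (wbind μ out)
  | _, send _ _ step next, Φ, μ => ∑' o, (next o).val Φ (wstep μ step o)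
  | _, recv _ _ next, Φ, μ => ⨆ i, (next i).val Φ μ

theorem val_pre {R : Type} (Φ : (R → ℝ≥0∞) → ℝ≥0∞) : {S S' : Type} → (h : S' → PMF S) →
    (F : Sys R S) → (μ : S' → ℝ≥0∞) → (pre h F).val Φ μ = F.val Φ (wbind μ h)
  | _, _, h, result out, μ => by simp only [pre, val, wbind_wbind]
  | _, _, h, send O T step next, μ => by simp only [pre, val, wstep_wbind]
  | _, _, h, recv I ne next, μ => by
      simp only [pre, val]
      exact iSup_congr fun i => val_pre Φ h (next i) μ

/-- The value is a backward recursion, so a system that continues after `F` acts merely as another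
evaluation of the final weight of `F`. -/
theorem val_andThen {R R' : Type} (G : Sys R' R) (Φ : (R' → ℝ≥0∞) → ℝ≥0∞) : {S : Type} →
    (F : Sys R S) → (μ : S → ℝ≥0∞) → (andThen G F).val Φ μ = F.val (G.val Φ) μ
  | _, result out, μ => by simp only [andThen, val, val_pre]
  | _, send O T step next, μ => by
      simp only [andThen, val]
      exact tsum_congr fun o => val_andThen G Φ (next o) _
  | _, recv I ne next, μ => by
      simp only [andThen, val]
      exact iSup_congr fun i => val_andThen G Φ (next i) μ

/-- The joint weight of the transcript and of the honest player's output. -/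
noncomputable def runW {R S : Type} (F : Sys R S) (σ : F.Strategy) (μ : S → ℝ≥0∞)
    (τ : F.Transcript) (r : R) : ℝ≥0∞ := ∑' s, μ s * F.run σ s (τ, r)

theorem runW_result {R S : Type} (out : S → PMF R) (σ : (result out).Strategy) (μ : S → ℝ≥0∞)
    (τ : (result out).Transcript) : (result out).runW σ μ τ = wbind μ out := by
  funext r
  refine tsum_congr fun s => congrArg _ ?_
  exact PMF.map_apply_of_injective (fun r : R => (((), r) : Unit × R))
    (fun _ _ h => (Prod.mk.inj h).2) (out s) r

/-- Only one first message is compatible with the given transcript; it turns the weight of the state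
into `wstep μ step o`. -/
theorem runW_send {R S O T : Type} (step : S → PMF (O × T)) (next : O → Sys R T)
    (σ : (send O T step next).Strategy) (μ : S → ℝ≥0∞) (o : O) (τ : (next o).Transcript) :
    (send O T step next).runW σ μ ⟨o, τ⟩ = (next o).runW (σ o) (wstep μ step o) τ := by
  classical
  funext r
  have key : ∀ s, (send O T step next).run σ s (⟨o, τ⟩, r)
      = ∑' t, step s (o, t) * (next o).run (σ o) t (τ, r) := by
    intro s
    change ((step s).bind fun x => ((next x.1).run (σ x.1) x.2).map
      fun w => ((⟨x.1, w.1⟩ : Σ o, (next o).Transcript), w.2)) (⟨o, τ⟩, r) = _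
    rw [PMF.bind_apply, ENNReal.tsum_prod', tsum_eq_single o]
    · refine tsum_congr fun t => congrArg _ ?_
      exact PMF.map_apply_of_injective
        (fun w : (next o).Transcript × R => ((⟨o, w.1⟩ : Σ o, (next o).Transcript), w.2))
        (fun a b h => by
          obtain ⟨h1, h2⟩ := Prod.mk.inj h
          exact Prod.ext (eq_of_heq (Sigma.mk.inj h1).2) h2) _ (τ, r)
    · intro o' ho'
      simp only [ENNReal.tsum_eq_zero, mul_eq_zero]
      intro t
      refine Or.inr (PMF.map_apply_eq_zero _ _ _ fun a h => ho' ?_)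
      exact (Sigma.mk.inj (Prod.mk.inj h).1).1
  simp only [runW, key, wstep, ← ENNReal.tsum_mul_right, ← ENNReal.tsum_mul_left]
  rw [ENNReal.tsum_comm]
  simp only [mul_assoc]

theorem runW_recv {R S I : Type} (ne : Nonempty I) (next : I → Sys R S)
    (σ : (recv I ne next).Strategy) (μ : S → ℝ≥0∞) (i : I) (τ : (next i).Transcript) :
    (recv I ne next).runW σ μ ⟨i, τ⟩ = fun r => σ.1 i * (next i).runW (σ.2 i) μ τ r := by
  classical
  funext r
  have key : ∀ s, (recv I ne next).run σ s (⟨i, τ⟩, r)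
      = σ.1 i * (next i).run (σ.2 i) s (τ, r) := by
    intro s
    change (σ.1.bind fun i => ((next i).run (σ.2 i) s).map
      fun w => ((⟨i, w.1⟩ : Σ i, (next i).Transcript), w.2)) (⟨i, τ⟩, r) = _
    rw [PMF.bind_apply, tsum_eq_single i]
    · refine congrArg _ ?_
      exact PMF.map_apply_of_injective
        (fun w : (next i).Transcript × R => ((⟨i, w.1⟩ : Σ i, (next i).Transcript), w.2))
        (fun a b h => by
          obtain ⟨h1, h2⟩ := Prod.mk.inj h
          exact Prod.ext (eq_of_heq (Sigma.mk.inj h1).2) h2) _ (τ, r)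
    · intro i' hi'
      refine mul_eq_zero.2 (Or.inr (PMF.map_apply_eq_zero _ _ _ fun a h => hi' ?_))
      exact (Sigma.mk.inj (Prod.mk.inj h).1).1
  simp only [runW, key, ← ENNReal.tsum_mul_left]
  exact tsum_congr fun s => mul_left_comm _ _ _

theorem tsum_runW_result {R S : Type} (Φ : (R → ℝ≥0∞) → ℝ≥0∞) (out : S → PMF R)
    (σ : (result out).Strategy) (μ : S → ℝ≥0∞) :
    ∑' τ, Φ ((result out).runW σ μ τ) = Φ (wbind μ out) := by
  refine (tsum_congr fun τ => congrArg Φ (runW_result out σ μ τ)).trans ?_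
  change ∑' _ : Unit, Φ (wbind μ out) = _
  simp

/-- A randomized message multiplies the weights by its probability, which `hΦ` takes out; an average
over messages is then at most the supremum. -/
theorem tsum_runW_le_val {R : Type} (Φ : (R → ℝ≥0∞) → ℝ≥0∞)
    (hΦ : ∀ (c : ℝ≥0∞) (ν : R → ℝ≥0∞), Φ (fun r => c * ν r) ≤ c * Φ ν) : {S : Type} →
    (F : Sys R S) → (σ : F.Strategy) → (μ : S → ℝ≥0∞) →
    ∑' τ, Φ (F.runW σ μ τ) ≤ F.val Φ μ
  | _, result out, σ, μ => (tsum_runW_result Φ out σ μ).le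
  | S, send O T step next, σ, μ => by
      refine (ENNReal.tsum_sigma' (β := fun o => (next o).Transcript)
        (fun τ => Φ ((send O T step next).runW σ μ τ))).le.trans ?_
      refine ENNReal.tsum_le_tsum fun o => ?_
      refine le_trans (le_of_eq ?_) (tsum_runW_le_val Φ hΦ (next o) (σ o) (wstep μ step o))
      exact tsum_congr fun τ => by rw [runW_send]
  | S, recv I ne next, σ, μ => by
      refine (ENNReal.tsum_sigma' (β := fun i => (next i).Transcript)
        (fun τ => Φ ((recv I ne next).runW σ μ τ))).le.trans ?_
      calc _ ≤ ∑' i, σ.1 i * (recv I ne next).val Φ μ := by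
            refine ENNReal.tsum_le_tsum fun i => ?_
            calc _ ≤ ∑' τ, σ.1 i * Φ ((next i).runW (σ.2 i) μ τ) := by
                  refine ENNReal.tsum_le_tsum fun τ => ?_
                  rw [runW_recv]
                  exact hΦ _ _
              _ = σ.1 i * ∑' τ, Φ ((next i).runW (σ.2 i) μ τ) := ENNReal.tsum_mul_left
              _ ≤ _ := by
                  gcongr
                  exact (tsum_runW_le_val Φ hΦ (next i) (σ.2 i) μ).trans
                    (le_iSup (fun i => (next i).val Φ μ) i)
        _ = _ := by rw [ENNReal.tsum_mul_right, PMF.tsum_coe, one_mul]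

theorem nonempty_strategy {R : Type} : {S : Type} → (F : Sys R S) → Nonempty F.Strategy
  | _, result _ => ⟨()⟩
  | _, send _ _ _ next => ⟨fun o => (nonempty_strategy (next o)).some⟩
  | _, recv _ ne next => ⟨(PMF.pure ne.some, fun i => (nonempty_strategy (next i)).some)⟩

/-- Suprema over infinite message alphabets need not be attained, so only a fraction `θ < 1` of the
value is promised. The constructed strategy is deterministic. -/
theorem exists_strategy {R : Type} (Φ : (R → ℝ≥0∞) → ℝ≥0∞) : {S : Type} →
    (F : Sys R S) → (μ : S → ℝ≥0∞) → (hfin : F.val Φ μ ≠ ⊤) → (θ : ℝ≥0∞) → θ < 1 →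
    ∃ σ, θ * F.val Φ μ ≤ ∑' τ, Φ (F.runW σ μ τ)
  | _, result out, μ, _, θ, hθ => by
      refine ⟨(), ?_⟩
      refine le_trans ?_ (tsum_runW_result Φ out () μ).ge
      exact mul_le_of_le_one_left' hθ.le
  | S, send O T step next, μ, hfin, θ, hθ => by
      choose σ hσ using fun o => exists_strategy Φ (next o) (wstep μ step o)
        (ENNReal.ne_top_of_tsum_ne_top hfin o) θ hθ
      refine ⟨σ, ?_⟩
      refine le_trans ?_ (ENNReal.tsum_sigma' (β := fun o => (next o).Transcript)
        (fun τ => Φ ((send O T step next).runW σ μ τ))).ge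
      simp only [val]
      rw [← ENNReal.tsum_mul_left]
      refine ENNReal.tsum_le_tsum fun o => (hσ o).trans (le_of_eq ?_)
      exact tsum_congr fun τ => congrArg Φ (runW_send step next σ μ o τ).symm
  | S, recv I ne next, μ, hfin, θ, hθ => by
      classical
      by_cases h0 : (recv I ne next).val Φ μ = 0
      · exact ⟨(nonempty_strategy _).some, by rw [h0, mul_zero]; exact bot_le⟩
      -- The loss is split: a factor `θ / η` is given up when choosing the next message, a factor
      -- `η` in the rest of the interaction.
      obtain ⟨η, hη, hη'⟩ := exists_between hθ
      have hη0 : η ≠ 0 := (pos_of_gt hη).ne'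
      have hηt : η ≠ ⊤ := ne_top_of_lt hη'
      have hlt : θ / η * (recv I ne next).val Φ μ < (recv I ne next).val Φ μ := by
        conv_rhs => rw [← one_mul ((recv I ne next).val Φ μ)]
        refine ENNReal.mul_lt_mul_left h0 hfin ?_
        rwa [ENNReal.div_lt_iff (Or.inl hη0) (Or.inl hηt), one_mul]
      obtain ⟨i, hi⟩ := lt_iSup_iff.1 hlt
      have hfi : (next i).val Φ μ ≠ ⊤ :=
        ne_top_of_le_ne_top hfin (le_iSup (fun i => (next i).val Φ μ) i)
      obtain ⟨σ, hσ⟩ := exists_strategy Φ (next i) μ hfi η hη'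
      refine ⟨(PMF.pure i, Function.update (fun i => (nonempty_strategy (next i)).some) i σ), ?_⟩
      refine le_trans ?_ (ENNReal.tsum_sigma' (β := fun i => (next i).Transcript)
        (fun τ => Φ ((recv I ne next).runW _ μ τ))).ge
      -- Only transcripts that start with the chosen message are needed.
      refine le_trans ?_ (ENNReal.le_tsum i)
      have hθη : θ * (recv I ne next).val Φ μ ≤ η * (next i).val Φ μ := by
        calc _ = η * (θ / η * (recv I ne next).val Φ μ) := by
              rw [← mul_assoc, ENNReal.mul_div_cancel hη0 hηt]
          _ ≤ _ := by gcongr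
      refine hθη.trans (hσ.trans (le_of_eq ?_))
      refine tsum_congr fun τ => congrArg Φ ?_
      refine Eq.trans ?_ (runW_recv ne next _ μ i τ).symm
      simp

end Sys

/-! ### Prediction advantages of strategies and the value for the bias -/

/-- The bias of the bit `β`. -/
noncomputable def bitBias {R : Type} (β : R → Bool) (ν : R → ℝ≥0∞) : ℝ≥0∞ :=
  bias (bitW β ν true) (bitW β ν false)

theorem bitW_mul {R : Type} (β : R → Bool) (c : ℝ≥0∞) (ν : R → ℝ≥0∞) (b : Bool) :
    bitW β (fun r => c * ν r) b = c * bitW β ν b := by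
  simp only [bitW, ← ENNReal.tsum_mul_left, mul_ite, mul_zero]

theorem bitBias_mul_le {R : Type} (β : R → Bool) (c : ℝ≥0∞) (ν : R → ℝ≥0∞) :
    bitBias β (fun r => c * ν r) ≤ c * bitBias β ν := by
  simp only [bitBias, bitW_mul]
  exact bias_mul_le _ _ _

theorem bitW_add {R : Type} (β : R → Bool) (ν : R → ℝ≥0∞) :
    bitW β ν true + bitW β ν false = ∑' r, ν r := by
  rw [bitW, bitW, ← ENNReal.tsum_add]
  exact tsum_congr fun r => by cases β r <;> simp

/-- Needed for finiteness, and for describing a partially run system by an item whose uniform part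
is its weight minus its value. -/
theorem Sys.val_bitBias_le {R : Type} (β : R → Bool) : {S : Type} → (F : Sys R S) →
    (μ : S → ℝ≥0∞) → F.val (bitBias β) μ ≤ ∑' s, μ s
  | _, result out, μ => by
      rw [← tsum_wbind μ out, ← bitW_add β]
      exact bias_le_add _ _
  | _, send O T step next, μ => by
      rw [← tsum_wstep μ step]
      exact ENNReal.tsum_le_tsum fun o => Sys.val_bitBias_le β (next o) _
  | _, recv I ne next, μ => iSup_le fun i => Sys.val_bitBias_le β (next i) μ

theorem Sys.advW_run {R : Type} (β : R → Bool) (F : Sys R Unit) (σ : F.Strategy) :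
    advW (F.run σ ()) (fun w => β w.2) (fun w => w.1)
      = ∑' τ, bitBias β (F.runW σ (fun _ => 1) τ) := by
  classical
  have key : ∀ b τ, jointW (F.run σ ()) (fun w => β w.2) (fun w => w.1) b τ
      = bitW β (F.runW σ (fun _ => 1) τ) b := by
    intro b τ
    unfold jointW bitW Sys.runW
    rw [ENNReal.tsum_prod', tsum_eq_single τ (fun τ' h => by simp [h])]
    simp
  simp only [advW, key, bitBias]

theorem Sys.advW_run_le_val {R : Type} (β : R → Bool) (F : Sys R Unit) (σ : F.Strategy) :
    advW (F.run σ ()) (fun w => β w.2) (fun w => w.1) ≤ F.val (bitBias β) fun _ => 1 := by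
  rw [Sys.advW_run]
  exact Sys.tsum_runW_le_val _ (bitBias_mul_le β) F σ _

/-- A bound for every strategy passes to the supremum, since any smaller number is reached by some
strategy. -/
theorem Sys.val_le_of_advW_le {R : Type} (β : R → Bool) (F : Sys R Unit) {q : ℝ≥0∞}
    (h : ∀ σ, advW (F.run σ ()) (fun w => β w.2) (fun w => w.1) ≤ q) :
    F.val (bitBias β) (fun _ => 1) ≤ q := by
  have hfin : F.val (bitBias β) (fun _ => 1) ≠ ⊤ :=
    ne_top_of_le_ne_top ENNReal.one_ne_top ((Sys.val_bitBias_le β F _).trans (by simp))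
  refine le_of_forall_lt_imp_le_of_dense fun c hc => ?_
  have h0 : F.val (bitBias β) (fun _ => 1) ≠ 0 := (pos_of_gt hc).ne'
  -- The fraction is chosen so that its product with the value is exactly `c`.
  obtain ⟨σ, hσ⟩ := Sys.exists_strategy (bitBias β) F _ hfin (c / F.val (bitBias β) fun _ => 1)
    (by rwa [ENNReal.div_lt_iff (Or.inl h0) (Or.inl hfin), one_mul])
  rw [ENNReal.div_mul_cancel h0 hfin, ← Sys.advW_run] at hσ
  exact hσ.trans (h σ)

end WeakOT

/-! ### Independence of the states of systems in parallel composition -/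

open scoped ENNReal
namespace WeakOT

theorem wbind_wprod_result {S₁ S₂ R₁ R₂ : Type} (μ₁ : S₁ → ℝ≥0∞) (μ₂ : S₂ → ℝ≥0∞)
    (out₁ : S₁ → PMF R₁) (out₂ : S₂ → PMF R₂) :
    wbind (wprod μ₁ μ₂) (fun s => (out₁ s.1).bind fun r₁ => (out₂ s.2).map fun r₂ => (r₁, r₂))
      = wprod (wbind μ₁ out₁) (wbind μ₂ out₂) := by
  classical
  have key : ∀ s₁ s₂ r₁ r₂, ((out₁ s₁).bind fun r₁ => (out₂ s₂).map fun r₂ => (r₁, r₂)) (r₁, r₂)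
      = out₁ s₁ r₁ * out₂ s₂ r₂ := by
    intro s₁ s₂ r₁ r₂
    rw [PMF.bind_apply, tsum_eq_single r₁]
    · refine congrArg _ ?_
      exact PMF.map_apply_of_injective _ (fun _ _ h => (Prod.mk.inj h).2) _ r₂
    · intro r hr
      exact mul_eq_zero.2
        (Or.inr (PMF.map_apply_eq_zero _ _ _ fun a h => hr (Prod.mk.inj h).1))
  funext ⟨r₁, r₂⟩
  simp only [wbind, wprod]
  rw [ENNReal.tsum_prod']
  simp only [key, ← ENNReal.tsum_mul_right, ← ENNReal.tsum_mul_left]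
  rw [ENNReal.tsum_comm]
  exact tsum_congr fun s₁ => tsum_congr fun s₂ => by ring

/-- A message of one of two independent systems carries no information about the other, so the joint
state keeps a product weight. -/
theorem wstep_wprod_right {S₁ S₂ O T : Type} (μ₁ : S₁ → ℝ≥0∞) (μ₂ : S₂ → ℝ≥0∞)
    (step : S₂ → PMF (O × T)) (o : O) :
    wstep (wprod μ₁ μ₂) (fun s => (step s.2).map fun x => (x.1, (s.1, x.2))) o
      = wprod μ₁ (wstep μ₂ step o) := by
  classical
  funext ⟨s, t⟩
  have key : ∀ s₁ s₂, ((step s₂).map fun x => (x.1, (s₁, x.2))) (o, (s, t))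
      = if s₁ = s then step s₂ (o, t) else 0 := by
    intro s₁ s₂
    split_ifs with h
    · subst h
      exact PMF.map_apply_of_injective (fun x : O × T => (x.1, (s₁, x.2)))
        (fun a b h => Prod.ext (Prod.mk.inj h).1 (Prod.mk.inj (Prod.mk.inj h).2).2) _ (o, t)
    · exact PMF.map_apply_eq_zero _ _ _ fun a h' => h (Prod.mk.inj (Prod.mk.inj h').2).1
  simp only [wstep, wprod]
  rw [ENNReal.tsum_prod', tsum_eq_single s]
  · simp only [key, if_pos, ← ENNReal.tsum_mul_left, mul_assoc]
  · intro s' hs'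
    simp [key, hs']

theorem wstep_wprod_left {S₁ S₂ O T : Type} (μ₁ : S₁ → ℝ≥0∞) (μ₂ : S₂ → ℝ≥0∞)
    (step : S₁ → PMF (O × T)) (o : O) :
    wstep (wprod μ₁ μ₂) (fun s => (step s.1).map fun x => (x.1, (x.2, s.2))) o
      = wprod (wstep μ₁ step o) μ₂ := by
  classical
  funext ⟨t, s⟩
  have key : ∀ s₁ s₂, ((step s₁).map fun x => (x.1, (x.2, s₂))) (o, (t, s))
      = if s₂ = s then step s₁ (o, t) else 0 := by
    intro s₁ s₂
    split_ifs with h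
    · subst h
      exact PMF.map_apply_of_injective (fun x : O × T => (x.1, (x.2, s₂)))
        (fun a b h => Prod.ext (Prod.mk.inj h).1 (Prod.mk.inj (Prod.mk.inj h).2).1) _ (o, t)
    · exact PMF.map_apply_eq_zero _ _ _ fun a h' => h (Prod.mk.inj (Prod.mk.inj h').2).2
  simp only [wstep, wprod]
  rw [ENNReal.tsum_prod', ← ENNReal.tsum_mul_right]
  refine tsum_congr fun s₁ => ?_
  rw [tsum_eq_single s]
  · simp only [key, if_pos]
    ring
  · intro s' hs'
    simp [key, hs']

namespace Sys

/-! ## Potentials for systems that hide several bits -/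

/-- The list `X` of `n` items bounds what the corrupted player learns about the hidden bits: if the
system sends a message, the items may depend on it, but no multilinear function of them increases on
average; and at the end `T` relates them to the weight of the honest player's output. -/
def Bdd {R : Type} (n : ℕ) (T : (R → ℝ≥0∞) → List Item → Prop) :
    {S : Type} → Sys R S → (S → ℝ≥0∞) → List Item → Prop
  | _, result out, μ, X => T (wbind μ out) X
  | _, send O _ step next, μ, X => ∃ Y : O → List Item,
      (∀ o, (Y o).length = n ∧ Bdd n T (next o) (wstep μ step o) (Y o)) ∧
        ∀ G, Multi n G → ∑' o, G (Y o) ≤ G X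
  | _, recv _ _ next, μ, X => ∀ i, Bdd n T (next i) μ X

theorem Bdd.pre {R : Type} {n : ℕ} {T : (R → ℝ≥0∞) → List Item → Prop} : {S S' : Type} →
    {h : S' → PMF S} → {F : Sys R S} → {μ : S' → ℝ≥0∞} → {X : List Item} →
    Bdd n T F (wbind μ h) X → Bdd n T (Sys.pre h F) μ X
  | _, _, h, result out, μ, X, hF => by simpa only [Sys.pre, Bdd, wbind_wbind] using hF
  | _, _, h, send O T step next, μ, X, hF => by
      simpa only [Sys.pre, Bdd, wstep_wbind] using hF
  | _, _, h, recv I ne next, μ, X, hF => fun i => Bdd.pre (hF i)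

theorem Bdd.andThen_result {R R' : Type} {n : ℕ} {T : (R' → ℝ≥0∞) → List Item → Prop}
    {out : R → PMF R'} : {S : Type} → {F : Sys R S} → {μ : S → ℝ≥0∞} → {X : List Item} →
    Bdd n (fun ν => T (wbind ν out)) F μ X → Bdd n T (andThen (result out) F) μ X
  | _, result out', μ, X, hF => by simpa only [andThen, Bdd, Sys.pre, wbind_wbind] using hF
  | _, send O T step next, μ, X, hF => by
      obtain ⟨Y, hY, hG⟩ := hF
      exact ⟨Y, fun o => ⟨(hY o).1, (hY o).2.andThen_result⟩, hG⟩
  | _, recv I ne next, μ, X, hF => fun i => (hF i).andThen_result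

/-- Sending does not increase `G` on average, and receiving leaves the items alone, so the bound at
the end holds at the start. -/
theorem Bdd.val_le {R : Type} {n : ℕ} {T : (R → ℝ≥0∞) → List Item → Prop}
    {Φ : (R → ℝ≥0∞) → ℝ≥0∞} {G : List Item → ℝ≥0∞} (hG : Multi n G)
    (hΦ : ∀ ν X, T ν X → Φ ν ≤ G X) : {S : Type} → {F : Sys R S} → {μ : S → ℝ≥0∞} →
    {X : List Item} → Bdd n T F μ X → F.val Φ μ ≤ G X
  | _, result out, μ, X, hF => hΦ _ _ hF
  | _, send O T step next, μ, X, hF => by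
      obtain ⟨Y, hY, hY'⟩ := hF
      exact (ENNReal.tsum_le_tsum fun o => (hY o).2.val_le hG hΦ).trans (hY' G hG)
  | _, recv I ne next, μ, X, hF => iSup_le fun i => (hF i).val_le hG hΦ

section Par

variable {R₁ R₂ : Type} {β : R₁ → Bool} {n : ℕ} {T₂ : (R₂ → ℝ≥0∞) → List Item → Prop}
  {T : (R₁ × R₂ → ℝ≥0∞) → List Item → Prop}

theorem bdd_parResult
    (hT : ∀ ν₁ ν₂ x X, Dom (bitW β ν₁) x → T₂ ν₂ X → T (wprod ν₁ ν₂) (x :: X))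
    {S₁ : Type} (out₁ : S₁ → PMF R₁) (μ₁ : S₁ → ℝ≥0∞) (x : Item)
    (hx : Dom (bitW β (wbind μ₁ out₁)) x) : {S₂ : Type} → (F₂ : Sys R₂ S₂) →
    (μ₂ : S₂ → ℝ≥0∞) → (X : List Item) → Bdd n T₂ F₂ μ₂ X →
    Bdd (n + 1) T (parResult out₁ F₂) (wprod μ₁ μ₂) (x :: X)
  | _, result out₂, μ₂, X, hF => by
      simp only [parResult, Bdd, wbind_wprod_result]
      exact hT _ _ _ _ hx hF
  | _, send O T' step next, μ₂, X, hF => by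
      obtain ⟨Y, hY, hG⟩ := hF
      refine ⟨fun o => x :: Y o, fun o => ⟨by simp [(hY o).1], ?_⟩, fun G hGm => ?_⟩
      · rw [wstep_wprod_right]
        exact bdd_parResult hT out₁ μ₁ x hx (next o) _ _ (hY o).2
      · exact hG _ (hGm.1 x)
  | _, recv I ne next, μ₂, X, hF => fun i => bdd_parResult hT out₁ μ₁ x hx (next i) _ _ (hF i)

/-- What the item of a single system has to satisfy. -/
structure Pot (β : R₁ → Bool) {S : Type} (F : Sys R₁ S) (μ : S → ℝ≥0∞) (x : Item) : Prop where
  val_le : F.val (bitBias β) μ ≤ x.1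
  mass_le : ∑' s, μ s ≤ x.1 + x.2

/-- Both systems have to be unfolded while their messages interleave: `ih` covers a message to the
first system, and the recursion here runs over the second. -/
theorem bdd_parRecv {S₁ I₁ : Type} (ne₁ : Nonempty I₁) (next₁ : I₁ → Sys R₁ S₁)
    (ih : ∀ i, ∀ (μ₁ : S₁ → ℝ≥0∞) (x : Item), Pot β (next₁ i) μ₁ x → ∀ (S₂ : Type)
      (F₂ : Sys R₂ S₂) (μ₂ : S₂ → ℝ≥0∞) (X : List Item), X.length = n → Bdd n T₂ F₂ μ₂ X →
      Bdd (n + 1) T (par (next₁ i) S₂ F₂) (wprod μ₁ μ₂) (x :: X))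
    (μ₁ : S₁ → ℝ≥0∞) (x : Item) (hx : ∀ i, Pot β (next₁ i) μ₁ x) : {S₂ : Type} →
    (F₂ : Sys R₂ S₂) → (μ₂ : S₂ → ℝ≥0∞) → (X : List Item) → X.length = n → Bdd n T₂ F₂ μ₂ X →
    Bdd (n + 1) T (parRecv I₁ ne₁ (fun i => par (next₁ i)) F₂) (wprod μ₁ μ₂) (x :: X)
  | _, result out₂, μ₂, X, hX, hF => fun i => ih i μ₁ x (hx i) _ _ _ _ hX hF
  | _, send O T' step next, μ₂, X, hX, hF => by
      obtain ⟨Y, hY, hG⟩ := hF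
      refine ⟨fun o => x :: Y o, fun o => ⟨by simp [(hY o).1], ?_⟩, fun G hGm => ?_⟩
      · rw [wstep_wprod_right]
        exact bdd_parRecv ne₁ next₁ ih μ₁ x hx (next o) _ _ (hY o).1 (hY o).2
      · exact hG _ (hGm.1 x)
  | _, recv I ne next, μ₂, X, hX, hF => by
      rintro (i | i)
      · exact ih i μ₁ x (hx i) _ (recv I ne next) _ _ hX hF
      · exact bdd_parRecv ne₁ next₁ ih μ₁ x hx (next i) _ _ hX (hF i)

/-- The first system enters only through its value and its weight. These form a valid item at every
moment of its run, whatever happens in the second system in between. -/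
theorem bdd_par
    (hT : ∀ ν₁ ν₂ x X, Dom (bitW β ν₁) x → T₂ ν₂ X → T (wprod ν₁ ν₂) (x :: X)) :
    {S₁ : Type} → (F₁ : Sys R₁ S₁) → (μ₁ : S₁ → ℝ≥0∞) → (x : Item) → Pot β F₁ μ₁ x →
    (S₂ : Type) → (F₂ : Sys R₂ S₂) → (μ₂ : S₂ → ℝ≥0∞) → (X : List Item) → X.length = n →
    Bdd n T₂ F₂ μ₂ X → Bdd (n + 1) T (par F₁ S₂ F₂) (wprod μ₁ μ₂) (x :: X)
  | _, result out, μ₁, x, hx, _, F₂, μ₂, X, _, hF =>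
      bdd_parResult hT out μ₁ x
        ⟨hx.val_le, by rw [bitW_add, tsum_wbind]; exact hx.mass_le⟩ F₂ μ₂ X hF
  | _, send O T' step next, μ₁, x, hx, S₂, F₂, μ₂, X, hX, hF => by
      have hm : ∀ o, (next o).val (bitBias β) (wstep μ₁ step o) +
          (∑' t, wstep μ₁ step o t - (next o).val (bitBias β) (wstep μ₁ step o))
          = ∑' t, wstep μ₁ step o t :=
        fun o => add_tsub_cancel_of_le (val_bitBias_le β (next o) _)
      -- After the message `o` the known part is the value of the remaining interaction. Summed over
      -- `o`, these values give the value before the message and the weights give the old weight, so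
      -- linearity in the first entry suffices.
      refine ⟨fun o => ((next o).val (bitBias β) (wstep μ₁ step o),
        ∑' t, wstep μ₁ step o t - (next o).val (bitBias β) (wstep μ₁ step o)) :: X,
        fun o => ⟨by simp [hX], ?_⟩, fun G hGm => (hGm.2 X hX).tsum_le _ _ hx.val_le ?_⟩
      · rw [wstep_wprod_left]
        exact bdd_par hT (next o) _ _ ⟨le_rfl, (hm o).ge⟩ S₂ F₂ μ₂ X hX hF
      · simp_rw [hm, tsum_wstep]
        exact hx.mass_le
  | _, recv I ne next, μ₁, x, hx, _, F₂, μ₂, X, hX, hF =>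
      bdd_parRecv ne next (fun i μ₁ x hx => bdd_par hT (next i) μ₁ x hx) μ₁ x
        (fun i => ⟨(le_iSup (fun i => (next i).val (bitBias β) μ₁) i).trans hx.val_le,
          hx.mass_le⟩) F₂ μ₂ X hX hF

end Par

/-- The weight of a tuple is the product of weights described by the given items. -/
def IsProd {R : Type} (β : R → Bool) (n : ℕ) (ν : (Fin n → R) → ℝ≥0∞) (X : List Item) : Prop :=
  ∃ νs : List (R → ℝ≥0∞), νs.length = n ∧ List.Forall₂ (fun ρ x => Dom (bitW β ρ) x) νs X ∧
    ∀ f : List R → ℝ≥0∞, wsum ν (fun w => f (List.ofFn w)) = eprod νs f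

theorem bdd_parAll {R : Type} (β : R → Bool) (x : Item) (hx : 1 ≤ x.1 + x.2) : {n : ℕ} →
    (F : Fin n → Sys R Unit) → (∀ j, (F j).val (bitBias β) (fun _ => 1) ≤ x.1) →
    Bdd n (IsProd β n) (parAll F) (fun _ => 1) (List.replicate n x)
  | 0, F, h => by
      refine ⟨[], rfl, .nil, fun f => ?_⟩
      rw [wsum_wbind]
      simp only [wsum_pure]
      simp [wsum, eprod]
  | n + 1, F, h => by
      -- The recursive parallel composition ends by putting the pair of outputs into one tuple, and
      -- begins by splitting the trivial state.
      refine Bdd.andThen_result (Bdd.pre ?_)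
      have h1 : wbind (fun _ : Unit => (1 : ℝ≥0∞)) (fun _ => PMF.pure ((), ()))
          = wprod (fun _ => 1) (fun _ => 1) := by
        funext s
        simp [wbind, wprod]
      rw [h1]
      refine bdd_par (T₂ := IsProd β n) ?_ (F 0) _ x ⟨h 0, by simpa using hx⟩ Unit
        (parAll fun j => F j.succ) _ _ List.length_replicate (bdd_parAll β x hx _ fun j => h j.succ)
      rintro ν₁ ν₂ x X hx ⟨νs, hl, hνs, hf⟩
      refine ⟨ν₁ :: νs, by simp [hl], .cons hx hνs, fun f => ?_⟩
      rw [wsum_wbind, wsum_wprod]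
      simp only [wsum_pure, List.ofFn_succ, Fin.cons_zero, Fin.cons_succ]
      simp only [fun s => hf fun l => f (s :: l)]
      rfl

end Sys

end WeakOT

open scoped ENNReal
namespace WeakOT

/-! ## The protocol

Each player keeps a queue of pairs `(s, z)`.  For the sender `s = x₀ ⊕ x₁` and `z = x₀`, for the
receiver `s = c` and `z = y`; so an oblivious transfer without error is `z_A ⊕ z_B = s_A s_B`. -/

/-- Two pairs are combined.  If the player announces the difference of the bits `s`, it is
corrected and the first one remains, otherwise the new bit `s` is their exclusive or, and the
announcement `d` of the other player is used. -/
def comb (ann d : Bool) (u v : Bool × Bool) : Bool × Bool :=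
  (bif ann then u.1 else xor u.1 v.1, xor (xor u.2 v.2) (!ann && d && v.1))

/-- The message of a player about the first two pairs in his queue. -/
def qmsg (ann : Bool) : List (Bool × Bool) → Bool
  | u :: v :: _ => ann && xor u.1 v.1
  | _ => false

/-- The first two pairs in the queue are combined, and the new pair is put at the end. -/
def qstep (ann d : Bool) : List (Bool × Bool) → List (Bool × Bool)
  | u :: v :: r => r ++ [comb ann d u v]
  | q => q

/-- The queue after receiving the messages in the list; `γ i` tells who announces in round `i`
(with `f = false` for the sender and `f = true` for the receiver). -/
def proc (f : Bool) (γ : ℕ → Bool) (q : List (Bool × Bool)) : List Bool → List (Bool × Bool)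
  | [] => q
  | d :: ds => proc f (fun i => γ (i + 1)) (qstep (xor f (γ 0)) d q) ds

theorem proc_snoc (f d : Bool) : ∀ (ds : List Bool) (γ : ℕ → Bool) (q : List (Bool × Bool)),
    proc f γ q (ds ++ [d]) = qstep (xor f (γ ds.length)) d (proc f γ q ds)
  | [], _, _ => rfl
  | _ :: ds, _, _ => proc_snoc f d ds _ _

/-- The sender's representation of his outputs. -/
def toPair (x : Bool × Bool) : Bool × Bool := (xor x.1 x.2, x.1)

/-- The sender's outputs from their representation. -/
def ofPair (x : Bool × Bool) : Bool × Bool := (x.2, xor x.2 x.1)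

/-- The outputs of the sender if there are no instances of weak oblivious transfer: his first coin
becomes the input that the receiver has chosen. -/
def freeOutA (coins received : List Bool) : Bool × Bool :=
  bif received.headD false then (coins.getD 1 false, coins.headD false)
  else (coins.headD false, coins.getD 1 false)

/-- The protocol with `N k` instances in which `γ k i` tells who announces in round `i`.  For
`k = 0` the sender sends his first coin, and the receiver sends his choice. -/
def otProtocol (N : ℕ → ℕ) (γ : ℕ → ℕ → Bool) : Protocol where
  numWOT := N
  rounds k := if k = 0 then 1 else N k - 1
  coinsA k := if k = 0 then 2 else 0
  coinsB k := if k = 0 then 1 else 0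
  msgA k w c r := if k = 0 then c.headD false
    else qmsg (γ k r.length) (proc false (γ k) (w.map toPair) r)
  msgB k w c r := if k = 0 then c.headD false
    else if r = [] then false
    else qmsg (!γ k r.dropLast.length) (proc true (γ k) w r.dropLast)
  outA k w c r := if k = 0 then freeOutA c r
    else ofPair ((proc false (γ k) (w.map toPair) r).headD (false, false))
  outB k w c r := if k = 0 then (c.headD false, r.headD false)
    else (proc true (γ k) w r).headD (false, false)

/-- The received bit `d` changes only the components `z`. Hence nothing a cheating player sends
influences the hidden bits or the later announcements of the honest one. -/
theorem map_fst_qstep (ann d : Bool) (q : List (Bool × Bool)) :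
    (qstep ann d q).map Prod.fst = sstep ann (q.map Prod.fst) := by
  match q with
  | [] => rfl
  | [u] => rfl
  | u :: v :: r => simp [qstep, sstep, comb]

theorem qmsg_eq_smsg (ann : Bool) (q : List (Bool × Bool)) :
    qmsg ann q = smsg ann (q.map Prod.fst) := by
  match q with
  | [] => rfl
  | [u] => rfl
  | u :: v :: r => rfl

theorem xor_ofPair_headD (q : List (Bool × Bool)) :
    xor (ofPair (q.headD (false, false))).1 (ofPair (q.headD (false, false))).2
      = (q.map Prod.fst).headD false := by
  match q with
  | [] => rfl
  | (s, z) :: r => cases s <;> cases z <;> rfl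

theorem fst_headD (q : List (Bool × Bool)) :
    (q.headD (false, false)).1 = (q.map Prod.fst).headD false := by
  match q with
  | [] => rfl
  | u :: r => rfl

/-! ## Security in the malicious model -/

/-- Sending a function of the state and keeping the state restricts the weight to the states with
that message. -/
theorem wsum_wstep_pure {S O : Type} [DecidableEq O] (μ : S → ℝ≥0∞) (msg : S → O) (o : O)
    (f : S → ℝ≥0∞) :
    wsum (wstep μ (fun s => PMF.pure (msg s, s)) o) f
      = wsum μ fun s => if msg s = o then f s else 0 := by
  classical
  have key : wstep μ (fun s => PMF.pure (msg s, s)) o = fun s => if msg s = o then μ s else 0 := by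
    funext t
    unfold wstep
    rw [tsum_eq_single t (fun s hs => by simp [hs.symm])]
    simp [eq_comm]
  rw [key]
  unfold wsum
  exact tsum_congr fun s => by simp only; split_ifs <;> simp

theorem bitW_wbind_pure {S R : Type} (β : R → Bool) (μ : S → ℝ≥0∞) (out : S → R) (b : Bool) :
    bitW β (wbind μ fun s => PMF.pure (out s)) b
      = wsum μ fun s => if β (out s) = b then 1 else 0 := by
  have := wsum_wbind μ (fun s => PMF.pure (out s)) fun r => if β r = b then 1 else 0
  simp only [wsum_pure] at this
  rw [← this]
  unfold bitW wsum
  exact tsum_congr fun r => by simp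

/-- By `map_fst_qstep` and `qmsg_eq_smsg` the supremum over the replies `b` has no effect, and the
rounds only announce the differences accounted for by `leak`. The start of the remaining gates is
given by the number of messages received so far. -/
theorem val_roundsA_le (N : ℕ → ℕ) (γ : ℕ → ℕ → Bool) {k : ℕ} (hk : k ≠ 0) : ∀ (m : ℕ) (h : List Bool)
    (ρ : List (Bool × Bool) × List Bool → ℝ≥0∞),
    ((otProtocol N γ).roundsA k m h).val (bitBias fun x => xor x.1 x.2) ρ
      ≤ leak (fun i => γ k (h.length + i)) m fun f =>
        wsum ρ fun st => f ((proc false (γ k) (st.1.map toPair) h).map Prod.fst)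
  | 0, h, ρ => by
      simp only [Protocol.roundsA, Sys.val, bitBias, bitW_wbind_pure, leak, otProtocol, if_neg hk,
        xor_ofPair_headD]
      exact le_rfl
  | m + 1, h, ρ => by
      simp only [Protocol.roundsA, Sys.val, leak]
      refine ENNReal.tsum_le_tsum fun o => iSup_le fun b => ?_
      refine (val_roundsA_le N γ hk m (h ++ [b]) _).trans (le_of_eq ?_)
      simp only [wsum_wstep_pure, List.length_append, List.length_singleton, proc_snoc,
        Bool.false_xor, map_fst_qstep, otProtocol, if_neg hk, qmsg_eq_smsg]
      congr 1
      funext i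
      congr 1
      omega

/-- The receiver speaks second but ignores the message of the current round, which `dropLast`
removes. His gates are negated: he announces where the sender does not. -/
theorem val_roundsB_le (N : ℕ → ℕ) (γ : ℕ → ℕ → Bool) {k : ℕ} (hk : k ≠ 0) : ∀ (m : ℕ) (h : List Bool)
    (ρ : List (Bool × Bool) × List Bool → ℝ≥0∞),
    ((otProtocol N γ).roundsB k m h).val (bitBias fun x => x.1) ρ
      ≤ leak (fun i => !γ k (h.length + i)) m fun f =>
        wsum ρ fun st => f ((proc true (γ k) st.1 h).map Prod.fst)
  | 0, h, ρ => by
      simp only [Protocol.roundsB, Sys.val, bitBias, bitW_wbind_pure, leak, otProtocol, if_neg hk,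
        fst_headD]
      exact le_rfl
  | m + 1, h, ρ => by
      simp only [Protocol.roundsB, Sys.val, leak]
      refine iSup_le fun a => ENNReal.tsum_le_tsum fun o => ?_
      refine (val_roundsB_le N γ hk m (h ++ [a]) _).trans (le_of_eq ?_)
      simp only [wsum_wstep_pure, List.length_append, List.length_singleton, proc_snoc,
        Bool.true_xor, map_fst_qstep, otProtocol, if_neg hk, qmsg_eq_smsg, List.dropLast_concat,
        List.append_eq_nil_iff, List.cons_ne_nil, and_false, if_false]
      congr 1
      funext i
      congr 2
      omega

theorem wsum_const {S : Type} (μ : PMF S) (c : ℝ≥0∞) : wsum μ (fun _ => c) = c := by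
  rw [wsum, ENNReal.tsum_mul_right, PMF.tsum_coe, one_mul]

/-- Only the bits `β` of the outputs matter for the leakage, and they inherit the product weight. -/
theorem leak_isProd_le {R : Type} (β : R → Bool) (γ : ℕ → Bool) {m : ℕ}
    {ν : (Fin (m + 1) → R) → ℝ≥0∞} {X : List Item} (h : Sys.IsProd β (m + 1) ν X) :
    leak γ m (fun f => wsum ν fun w => f ((List.ofFn w).map β)) ≤ gval γ m X := by
  obtain ⟨νs, hl, hνs, hf⟩ := h
  simp only [fun f : List Bool → ℝ≥0∞ => hf fun l => f (l.map β)]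
  simp only [eprod_map]
  exact leak_le m γ _ X (by simp [hl]) (by rwa [List.forall₂_map_left_iff])

/-- If every instance leaks with weight at most that of `x`, then so does the whole system with
weight at most `gval`. -/
theorem advW_andThen_parAll_le {R R' : Type} (β : R → Bool) (β' : R' → Bool) (γ : ℕ → Bool)
    {n m : ℕ} (hn : n = m + 1) (F : Fin n → Sys R Unit) (x : Item) (hx : 1 ≤ x.1 + x.2)
    (hF : ∀ j, (F j).val (bitBias β) (fun _ => 1) ≤ x.1) (G : Sys R' (Fin n → R))
    (hG : ∀ ν : (Fin n → R) → ℝ≥0∞, G.val (bitBias β') ν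
      ≤ leak γ m fun f => wsum ν fun w => f ((List.ofFn w).map β))
    (σ : (Sys.andThen G (Sys.parAll F)).Strategy) :
    advW ((Sys.andThen G (Sys.parAll F)).run σ ()) (fun w => β' w.2) (fun w => w.1)
      ≤ gval γ m (List.replicate n x) := by
  subst hn
  refine (Sys.advW_run_le_val β' _ σ).trans ?_
  rw [Sys.val_andThen]
  exact Sys.Bdd.val_le (T := Sys.IsProd β (m + 1)) (multi_gval m γ)
    (fun ν X hν => (hG ν).trans (leak_isProd_le β γ hν)) (Sys.bdd_parAll β x hx F hF)

/-- The channel phase is dominated by `leak`, the phase of the instances by the multilinear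
potential. For `k ≠ 0` the honest coins do not enter the messages or outputs and integrate out. -/
theorem advW_malicious_corruptB_le (N : ℕ → ℕ) (γ : ℕ → ℕ → Bool) {k : ℕ} (hk : k ≠ 0) {m : ℕ}
    (hN : (otProtocol N γ).numWOT k = m + 1)
    (F : Fin ((otProtocol N γ).numWOT k) → MaliciousSystem) (x : Item) (hx : 1 ≤ x.1 + x.2)
    (hF : ∀ j, ((F j).corruptB).val (bitBias fun y => xor y.1 y.2) (fun _ => 1) ≤ x.1)
    (σ : ((otProtocol N γ).malicious k F).corruptB.Strategy) :
    advW (((otProtocol N γ).malicious k F).corruptB.run σ ()) (fun w => xor w.2.1 w.2.2)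
      (fun w => w.1) ≤ gval (γ k) m (List.replicate ((otProtocol N γ).numWOT k) x) := by
  refine advW_andThen_parAll_le (fun y => xor y.1 y.2) (fun y => xor y.1 y.2) (γ k) hN
    (fun j => (F j).corruptB) x hx hF _ (fun ν => ?_) σ
  have hr : (otProtocol N γ).rounds k = m := by
    change (if k = 0 then 1 else N k - 1) = m
    rw [if_neg hk]; exact Nat.sub_eq_of_eq_add hN
  rw [Sys.val_pre, hr]
  refine (val_roundsA_le N γ hk m [] _).trans (le_of_eq ?_)
  simp only [wsum_wbind, wsum_map, wsum_const, proc, List.length_nil, zero_add, List.map_map]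
  rfl

theorem advW_malicious_corruptA_le (N : ℕ → ℕ) (γ : ℕ → ℕ → Bool) {k : ℕ} (hk : k ≠ 0) {m : ℕ}
    (hN : (otProtocol N γ).numWOT k = m + 1)
    (F : Fin ((otProtocol N γ).numWOT k) → MaliciousSystem) (x : Item) (hx : 1 ≤ x.1 + x.2)
    (hF : ∀ j, ((F j).corruptA).val (bitBias fun y => y.1) (fun _ => 1) ≤ x.1)
    (σ : ((otProtocol N γ).malicious k F).corruptA.Strategy) :
    advW (((otProtocol N γ).malicious k F).corruptA.run σ ()) (fun w => w.2.1)
      (fun w => w.1) ≤ gval (fun i => !γ k i) m (List.replicate ((otProtocol N γ).numWOT k) x) := by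
  refine advW_andThen_parAll_le (fun y => y.1) (fun y => y.1) (fun i => !γ k i) hN
    (fun j => (F j).corruptA) x hx hF _ (fun ν => ?_) σ
  have hr : (otProtocol N γ).rounds k = m := by
    change (if k = 0 then 1 else N k - 1) = m
    rw [if_neg hk]; exact Nat.sub_eq_of_eq_add hN
  rw [Sys.val_pre, hr]
  refine (val_roundsB_le N γ hk m [] _).trans (le_of_eq ?_)
  simp only [wsum_wbind, wsum_map, wsum_const, proc, List.length_nil, zero_add]

end WeakOT

open scoped ENNReal
namespace WeakOT

/-! ## The joint run of two honest players -/

/-- The queue of bits after `m` rounds. -/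
def sst (γ : ℕ → Bool) (l : List Bool) : ℕ → List Bool
  | 0 => l
  | m + 1 => sstep (γ m) (sst γ l m)

/-- The announcements in the first `m` rounds. -/
def smsgs : (ℕ → Bool) → ℕ → List Bool → List Bool
  | _, 0, _ => []
  | γ, m + 1, l => smsg (γ 0) l :: smsgs (fun i => γ (i + 1)) m (sstep (γ 0) l)

theorem sst_succ' (γ : ℕ → Bool) (l : List Bool) :
    ∀ m, sst γ l (m + 1) = sst (fun i => γ (i + 1)) (sstep (γ 0) l) m
  | 0 => rfl
  | m + 1 => congrArg (sstep (γ (m + 1))) (sst_succ' γ l m)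

/-- `smsgs` recurses at the first round, as `leak` does, whereas conversations grow at the last
round. -/
theorem smsgs_snoc : ∀ (m : ℕ) (γ : ℕ → Bool) (l : List Bool),
    smsgs γ (m + 1) l = smsgs γ m l ++ [smsg (γ m) (sst γ l m)]
  | 0, _, _ => rfl
  | m + 1, γ, l => by
      rw [sst_succ', smsgs, smsgs_snoc m]
      rfl

/-- Two pairs of both players are combined. -/
def jcomb (g : Bool) (u v : (Bool × Bool) × (Bool × Bool)) : (Bool × Bool) × (Bool × Bool) :=
  (comb g (!g && xor u.2.1 v.2.1) u.1 v.1, comb (!g) (g && xor u.1.1 v.1.1) u.2 v.2)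

/-- One round of the joint run. -/
def jstep (g : Bool) :
    List ((Bool × Bool) × (Bool × Bool)) → List ((Bool × Bool) × (Bool × Bool))
  | u :: v :: r => r ++ [jcomb g u v]
  | q => q

/-- The queues of both players after `m` rounds. -/
def jst (γ : ℕ → Bool) (q : List ((Bool × Bool) × (Bool × Bool))) :
    ℕ → List ((Bool × Bool) × (Bool × Bool))
  | 0 => q
  | m + 1 => jstep (γ m) (jst γ q m)

theorem map_fst_jstep (g : Bool) (q : List ((Bool × Bool) × (Bool × Bool))) :
    (jstep g q).map Prod.fst = qstep g (qmsg (!g) (q.map Prod.snd)) (q.map Prod.fst) := by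
  match q with
  | [] => rfl
  | [u] => rfl
  | u :: v :: r => simp [jstep, qstep, qmsg, jcomb]

theorem map_snd_jstep (g : Bool) (q : List ((Bool × Bool) × (Bool × Bool))) :
    (jstep g q).map Prod.snd = qstep (!g) (qmsg g (q.map Prod.fst)) (q.map Prod.snd) := by
  match q with
  | [] => rfl
  | [u] => rfl
  | u :: v :: r => simp [jstep, qstep, qmsg, jcomb]

theorem map_jst_fst (γ : ℕ → Bool) (q : List ((Bool × Bool) × (Bool × Bool))) :
    ∀ m, ((jst γ q m).map Prod.fst).map Prod.fst = sst γ ((q.map Prod.fst).map Prod.fst) m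
  | 0 => rfl
  | m + 1 => by rw [jst, map_fst_jstep, map_fst_qstep, map_jst_fst γ q m]; rfl

theorem map_jst_snd (γ : ℕ → Bool) (q : List ((Bool × Bool) × (Bool × Bool))) :
    ∀ m, ((jst γ q m).map Prod.snd).map Prod.fst
      = sst (fun i => !γ i) ((q.map Prod.snd).map Prod.fst) m
  | 0 => rfl
  | m + 1 => by rw [jst, map_snd_jstep, map_fst_qstep, map_jst_snd γ q m]; rfl

/-- Each round shortens the queue by one, so a queue of `n + 1 + m` pairs never runs short within
`m` rounds. -/
theorem length_jst (γ : ℕ → Bool) (q : List ((Bool × Bool) × (Bool × Bool))) (n : ℕ) :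
    ∀ m, q.length = n + 1 + m → (jst γ q m).length = n + 1
  | 0, h => h
  | m + 1, h => by
      have ih := length_jst γ q (n + 1) m (by omega)
      match hq : jst γ q m, ih with
      | u :: v :: r, ih => simp [jst, hq, jstep] at ih ⊢; exact ih

/-- The representation of the outputs of an instance. -/
def toJoint (o : Output) : (Bool × Bool) × (Bool × Bool) := (toPair o.1, o.2)

/-- The outputs of both players from their representation. -/
def ofJoint (u : (Bool × Bool) × (Bool × Bool)) : Output := (ofPair u.1, u.2)

/-- What has happened after `m` rounds between honest players. -/
structure TalkInv (γ : ℕ → Bool) (q : List ((Bool × Bool) × (Bool × Bool))) (m : ℕ)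
    (t : List Bool × List Bool) : Prop where
  length_fst : t.1.length = m
  length_snd : t.2.length = m
  proc_fst : proc false γ (q.map Prod.fst) t.1 = (jst γ q m).map Prod.fst
  proc_snd : proc true γ (q.map Prod.snd) t.2 = (jst γ q m).map Prod.snd
  fst_eq : t.1 = smsgs (fun i => !γ i) m ((q.map Prod.snd).map Prod.fst)
  snd_eq : t.2 = smsgs γ m ((q.map Prod.fst).map Prod.fst)

/-- Processing the received messages separately yields the two halves of one joint queue. The
messages themselves are the announcement lists of each player's bits `s` alone. -/
theorem talkInv (N : ℕ → ℕ) (γ : ℕ → ℕ → Bool) {k : ℕ} (hk : k ≠ 0) (W : List Output)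
    (rA rB : List Bool) : ∀ m, TalkInv (γ k) (W.map toJoint) m
      (Protocol.talk ((otProtocol N γ).msgA k (W.map Prod.fst) rA)
        ((otProtocol N γ).msgB k (W.map Prod.snd) rB) m)
  | 0 => ⟨rfl, rfl, rfl, rfl, rfl, rfl⟩
  | m + 1 => by
      have ih := talkInv N γ hk W rA rB m
      set t := Protocol.talk ((otProtocol N γ).msgA k (W.map Prod.fst) rA)
        ((otProtocol N γ).msgB k (W.map Prod.snd) rB) m with ht
      set q := W.map toJoint with hq
      have hA : (W.map Prod.fst).map toPair = q.map Prod.fst := by simp [hq, toJoint]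
      have hB : W.map Prod.snd = q.map Prod.snd := by simp [hq, toJoint]
      have ha : (otProtocol N γ).msgA k (W.map Prod.fst) rA t.1
          = qmsg (γ k m) ((jst (γ k) q m).map Prod.fst) := by
        simp only [otProtocol, if_neg hk, hA, ih.proc_fst, ih.length_fst]
      have hb : ∀ a, (otProtocol N γ).msgB k (W.map Prod.snd) rB (t.2 ++ [a])
          = qmsg (!γ k m) ((jst (γ k) q m).map Prod.snd) := by
        intro a
        simp only [otProtocol, if_neg hk, hB, List.dropLast_concat, ih.proc_snd, ih.length_snd,
          List.append_eq_nil_iff, List.cons_ne_nil, and_false, if_false]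
      have hs : Protocol.talk ((otProtocol N γ).msgA k (W.map Prod.fst) rA)
        ((otProtocol N γ).msgB k (W.map Prod.snd) rB) (m + 1)
          = (t.1 ++ [qmsg (!γ k m) ((jst (γ k) q m).map Prod.snd)],
            t.2 ++ [qmsg (γ k m) ((jst (γ k) q m).map Prod.fst)]) := by
        simp only [Protocol.talk, ← ht, ha, hb]
      rw [hs]
      refine ⟨by simp [ih.length_fst], by simp [ih.length_snd], ?_, ?_, ?_, ?_⟩
      · rw [proc_snoc, ih.proc_fst, ih.length_fst, jst, map_fst_jstep, Bool.false_xor]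
      · rw [proc_snoc, ih.proc_snd, ih.length_snd, jst, map_snd_jstep, Bool.true_xor]
      · dsimp only
        rw [smsgs_snoc, ← ih.fst_eq, qmsg_eq_smsg, map_jst_snd]
      · dsimp only
        rw [smsgs_snoc, ← ih.snd_eq, qmsg_eq_smsg, map_jst_fst]

/-- The error bit of a joint pair. -/
def jerr (u : (Bool × Bool) × (Bool × Bool)) : Bool := xor (xor u.1.2 u.2.2) (u.1.1 && u.2.1)

/-- Modulo 2, if the sender announces `d = s ⊕ s'` and the receiver holds `t, t'`, then `s t + s' t'
= s (t + t') + d t'`. The term `d t'` is the correction, and errors simply add up. -/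
theorem jerr_jcomb (g : Bool) (u v : (Bool × Bool) × (Bool × Bool)) :
    jerr (jcomb g u v) = xor (jerr u) (jerr v) := by
  revert g u v
  decide

theorem jerr_toJoint (o : Output) : jerr (toJoint o) = err o := by
  revert o
  decide

theorem err_ofJoint (u : (Bool × Bool) × (Bool × Bool)) : err (ofJoint u) = jerr u := by
  revert u
  decide

/-- The exclusive or of the bits in a list. -/
def xorList (l : List Bool) : Bool := l.foldr xor false

theorem xorList_append (l l' : List Bool) : xorList (l ++ l') = xor (xorList l) (xorList l') := by
  induction l with
  | nil => simp [xorList]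
  | cons a l ih => simp only [xorList, List.cons_append, List.foldr_cons] at ih ⊢; rw [ih]; simp

theorem xorList_jst (γ : ℕ → Bool) (q : List ((Bool × Bool) × (Bool × Bool))) :
    ∀ m, xorList ((jst γ q m).map jerr) = xorList (q.map jerr)
  | 0 => rfl
  | m + 1 => by
      rw [← xorList_jst γ q m, jst]
      match jst γ q m with
      | [] => rfl
      | [u] => rfl
      | u :: v :: r =>
        simp only [jstep, List.map_append, xorList_append, List.map_cons, List.map_nil, jerr_jcomb]
        simp only [xorList, List.foldr_cons, List.foldr_nil, Bool.xor_false]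
        rw [Bool.xor_comm, Bool.xor_assoc]

section
variable (N : ℕ → ℕ) (γ : ℕ → ℕ → Bool) {k : ℕ}

theorem messages_eq (hk : k ≠ 0) (w : Fin ((otProtocol N γ).numWOT k) → Output)
    (rA rB : List Bool) :
    (otProtocol N γ).messages k w rA rB
      = Protocol.talk ((otProtocol N γ).msgA k ((List.ofFn w).map Prod.fst) rA)
        ((otProtocol N γ).msgB k ((List.ofFn w).map Prod.snd) rB) (N k - 1) := by
  have hr : (otProtocol N γ).rounds k = N k - 1 := if_neg hk
  rw [Protocol.messages, hr, List.map_ofFn, List.map_ofFn]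
  rfl

theorem play_eq (hk : k ≠ 0) (w : Fin ((otProtocol N γ).numWOT k) → Output) (rA rB : List Bool) :
    (otProtocol N γ).play k w rA rB
      = ofJoint ((jst (γ k) ((List.ofFn w).map toJoint) (N k - 1)).headD
          ((false, false), (false, false))) := by
  have h := talkInv N γ hk (List.ofFn w) rA rB (N k - 1)
  rw [← messages_eq N γ hk w rA rB] at h
  have hA : ((List.ofFn fun j => (w j).1).map toPair)
      = ((List.ofFn w).map toJoint).map Prod.fst := by
    simp only [List.map_ofFn]; rfl
  have hB : (List.ofFn fun j => (w j).2) = ((List.ofFn w).map toJoint).map Prod.snd := by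
    simp only [List.map_ofFn]; rfl
  have h1 : (otProtocol N γ).outA k (List.ofFn fun j => (w j).1) rA
      ((otProtocol N γ).messages k w rA rB).1 = ofPair (((jst (γ k) ((List.ofFn w).map toJoint)
        (N k - 1)).map Prod.fst).headD (false, false)) := by
    rw [← h.proc_fst, ← hA]
    exact if_neg hk
  have h2 : (otProtocol N γ).outB k (List.ofFn fun j => (w j).2) rB
      ((otProtocol N γ).messages k w rA rB).2 = (((jst (γ k) ((List.ofFn w).map toJoint)
        (N k - 1)).map Prod.snd).headD (false, false)) := by
    rw [← h.proc_snd, ← hB]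
    exact if_neg hk
  rw [Protocol.play, h1, h2]
  cases jst (γ k) ((List.ofFn w).map toJoint) (N k - 1) <;> rfl

/-- The error of the protocol is thus a function of the errors of the instances, which the
hypotheses already give to the corrupted player. -/
theorem err_play (hk : k ≠ 0) {m : ℕ} (hN : (otProtocol N γ).numWOT k = m + 1)
    (w : Fin ((otProtocol N γ).numWOT k) → Output) (rA rB : List Bool) :
    err ((otProtocol N γ).play k w rA rB) = xorList (List.ofFn fun j => err (w j)) := by
  have hl := length_jst (γ k) ((List.ofFn w).map toJoint) 0 (N k - 1) (by
    simp only [List.length_map, List.length_ofFn]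
    change N k = m + 1 at hN
    change N k = _
    omega)
  have hx := xorList_jst (γ k) ((List.ofFn w).map toJoint) (N k - 1)
  rw [play_eq N γ hk, err_ofJoint]
  have hE : (List.ofFn fun j => err (w j)) = ((List.ofFn w).map toJoint).map jerr := by
    simp only [List.map_ofFn]
    exact congrArg List.ofFn (funext fun j => (jerr_toJoint (w j)).symm)
  rw [hE, ← hx]
  match jst (γ k) ((List.ofFn w).map toJoint) (N k - 1), hl with
  -- After the last round exactly one pair is left, so the total error is the error of the output.
  | [u], _ => simp [xorList]

/-! ## Security in the semi-honest model -/

theorem tsum_list_cons {g : List Bool → ℝ≥0∞} (h : g [] = 0) :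
    ∑' l, g l = ∑' d, ∑' l, g (d :: l) := by
  rw [← ENNReal.tsum_prod (f := fun d l => g (d :: l))]
  refine (Function.Injective.tsum_eq (g := fun p : Bool × List Bool => p.1 :: p.2) ?_ ?_).symm
  · rintro ⟨a, l⟩ ⟨b, l'⟩ h
    simpa using h
  · intro l hl
    match l with
    | [] => exact (hl h).elim
    | d :: l => exact ⟨(d, l), rfl⟩

/-- The bias of the final bit given all announcements. -/
theorem tsum_smsgs_le_leak : ∀ (m : ℕ) (γ : ℕ → Bool) (L : (List Bool → ℝ≥0∞) → ℝ≥0∞),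
    L (fun _ => 0) = 0 →
    ∑' ms, bias (L fun l => if smsgs γ m l = ms ∧ (sst γ l m).headD false = true then 1 else 0)
      (L fun l => if smsgs γ m l = ms ∧ (sst γ l m).headD false = false then 1 else 0)
      ≤ leak γ m L
  | 0, γ, L, hL => by
      rw [tsum_eq_single []]
      -- Without rounds only the empty list of announcements has weight.
      · simp [smsgs, sst, leak]
      · intro ms hms
        simp [smsgs, hms.symm, hL, bias]
  | m + 1, γ, L, hL => by
      rw [tsum_list_cons (by simp [smsgs, hL, bias])]
      rw [leak]
      refine ENNReal.tsum_le_tsum fun d => ?_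
      refine le_trans (le_of_eq ?_) (tsum_smsgs_le_leak m _ _ (by simp [hL]))
      refine tsum_congr fun ms => ?_
      have key : ∀ b l, (if smsgs γ (m + 1) l = d :: ms ∧ (sst γ l (m + 1)).headD false = b then
          (1 : ℝ≥0∞) else 0) = if smsg (γ 0) l = d then
            (if smsgs (fun i => γ (i + 1)) m (sstep (γ 0) l) = ms ∧
              (sst (fun i => γ (i + 1)) (sstep (γ 0) l) m).headD false = b then 1 else 0) else 0 := by
        intro b l
        rw [sst_succ']
        simp only [smsgs, List.cons.injEq]
        by_cases h : smsg (γ 0) l = d <;> simp [h]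
      simp only [key]

theorem tsum_pi_succ {n : ℕ} {β : Fin (n + 1) → Type} (f : ((j : Fin (n + 1)) → β j) → ℝ≥0∞) :
    ∑' o, f o = ∑' o₀, ∑' o : (j : Fin n) → β j.succ, f (Fin.cons o₀ o) := by
  rw [← ENNReal.tsum_prod (f := fun o₀ o => f (Fin.cons o₀ o))]
  exact ((Fin.consEquiv β).tsum_eq f).symm

/-- Independent observations are averaged one coordinate at a time, using linearity in that
coordinate with all others fixed. -/
theorem Multi.tsum_pi_le : ∀ {n : ℕ} {G : List Item → ℝ≥0∞}, Multi n G → ∀ {β : Fin n → Type}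
    (y : (j : Fin n) → β j → Item) (x : Item), (∀ j, ∑' o, (y j o).1 ≤ x.1) →
    (∀ j, ∑' o, ((y j o).1 + (y j o).2) ≤ x.1 + x.2) →
    ∑' o : (j : Fin n) → β j, G (List.ofFn fun j => y j (o j)) ≤ G (List.replicate n x)
  | 0, G, _, β, y, x, _, _ => by
      rw [tsum_eq_single (fun j => j.elim0) (fun o ho => (ho (funext fun j => j.elim0)).elim)]
      simp
  | n + 1, G, hG, β, y, x, h1, h2 => by
      rw [tsum_pi_succ]
      simp only [List.ofFn_succ, Fin.cons_zero, Fin.cons_succ]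
      calc _ ≤ ∑' o₀, G (y 0 o₀ :: List.replicate n x) :=
            ENNReal.tsum_le_tsum fun o₀ => (hG.1 (y 0 o₀)).tsum_pi_le (fun j => y j.succ) x
              (fun j => h1 j.succ) fun j => h2 j.succ
        _ ≤ _ := (hG.2 _ List.length_replicate).tsum_le _ _ (h1 0) (h2 0)

/-- Given the observations of all components, the hidden bits are independent. -/
theorem wsum_prodPMF : ∀ {n : ℕ} {α β : Fin n → Type} (μ : (j : Fin n) → PMF (α j))
    (X : (j : Fin n) → α j → Bool) (O : (j : Fin n) → α j → β j) (o : (j : Fin n) → β j)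
    (f : List Bool → ℝ≥0∞) [∀ w : (j : Fin n) → α j, Decidable (∀ j, O j (w j) = o j)],
    wsum (prodPMF μ) (fun w => if ∀ j, O j (w j) = o j then f (List.ofFn fun j => X j (w j)) else 0)
      = eprod (List.ofFn fun j => fun b => jointW (μ j) (X j) (O j) b (o j)) f
  | 0, α, β, μ, X, O, o, f, _ => by
      rw [prodPMF, wsum_pure, if_pos fun j => j.elim0]
      simp [eprod]
  | n + 1, α, β, μ, X, O, o, f, _ => by
      classical
      simp only [prodPMF, wsum_bind, wsum_map, Fin.forall_fin_succ, Fin.cons_zero, Fin.cons_succ,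
        List.ofFn_succ, eprod, ite_and]
      have ih := fun x => wsum_prodPMF (fun j => μ j.succ) (fun j => X j.succ) (fun j => O j.succ)
        (fun j => o j.succ) fun l => f (X 0 x :: l)
      have : ∀ x, wsum (prodPMF fun j : Fin n => μ j.succ) (fun w => if O 0 x = o 0 then
          (if ∀ j : Fin n, O j.succ (w j) = o j.succ then
            f (X 0 x :: List.ofFn fun j => X j.succ (w j)) else 0) else 0)
          = if O 0 x = o 0 then eprod (List.ofFn fun j : Fin n => fun b =>
            jointW (μ j.succ) (X j.succ) (O j.succ) b (o j.succ)) fun l => f (X 0 x :: l) else 0 := by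
        intro x
        split_ifs with h
        · exact ih x
        · simp [wsum]
      simp only [this, jointW, ← ENNReal.tsum_mul_right]
      rw [ENNReal.tsum_comm]
      refine tsum_congr fun x => ?_
      rw [tsum_eq_single (X 0 x) (fun b hb => by simp [hb.symm])]
      by_cases h : O 0 x = o 0 <;> simp [h]

/-- Conditioned on the observations `o` the hidden bits have a product weight, so `leak_le` bounds
the bias by `gval` of exact items. Averaging over `o` then uses multilinearity. -/
theorem advW_prodPMF_le {n m : ℕ} (hn : n = m + 1) (γ : ℕ → Bool) {α β : Fin n → Type}
    (μ : (j : Fin n) → PMF (α j)) (X : (j : Fin n) → α j → Bool) (O : (j : Fin n) → α j → β j)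
    (x : Item) (hx : 1 ≤ x.1 + x.2) (h : ∀ j, advW (μ j) (X j) (O j) ≤ x.1) :
    advW (prodPMF μ) (fun w => (sst γ (List.ofFn fun j => X j (w j)) m).headD false)
      (fun w => ((fun j => O j (w j)), smsgs γ m (List.ofFn fun j => X j (w j))))
      ≤ gval γ m (List.replicate n x) := by
  classical
  have key : ∀ (b : Bool) (o : (j : Fin n) → β j) (ms : List Bool),
      jointW (prodPMF μ) (fun w => (sst γ (List.ofFn fun j => X j (w j)) m).headD false)
        (fun w => ((fun j => O j (w j)), smsgs γ m (List.ofFn fun j => X j (w j)))) b (o, ms)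
      = eprod (List.ofFn fun j => fun b => jointW (μ j) (X j) (O j) b (o j))
          (fun l => if smsgs γ m l = ms ∧ (sst γ l m).headD false = b then 1 else 0) := by
    intro b o ms
    rw [← wsum_prodPMF]
    unfold jointW wsum
    refine tsum_congr fun w => ?_
    have he : (fun j => O j (w j)) = o ↔ ∀ j, O j (w j) = o j := funext_iff
    beta_reduce
    by_cases h1 : ∀ j, O j (w j) = o j
    · rw [if_pos h1]
      simp only [Prod.mk.injEq, he.2 h1, true_and, mul_ite, mul_one, mul_zero]
      exact if_congr and_comm rfl rfl
    · rw [if_neg h1, mul_zero, if_neg]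
      exact fun h2 => h1 (he.1 (Prod.mk.inj h2.2).1)
  rw [advW, ENNReal.tsum_prod']
  simp only [key]
  calc _ ≤ ∑' o : (j : Fin n) → β j, gval γ m (List.ofFn fun j =>
        itemOf (jointW (μ j) (X j) (O j) true (o j)) (jointW (μ j) (X j) (O j) false (o j))) := by
        refine ENNReal.tsum_le_tsum fun o => ?_
        refine (tsum_smsgs_le_leak m γ _ ?_).trans (leak_le m γ _ _ (by simp [hn]) ?_)
        · simpa using eprod_mul (List.ofFn fun j => fun b => jointW (μ j) (X j) (O j) b (o j)) 0
            fun _ => 0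
        · rw [List.forall₂_iff_get]
          refine ⟨by simp, fun i h1 h2 => ?_⟩
          simp only [List.get_eq_getElem, List.getElem_ofFn]
          exact dom_itemOf fun b => jointW (μ ⟨i, _⟩) (X ⟨i, _⟩) (O ⟨i, _⟩) b (o ⟨i, _⟩)
    _ ≤ _ := by
        subst hn
        -- The biases of one instance sum to its advantage, the weights to 1.
        refine (multi_gval m γ).tsum_pi_le (fun j o => itemOf (jointW (μ j) (X j) (O j) true o)
          (jointW (μ j) (X j) (O j) false o)) x h fun j => ?_
        simp_rw [itemOf_mass]
        rw [tsum_jointW_add]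
        exact hx

end

end WeakOT

open scoped ENNReal
namespace WeakOT

/-! ## The protocol implements weak oblivious transfer -/

theorem coins_zero : coins 0 = PMF.pure [] := by
  refine PMF.ext_wsum fun f => ?_
  rw [coins, wsum_map, wsum_pure]
  simp only [List.ofFn_zero]
  exact wsum_const _ _

theorem advW_map {α α' β : Type} (μ : PMF α) (g : α → α') (X : α' → Bool) (Y : α' → β) :
    advW (μ.map g) X Y = advW μ (fun a => X (g a)) (fun a => Y (g a)) := by
  classical
  have key : ∀ {δ : Type} (μ : PMF δ) (X : δ → Bool) (Y : δ → β) b y,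
      jointW μ X Y b y = wsum μ fun a => if X a = b ∧ Y a = y then 1 else 0 := by
    intro δ μ X Y b y
    unfold jointW wsum
    exact tsum_congr fun a => by simp
  simp only [advW, key, wsum_map]

theorem prob_eq_wsum {α : Type} (μ : PMF α) (s : Set α) [DecidablePred (· ∈ s)] :
    prob μ s = (wsum μ fun a => if a ∈ s then 1 else 0).toReal := by
  rw [prob, PMF.toOuterMeasure_apply, wsum]
  congr 1
  exact tsum_congr fun a => by simp [Set.indicator_apply]

theorem wsum_prodPMF_eq_zero : ∀ {n : ℕ} {α : Fin n → Type} (μ : (j : Fin n) → PMF (α j))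
    (f : ((j : Fin n) → α j) → ℝ≥0∞), (∀ w, (∀ j, μ j (w j) ≠ 0) → f w = 0) →
    wsum (prodPMF μ) f = 0
  | 0, α, μ, f, h => by rw [prodPMF, wsum_pure]; exact h _ fun j => j.elim0
  | n + 1, α, μ, f, h => by
      simp only [prodPMF, wsum_bind, wsum_map]
      rw [wsum, ENNReal.tsum_eq_zero]
      intro x
      by_cases hx : μ 0 x = 0
      · rw [hx, zero_mul]
      · rw [wsum_prodPMF_eq_zero _ _ fun w hw => h _ ?_, mul_zero]
        intro j
        refine Fin.cases ?_ (fun j => ?_) j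
        · exact hx
        · exact hw j

section
variable (N : ℕ → ℕ) (γ : ℕ → ℕ → Bool) {k : ℕ}

theorem messages_eq_smsgs (hk : k ≠ 0) (w : Fin ((otProtocol N γ).numWOT k) → Output)
    (rA rB : List Bool) :
    (otProtocol N γ).messages k w rA rB
      = (smsgs (fun i => !γ k i) (N k - 1) (List.ofFn fun j => (w j).2.1),
        smsgs (γ k) (N k - 1) (List.ofFn fun j => xor (w j).1.1 (w j).1.2)) := by
  have h := talkInv N γ hk (List.ofFn w) rA rB (N k - 1)
  rw [← messages_eq N γ hk w rA rB] at h
  refine Prod.ext (h.fst_eq.trans ?_) (h.snd_eq.trans ?_)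
  · simp only [List.map_ofFn]; rfl
  · simp only [List.map_ofFn]; rfl

theorem xor_play_fst (hk : k ≠ 0) (w : Fin ((otProtocol N γ).numWOT k) → Output)
    (rA rB : List Bool) :
    xor ((otProtocol N γ).play k w rA rB).1.1 ((otProtocol N γ).play k w rA rB).1.2
      = (sst (γ k) (List.ofFn fun j => xor (w j).1.1 (w j).1.2) (N k - 1)).headD false := by
  have h := map_jst_fst (γ k) ((List.ofFn w).map toJoint) (N k - 1)
  have e : (((List.ofFn w).map toJoint).map Prod.fst).map Prod.fst
      = List.ofFn fun j => xor (w j).1.1 (w j).1.2 := by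
    simp only [List.map_ofFn]; rfl
  rw [e] at h
  rw [play_eq N γ hk, ← h, ← xor_ofPair_headD]
  cases jst (γ k) ((List.ofFn w).map toJoint) (N k - 1) <;> rfl

theorem play_snd_fst (hk : k ≠ 0) (w : Fin ((otProtocol N γ).numWOT k) → Output)
    (rA rB : List Bool) :
    ((otProtocol N γ).play k w rA rB).2.1
      = (sst (fun i => !γ k i) (List.ofFn fun j => (w j).2.1) (N k - 1)).headD false := by
  have h := map_jst_snd (γ k) ((List.ofFn w).map toJoint) (N k - 1)
  have e : (((List.ofFn w).map toJoint).map Prod.snd).map Prod.fst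
      = List.ofFn fun j => (w j).2.1 := by
    simp only [List.map_ofFn]; rfl
  rw [e] at h
  rw [play_eq N γ hk, ← h, ← fst_headD]
  cases jst (γ k) ((List.ofFn w).map toJoint) (N k - 1) <;> rfl

/-- The input that was not chosen is `x_c ⊕ s_A`, and `x_c = e ⊕ y` is in the view of the receiver
once the error is given. So it is as hard to predict as `s_A`. -/
theorem sel_not (o : Output) :
    sel o.1 (!o.2.1) = xor (xor o.1.1 o.1.2) (xor (err o) o.2.2) := by
  revert o
  decide

theorem play_zero (w : Fin ((otProtocol N γ).numWOT 0) → Output) (rA rB : List Bool) :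
    (otProtocol N γ).play 0 w rA rB
      = (freeOutA rA [rB.headD false], (rB.headD false, rA.headD false)) := rfl

theorem semiHonest_correct {m : ℕ} (hN : k ≠ 0 → (otProtocol N γ).numWOT k = m + 1)
    (F : Fin ((otProtocol N γ).numWOT k) → SemiHonestSystem)
    (hF : ∀ j, prob (F j).honest {o | err o = true} ≤ 0) :
    prob ((otProtocol N γ).semiHonest k F).honest {o | err o = true} ≤ 0 := by
  classical
  rw [prob_eq_wsum]
  refine le_of_eq ((ENNReal.toReal_eq_zero_iff _).2 (Or.inl ?_))
  simp only [Protocol.semiHonest, Protocol.honestRun, wsum_bind, wsum_map]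
  refine wsum_prodPMF_eq_zero _ _ fun w hw => ?_
  have hE : ∀ rA rB, err ((otProtocol N γ).play k w rA rB) = false := by
    intro rA rB
    -- For `k = 0` the sender puts the coin he has sent at the position chosen by the receiver, so
    -- no error can occur.
    by_cases hk : k = 0
    · subst hk
      rw [play_zero]
      cases h : rB.headD false <;> simp [freeOutA, err, sel]
    · rw [err_play N γ hk (hN hk)]
      have : ∀ j, err (w j) = false := by
        intro j
        by_contra h
        have h0 : prob (F j).honest {o | err o = true} = 0 := le_antisymm (hF j) (by
          rw [prob]; exact ENNReal.toReal_nonneg)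
        rw [prob, ENNReal.toReal_eq_zero_iff] at h0
        rcases h0 with h0 | h0
        · rw [PMF.toOuterMeasure_apply_eq_zero_iff, Set.disjoint_left] at h0
          exact h0 ((PMF.mem_support_iff _ _).2 (hw j)) (by simpa using h)
        · rw [PMF.toOuterMeasure_apply] at h0
          refine absurd h0 (ne_top_of_le_ne_top ENNReal.one_ne_top ?_)
          rw [← (F j).honest.tsum_coe]
          exact ENNReal.tsum_le_tsum fun a => Set.indicator_le_self _ _ _
      simp only [this]
      generalize (otProtocol N γ).numWOT k = n
      induction n with
      | zero => rfl
      | succ n ih => rw [List.ofFn_succ]; exact (Bool.false_xor _).trans ih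
  simp [hE, wsum]

/-- The view is reconstructed from the views and errors of the instances and the announcements of
the sender; the receiver's own messages and output are functions of these. By `sel_not` the
predicted bit is the sender's final `s` up to a known mask. -/
theorem semiHonest_secureA (hk : k ≠ 0) {m : ℕ} (hN : (otProtocol N γ).numWOT k = m + 1)
    (F : Fin ((otProtocol N γ).numWOT k) → SemiHonestSystem) {p q : ℝ} (hq : 0 ≤ q)
    (hF : ∀ j, (F j).IsWOT p q 0) (x : Item) (hx : 1 ≤ x.1 + x.2) (hqx : ENNReal.ofReal q ≤ x.1)
    {t : ℝ} (ht : 0 ≤ t)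
    (hG : gval (γ k) m (List.replicate ((otProtocol N γ).numWOT k) x) ≤ ENNReal.ofReal t) :
    predAdv ((otProtocol N γ).semiHonest k F).corruptB (fun w => sel w.1.1 (!w.1.2.1))
      (fun w => ((w.1.2, w.2), err w.1)) ≤ t := by
  rw [predAdv_le_iff _ _ _ ht]
  have hm : N k - 1 = m := Nat.sub_eq_of_eq_add hN
  have hcA : (otProtocol N γ).coinsA k = 0 := if_neg hk
  have hcB : (otProtocol N γ).coinsB k = 0 := if_neg hk
  have hμ : ((otProtocol N γ).semiHonest k F).corruptB = (prodPMF fun j => (F j).corruptB).map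
      fun w => ((otProtocol N γ).play k (fun j => (w j).1) [] [],
        (fun j => ((w j).1.2, (w j).2)), [],
          (otProtocol N γ).messages k (fun j => (w j).1) [] []) := by
    simp only [Protocol.semiHonest, hcA, hcB, coins_zero, PMF.pure_bind, PMF.pure_map]
    rfl
  rw [hμ]
  refine (advW_map _ _ _ _).le.trans ?_
  refine le_trans ?_ ((advW_prodPMF_le hN (γ k) (fun j => (F j).corruptB)
    (fun j w => xor w.1.1.1 w.1.1.2) (fun j w => ((w.1.2, w.2), err w.1)) x hx
    fun j => ?_).trans hG)
  · refine advW_le_of_comp _ _ _ _ _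
      (fun z => (((otProtocol N γ).outB k (List.ofFn fun j => (z.1 j).1.1) [] z.2,
        (fun j => (z.1 j).1), [], (smsgs (fun i => !γ k i) m (List.ofFn fun j => (z.1 j).1.1.1),
          z.2)), xorList (List.ofFn fun j => (z.1 j).2)))
      (fun z => xor (xorList (List.ofFn fun j => (z.1 j).2))
        ((otProtocol N γ).outB k (List.ofFn fun j => (z.1 j).1.1) [] z.2).2) ?_ ?_
    · intro w _
      simp only [err_play N γ hk hN]
      simp only [messages_eq_smsgs N γ hk, hm, Protocol.play]
    · intro w _
      rw [sel_not, xor_play_fst N γ hk, err_play N γ hk hN, hm]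
      simp only [messages_eq_smsgs N γ hk, hm, Protocol.play]
  -- The same masking turns the hypothesis on each instance into one about its bit `x₀ ⊕ x₁`.
  · refine le_trans ?_ (((predAdv_le_iff _ _ _ hq).1 (hF j).secureA).trans hqx)
    refine advW_le_of_comp _ _ _ _ _ id (fun z => xor z.2 z.1.1.2) (fun _ _ => rfl) fun w _ => ?_
    rw [sel_not]
    simp

/-- Here the predicted bit is the receiver's `s` itself, so no mask is needed. -/
theorem semiHonest_secureB (hk : k ≠ 0) {m : ℕ} (hN : (otProtocol N γ).numWOT k = m + 1)
    (F : Fin ((otProtocol N γ).numWOT k) → SemiHonestSystem) {p q : ℝ} (hp : 0 ≤ p)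
    (hF : ∀ j, (F j).IsWOT p q 0) (x : Item) (hx : 1 ≤ x.1 + x.2) (hpx : ENNReal.ofReal p ≤ x.1)
    {t : ℝ} (ht : 0 ≤ t)
    (hG : gval (fun i => !γ k i) m (List.replicate ((otProtocol N γ).numWOT k) x)
      ≤ ENNReal.ofReal t) :
    predAdv ((otProtocol N γ).semiHonest k F).corruptA (fun w => w.1.2.1)
      (fun w => ((w.1.1, w.2), err w.1)) ≤ t := by
  rw [predAdv_le_iff _ _ _ ht]
  have hm : N k - 1 = m := Nat.sub_eq_of_eq_add hN
  have hcA : (otProtocol N γ).coinsA k = 0 := if_neg hk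
  have hcB : (otProtocol N γ).coinsB k = 0 := if_neg hk
  have hμ : ((otProtocol N γ).semiHonest k F).corruptA = (prodPMF fun j => (F j).corruptA).map
      fun w => ((otProtocol N γ).play k (fun j => (w j).1) [] [],
        (fun j => ((w j).1.1, (w j).2)), [],
          (otProtocol N γ).messages k (fun j => (w j).1) [] []) := by
    simp only [Protocol.semiHonest, hcA, hcB, coins_zero, PMF.pure_bind, PMF.pure_map]
    rfl
  rw [hμ]
  refine (advW_map _ _ _ _).le.trans ?_
  refine le_trans ?_ ((advW_prodPMF_le hN (fun i => !γ k i) (fun j => (F j).corruptA)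
    (fun j w => w.1.2.1) (fun j w => ((w.1.1, w.2), err w.1)) x hx
    fun j => ((predAdv_le_iff _ _ _ hp).1 (hF j).secureB).trans hpx).trans hG)
  refine advW_le_of_comp _ _ _ _ _
    (fun z => (((otProtocol N γ).outA k (List.ofFn fun j => (z.1 j).1.1) [] z.2,
      (fun j => (z.1 j).1), [], (z.2, smsgs (γ k) m
        (List.ofFn fun j => xor (z.1 j).1.1.1 (z.1 j).1.1.2))),
        xorList (List.ofFn fun j => (z.1 j).2)))
    (fun _ => false) ?_ ?_
  · intro w _
    simp only [err_play N γ hk hN]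
    simp only [messages_eq_smsgs N γ hk, hm, Protocol.play]
  · intro w _
    rw [play_snd_fst N γ hk, hm, Bool.xor_false]

/-! ## The outputs of honest players -/

theorem wsum_uniform {α : Type} [Fintype α] [Nonempty α] (f : α → ℝ≥0∞) :
    wsum (PMF.uniformOfFintype α) f = (Fintype.card α : ℝ≥0∞)⁻¹ * ∑ a, f a := by
  simp only [wsum, PMF.uniformOfFintype_apply, tsum_fintype, Finset.mul_sum]

theorem wsum_rot (f : Output → ℝ≥0∞) :
    wsum rot f = 8⁻¹ * ∑ w : (Bool × Bool) × Bool, f (w.1, (w.2, sel w.1 w.2)) := by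
  rw [rot, wsum_map, wsum_uniform]
  rfl

/-- Among the 64 pairs of outcomes of two perfect transfers, each of the 8 outcomes of a perfect
transfer arises exactly 8 times as their combination. -/
theorem wsum_rot_jcomb (g : Bool) (H : (Bool × Bool) × (Bool × Bool) → ℝ≥0∞) :
    wsum rot (fun u => wsum rot fun v => H (jcomb g (toJoint u) (toJoint v)))
      = wsum rot fun s => H (toJoint s) := by
  simp only [wsum_rot]
  rw [← Finset.mul_sum]
  have h8 : (8 : ℝ≥0∞)⁻¹ * 8 = 1 := ENNReal.inv_mul_cancel (by norm_num) (by norm_num)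
  have key : ∑ w : (Bool × Bool) × Bool, ∑ w' : (Bool × Bool) × Bool,
      H (jcomb g (toJoint (w.1, (w.2, sel w.1 w.2))) (toJoint (w'.1, (w'.2, sel w'.1 w'.2))))
      = 8 * ∑ w : (Bool × Bool) × Bool, H (toJoint (w.1, (w.2, sel w.1 w.2))) := by
    cases g <;>
      simp [Fintype.sum_prod_type, jcomb, comb, toJoint, toPair, sel] <;> ring
  rw [key, ← mul_assoc (8⁻¹ : ℝ≥0∞) 8, h8, one_mul]

/-- The combined transfer is again perfect and independent of the rest, so the queue looks like a
shorter queue of fresh ones. -/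
theorem eprod_rot_jstep (g : Bool) (m : ℕ)
    (f : List ((Bool × Bool) × (Bool × Bool)) → ℝ≥0∞) :
    eprod (List.replicate (m + 2) (rot : Output → ℝ≥0∞)) (fun l => f (jstep g (l.map toJoint)))
      = eprod (List.replicate (m + 1) (rot : Output → ℝ≥0∞)) fun l => f (l.map toJoint) := by
  have h := wsum_rot_jcomb g fun s => eprod (List.replicate m (rot : Output → ℝ≥0∞)) fun l =>
    f (l.map toJoint ++ [s])
  rw [List.replicate_succ' (n := m), eprod_snoc, eprod_tsum]
  simp only [eprod_mul, List.map_append, List.map_cons, List.map_nil]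
  exact h

theorem eprod_rot_jst (γ : ℕ → Bool) : ∀ (m n : ℕ)
    (f : List ((Bool × Bool) × (Bool × Bool)) → ℝ≥0∞),
    eprod (List.replicate (n + 1 + m) (rot : Output → ℝ≥0∞))
        (fun l => f (jst γ (l.map toJoint) m))
      = eprod (List.replicate (n + 1) (rot : Output → ℝ≥0∞)) fun l => f (l.map toJoint)
  | 0, n, f => rfl
  | m + 1, n, f => by
      have h := eprod_rot_jst γ m (n + 1) fun q => f (jstep (γ m) q)
      rw [eprod_rot_jstep] at h
      rw [← h, show n + 1 + (m + 1) = n + 1 + 1 + m by omega]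
      rfl

theorem wsum_prodPMF_const {R : Type} (μ : PMF R) : ∀ (n : ℕ) (f : List R → ℝ≥0∞),
    wsum (prodPMF fun _ : Fin n => μ) (fun w => f (List.ofFn w))
      = eprod (List.replicate n (μ : R → ℝ≥0∞)) f
  | 0, f => by rw [prodPMF, wsum_pure]; simp [eprod]
  | n + 1, f => by
      simp only [prodPMF, wsum_bind, wsum_map, List.ofFn_succ, Fin.cons_zero, Fin.cons_succ]
      simp only [fun x => wsum_prodPMF_const μ n fun l => f (x :: l)]
      rfl

theorem ofJoint_toJoint (o : Output) : ofJoint (toJoint o) = o := by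
  revert o
  decide

theorem wsum_coins_one (f : List Bool → ℝ≥0∞) : wsum (coins 1) f = 2⁻¹ * ∑ a, f [a] := by
  rw [coins, wsum_map, wsum_uniform, ← (Equiv.funUnique (Fin 1) Bool).symm.sum_comp]
  simp

theorem wsum_coins_two (f : List Bool → ℝ≥0∞) :
    wsum (coins 2) f = 4⁻¹ * ∑ a : Bool × Bool, f [a.1, a.2] := by
  rw [coins, wsum_map, wsum_uniform, ← (finTwoArrowEquiv Bool).symm.sum_comp]
  simp

theorem honestRun_rot {m : ℕ} (hN : k ≠ 0 → (otProtocol N γ).numWOT k = m + 1) :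
    ((otProtocol N γ).honestRun k fun _ => rot) = rot := by
  refine PMF.ext_wsum fun f => ?_
  simp only [Protocol.honestRun, wsum_bind, wsum_map]
  -- For `k = 0` the three coins are independent. The two sender coins are only permuted according
  -- to the receiver's coin, which keeps them uniform and independent of it.
  by_cases hk : k = 0
  · subst hk
    simp only [play_zero, wsum_const]
    have h2 : (otProtocol N γ).coinsA 0 = 2 := rfl
    have h1 : (otProtocol N γ).coinsB 0 = 1 := rfl
    have h8 : (8 : ℝ≥0∞)⁻¹ = 4⁻¹ * 2⁻¹ := by
      rw [← ENNReal.mul_inv (by norm_num) (by norm_num)]; norm_num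
    rw [h1, h2, wsum_coins_two, wsum_rot, h8]
    simp only [wsum_coins_one]
    rw [← Finset.mul_sum, mul_assoc]
    congr 2
    simp [Fintype.sum_prod_type, freeOutA, sel]
    ring
  · have hm : N k - 1 = m := Nat.sub_eq_of_eq_add (hN hk)
    have hcA : (otProtocol N γ).coinsA k = 0 := if_neg hk
    have hcB : (otProtocol N γ).coinsB k = 0 := if_neg hk
    simp only [hcA, hcB, coins_zero, wsum_pure, play_eq N γ hk, hm]
    refine (wsum_prodPMF_const rot ((otProtocol N γ).numWOT k) fun l =>
      f (ofJoint ((jst (γ k) (l.map toJoint) m).headD ((false, false), (false, false))))).trans ?_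
    rw [hN hk, Nat.add_comm m 1]
    refine (eprod_rot_jst (γ k) m 0 fun q =>
      f (ofJoint (q.headD ((false, false), (false, false))))).trans ?_
    simp [eprod, ofJoint_toJoint, wsum]

end

end WeakOT

open scoped ENNReal
namespace WeakOT

/-! ## Levels: all items are combined in pairs in the same way -/

/-- Who announces in the rounds, if this is given for each level. -/
def expand : List Bool → List Bool
  | [] => []
  | g :: gs => List.replicate (2 ^ gs.length) g ++ expand gs

theorem length_expand : ∀ gs : List Bool, (expand gs).length = 2 ^ gs.length - 1
  | [] => rfl
  | g :: gs => by
      have := Nat.one_le_two_pow (n := gs.length)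
      simp only [expand, List.length_append, List.length_replicate, length_expand gs,
        List.length_cons, pow_succ]
      omega

theorem expand_map_not : ∀ gs : List Bool, expand (gs.map not) = (expand gs).map not
  | [] => rfl
  | g :: gs => by simp [expand, expand_map_not gs]

/-- The item that remains after the levels in the list. -/
noncomputable def levelItem : List Bool → Item → Item
  | [], x => x
  | g :: gs, x => levelItem gs (Item.comb g x x)

/-- Within a level all items are equal, and the combined ones line up behind those not yet treated;
so the queue order realizes a balanced tree. -/
theorem gval_replicate_append (g : Bool) (x : Item) (m : ℕ) : ∀ (a : ℕ) (γ : ℕ → Bool)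
    (Y : List Item), (∀ i < a, γ i = g) →
    gval γ (a + m) (List.replicate (2 * a) x ++ Y)
      = gval (fun i => γ (i + a)) m (Y ++ List.replicate a (Item.comb g x x))
  | 0, γ, Y, _ => by simp
  | a + 1, γ, Y, h => by
      have ih := gval_replicate_append g x m a (fun i => γ (i + 1)) (Y ++ [Item.comb g x x])
        fun i hi => h (i + 1) (by omega)
      rw [show 2 * (a + 1) = 2 * a + 1 + 1 by ring, show a + 1 + m = a + m + 1 by ring,
        List.replicate_succ, List.replicate_succ, List.cons_append, List.cons_append, gval,
        h 0 (by omega), List.append_assoc, ih]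
      simp only [List.append_assoc, List.singleton_append, ← List.replicate_succ]
      congr 1

theorem gval_expand : ∀ (gs : List Bool) (γ : ℕ → Bool) (x : Item),
    (∀ i < 2 ^ gs.length - 1, γ i = (expand gs).getD i false) →
    gval γ (2 ^ gs.length - 1) (List.replicate (2 ^ gs.length) x) = (levelItem gs x).1
  | [], γ, x, _ => by simp [gval, levelItem]
  | g :: gs, γ, x, h => by
      have h1 := Nat.one_le_two_pow (n := gs.length)
      have hl : 2 ^ (g :: gs).length - 1 = 2 ^ gs.length + (2 ^ gs.length - 1) := by
        rw [List.length_cons, pow_succ]; omega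
      rw [hl] at h ⊢
      have e := gval_replicate_append g x (2 ^ gs.length - 1) (2 ^ gs.length) γ [] fun i hi => by
        rw [h i (by omega), expand, List.getD_append _ _ _ _ (by simpa using hi)]
        simp [hi]
      rw [List.append_nil, List.nil_append] at e
      rw [List.length_cons, pow_succ, mul_comm, e, levelItem, gval_expand gs]
      intro i hi
      rw [h _ (by omega), expand, List.getD_append_right _ _ _ _ (by simp)]
      simp

/-! ## Which player announces on which level -/

/-- From `(a, b, d)`, which stands for the pair `(a / d, b / d)`, to the pair after one level. -/
def natStep (s : ℕ × ℕ × ℕ) : ℕ × ℕ × ℕ :=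
  if s.2.1 ≤ s.1 then (s.1 * s.1, s.2.1 * (2 * s.2.2 - s.2.1), s.2.2 * s.2.2)
  else (s.1 * (2 * s.2.2 - s.1), s.2.1 * s.2.1, s.2.2 * s.2.2)

/-- The sender announces if his security is the weaker one. -/
def natGate (s : ℕ × ℕ × ℕ) : Bool := decide (s.2.1 ≤ s.1)

/-- Who announces on the first `l` levels. -/
def gatesOf : (ℕ × ℕ × ℕ) → ℕ → List Bool
  | _, 0 => []
  | s, l + 1 => natGate s :: gatesOf (natStep s) l

theorem length_gatesOf : ∀ (l : ℕ) (s : ℕ × ℕ × ℕ), (gatesOf s l).length = l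
  | 0, _ => rfl
  | l + 1, s => congrArg (· + 1) (length_gatesOf l (natStep s))

/-- `a / d` -/
noncomputable def fstR (s : ℕ × ℕ × ℕ) : ℝ := s.1 / s.2.2

/-- `b / d` -/
noncomputable def sndR (s : ℕ × ℕ × ℕ) : ℝ := s.2.1 / s.2.2

/-- The common denominator is squared in each level, so the recursion stays within natural numbers
and loses no precision. -/
theorem natStep_fact {s : ℕ × ℕ × ℕ} (h : s.1 + s.2.1 < s.2.2) :
    fstR (natStep s) = (if s.2.1 ≤ s.1 then fstR s * fstR s else 1 - (1 - fstR s) * (1 - fstR s)) ∧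
    sndR (natStep s) =
      (if s.2.1 ≤ s.1 then 1 - (1 - sndR s) * (1 - sndR s) else sndR s * sndR s) := by
  obtain ⟨a, b, d⟩ := s
  have hd : (d : ℝ) ≠ 0 := by
    have : d ≠ 0 := by simp only at h; omega
    exact_mod_cast this
  have ha : ((2 * d - a : ℕ) : ℝ) = 2 * d - a := by
    rw [Nat.cast_sub (by simp only at h; omega)]; push_cast; ring
  have hb : ((2 * d - b : ℕ) : ℝ) = 2 * d - b := by
    rw [Nat.cast_sub (by simp only at h; omega)]; push_cast; ring
  unfold fstR sndR natStep
  split_ifs <;> simp only [Nat.cast_mul, ha, hb] <;> constructor <;> field_simp <;> ring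

theorem le_iff_sndR_le {s : ℕ × ℕ × ℕ} (h : s.1 + s.2.1 < s.2.2) :
    s.2.1 ≤ s.1 ↔ sndR s ≤ fstR s := by
  have hd : (0 : ℝ) < s.2.2 := by exact_mod_cast (by omega : 0 < s.2.2)
  unfold fstR sndR
  rw [div_le_div_iff_of_pos_right hd]
  exact_mod_cast Iff.rfl

theorem fstR_nonneg (s : ℕ × ℕ × ℕ) : 0 ≤ fstR s := by unfold fstR; positivity

theorem sndR_nonneg (s : ℕ × ℕ × ℕ) : 0 ≤ sndR s := by unfold sndR; positivity

/-- The gap `1 - p - q`. -/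
noncomputable def gap (s : ℕ × ℕ × ℕ) : ℝ := 1 - fstR s - sndR s

theorem gap_pos_iff {s : ℕ × ℕ × ℕ} (hd : 0 < s.2.2) : 0 < gap s ↔ s.1 + s.2.1 < s.2.2 := by
  have hd' : (0 : ℝ) < s.2.2 := by exact_mod_cast hd
  have : gap s = (s.2.2 - (s.1 + s.2.1)) / s.2.2 := by
    unfold gap fstR sndR
    field_simp
    ring
  rw [this, div_pos_iff_of_pos_right hd', sub_pos]
  exact_mod_cast Iff.rfl

/-- For `p ≥ q` the new gap is `(1 - q)² - p²`, which factors into `(1 - p - q) (1 + p - q)`. The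
new difference is `p² + (1 - q)² - 1`, where `2 (p² + (1 - q)²) = (1 + p - q)² + (1 - p - q)²`. Thus
both depend only on the old gap and `|p - q|`. -/
theorem gap_natStep {s : ℕ × ℕ × ℕ} (h : s.1 + s.2.1 < s.2.2) :
    gap (natStep s) = gap s * (1 + |fstR s - sndR s|) ∧
    |fstR (natStep s) - sndR (natStep s)|
      = |((1 + |fstR s - sndR s|) ^ 2 - 2 + gap s ^ 2) / 2| := by
  obtain ⟨h1, h2⟩ := natStep_fact h
  unfold gap
  rw [h1, h2]
  by_cases hc : s.2.1 ≤ s.1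
  · have := (le_iff_sndR_le h).1 hc
    rw [abs_of_nonneg (by linarith : 0 ≤ fstR s - sndR s)]
    simp only [if_pos hc]
    constructor
    · ring
    · congr 1; ring
  · have := not_le.1 fun h' => hc ((le_iff_sndR_le h).2 h')
    rw [abs_of_nonpos (by linarith : fstR s - sndR s ≤ 0)]
    simp only [if_neg hc]
    constructor
    · ring
    · rw [← abs_neg]; congr 1; ring

theorem natStep_lt {s : ℕ × ℕ × ℕ} (h : s.1 + s.2.1 < s.2.2) :
    (natStep s).1 + (natStep s).2.1 < (natStep s).2.2 := by
  have hd : 0 < (natStep s).2.2 := by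
    unfold natStep; split_ifs <;> exact Nat.mul_pos (by omega) (by omega)
  rw [← gap_pos_iff hd, (gap_natStep h).1]
  exact mul_pos ((gap_pos_iff (by omega)).2 h) (by positivity)

theorem iterate_natStep_lt {s : ℕ × ℕ × ℕ} (h : s.1 + s.2.1 < s.2.2) :
    ∀ l, (natStep^[l] s).1 + (natStep^[l] s).2.1 < (natStep^[l] s).2.2
  | 0 => h
  | l + 1 => by rw [Function.iterate_succ_apply']; exact natStep_lt (iterate_natStep_lt h l)

theorem abs_sub_le_one_sub_gap (s : ℕ × ℕ × ℕ) : |fstR s - sndR s| ≤ 1 - gap s := by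
  have := fstR_nonneg s
  have := sndR_nonneg s
  unfold gap
  exact abs_le.2 ⟨by linarith, by linarith⟩

/-- The basic inequality: two levels square `1 - gap ^ 2`. -/
theorem one_sub_gap_sq_le {s : ℕ × ℕ × ℕ} (h : s.1 + s.2.1 < s.2.2) :
    1 - gap (natStep (natStep s)) ^ 2 ≤ (1 - gap s ^ 2) ^ 2 := by
  obtain ⟨h1, h2⟩ := gap_natStep h
  obtain ⟨h3, -⟩ := gap_natStep (natStep_lt h)
  rw [h3, h2, h1]
  have hδ : 0 < gap s := (gap_pos_iff (by omega)).2 h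
  have hd := abs_sub_le_one_sub_gap s
  have hd0 := abs_nonneg (fstR s - sndR s)
  generalize |fstR s - sndR s| = d at *
  generalize gap s = δ at *
  -- Since `1 - (1 - δ²)² = δ² (2 - δ²)`, a factor `δ²` cancels.
  suffices hs : 2 - δ ^ 2 ≤ (1 + d) ^ 2 * (1 + |((1 + d) ^ 2 - 2 + δ ^ 2) / 2|) ^ 2 by
    have := mul_le_mul_of_nonneg_left hs (sq_nonneg δ)
    nlinarith
  have hδ1 : δ ^ 2 ≤ 1 := by nlinarith
  have hz : 1 ≤ (1 + d) ^ 2 := by nlinarith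
  generalize (1 + d) ^ 2 = z at *
  -- If the first level alone gives the factor `2 - δ²`, the second is not needed; otherwise the
  -- absolute value has a known sign.
  rcases le_total (2 - δ ^ 2) z with hc | hc
  · have h0 : 0 ≤ |(z - 2 + δ ^ 2) / 2| := abs_nonneg _
    have : 1 ≤ (1 + |(z - 2 + δ ^ 2) / 2|) ^ 2 := by nlinarith
    nlinarith
  · rw [abs_of_nonpos (by linarith)]
    obtain ⟨c, hcδ⟩ : ∃ c, δ ^ 2 = 2 - c := ⟨2 - δ ^ 2, by ring⟩
    rw [hcδ] at hc hδ1 ⊢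
    -- This product is `4 (z (1 + (c - z) / 2)² - c)`. Its second factor equals `4 (z - 1) + z (c -
    -- z)`, nonnegative for `1 ≤ z ≤ c`.
    have h5 : 0 ≤ (c - z) * (z * (4 + c) - 4 - z ^ 2) :=
      mul_nonneg (by linarith) (by nlinarith)
    nlinarith

theorem one_sub_gap_sq_iterate_le {s : ℕ × ℕ × ℕ} (h : s.1 + s.2.1 < s.2.2) :
    ∀ j, 1 - gap (natStep^[2 * j] s) ^ 2 ≤ (1 - gap s ^ 2) ^ 2 ^ j
  | 0 => by simp
  | j + 1 => by
      have h1 := iterate_natStep_lt h (2 * j)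
      have h2 := abs_sub_le_one_sub_gap (natStep^[2 * j] s)
      have h3 := abs_nonneg (fstR (natStep^[2 * j] s) - sndR (natStep^[2 * j] s))
      have h4 : 0 < gap (natStep^[2 * j] s) := (gap_pos_iff (by omega)).2 h1
      rw [show 2 * (j + 1) = 2 * j + 1 + 1 by ring, Function.iterate_succ_apply',
        Function.iterate_succ_apply', pow_succ 2 j, pow_mul]
      refine (one_sub_gap_sq_le h1).trans ?_
      exact pow_le_pow_left₀ (by nlinarith) (one_sub_gap_sq_iterate_le h j) 2

/-- A level at most doubles the gap because `|p - q| ≤ 1`. This gives a lower bound on the number of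
levels, needed to bound the precision. -/
theorem gap_iterate_le {s : ℕ × ℕ × ℕ} (h : s.1 + s.2.1 < s.2.2) :
    ∀ l, gap (natStep^[l] s) ≤ 2 ^ l * gap s
  | 0 => by simp
  | l + 1 => by
      have h1 := iterate_natStep_lt h l
      have h2 := abs_sub_le_one_sub_gap (natStep^[l] s)
      have h4 : 0 < gap (natStep^[l] s) := (gap_pos_iff (by omega)).2 h1
      rw [Function.iterate_succ_apply', (gap_natStep h1).1, pow_succ]
      have ih := gap_iterate_le h l
      nlinarith

/-- Both advantages are small enough. -/
def Stop (k : ℕ) (s : ℕ × ℕ × ℕ) : Prop := (s.1 + s.2.1) * 2 ^ k ≤ s.2.2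

theorem stop_iff {k : ℕ} {s : ℕ × ℕ × ℕ} (h : s.1 + s.2.1 < s.2.2) :
    Stop k s ↔ fstR s + sndR s ≤ (1 / 2) ^ k := by
  have hd : (0 : ℝ) < s.2.2 := by exact_mod_cast (by omega : 0 < s.2.2)
  unfold Stop fstR sndR
  rw [← add_div, one_div, inv_pow, div_le_iff₀ hd, inv_mul_eq_div, le_div_iff₀ (by positivity)]
  exact_mod_cast Iff.rfl

/-- `p + q = 1 - gap ≤ 1 - gap²`, and after `2j` levels the right side is at most `(1 - δ²)^(2^j) ≤
exp (-δ² 2^j)`. -/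
theorem stop_of_le {k : ℕ} {s : ℕ × ℕ × ℕ} (h : s.1 + s.2.1 < s.2.2) (j : ℕ)
    (hj : k * Real.log 2 ≤ gap s ^ 2 * 2 ^ j) : Stop k (natStep^[2 * j] s) := by
  have h1 := iterate_natStep_lt h (2 * j)
  rw [stop_iff h1]
  have h2 := abs_sub_le_one_sub_gap (natStep^[2 * j] s)
  have h3 := abs_nonneg (fstR (natStep^[2 * j] s) - sndR (natStep^[2 * j] s))
  have h4 : 0 < gap (natStep^[2 * j] s) := (gap_pos_iff (by omega)).2 h1
  have h5 : fstR (natStep^[2 * j] s) + sndR (natStep^[2 * j] s)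
      ≤ 1 - gap (natStep^[2 * j] s) ^ 2 := by
    have : fstR (natStep^[2 * j] s) + sndR (natStep^[2 * j] s) = 1 - gap (natStep^[2 * j] s) := by
      unfold gap; ring
    nlinarith
  refine h5.trans ((one_sub_gap_sq_iterate_le h j).trans ?_)
  have h6 : 1 - gap s ^ 2 ≤ Real.exp (-gap s ^ 2) := by
    have := Real.add_one_le_exp (-gap s ^ 2); linarith
  have h7 : 0 ≤ 1 - gap s ^ 2 := by
    have := abs_sub_le_one_sub_gap s
    have := abs_nonneg (fstR s - sndR s)
    have : 0 < gap s := (gap_pos_iff (by omega)).2 h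
    nlinarith
  refine (pow_le_pow_left₀ h7 h6 _).trans ?_
  rw [← Real.exp_nat_mul, one_div, inv_pow, ← Real.exp_log (by positivity : (0 : ℝ) < (2 ^ k)⁻¹),
    Real.exp_le_exp, Real.log_inv, Real.log_pow]
  push_cast
  linarith

theorem exists_stop (k : ℕ) {s : ℕ × ℕ × ℕ} (h : s.1 + s.2.1 < s.2.2) :
    ∃ l, Stop k (natStep^[l] s) := by
  have h1 : 0 < gap s := (gap_pos_iff (by omega)).2 h
  obtain ⟨j, hj⟩ := pow_unbounded_of_one_lt (k * Real.log 2 / gap s ^ 2) one_lt_two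
  refine ⟨2 * j, stop_of_le h j ?_⟩
  rw [div_lt_iff₀ (by positivity)] at hj
  linarith

/-- The number of levels. -/
noncomputable def numLevels (k : ℕ) (s : ℕ × ℕ × ℕ) : ℕ := sInf {l | Stop k (natStep^[l] s)}

theorem stop_numLevels (k : ℕ) {s : ℕ × ℕ × ℕ} (h : s.1 + s.2.1 < s.2.2) :
    Stop k (natStep^[numLevels k s] s) := Nat.sInf_mem (exists_stop k h)

theorem not_stop_of_lt {k l : ℕ} {s : ℕ × ℕ × ℕ} (hl : l < numLevels k s) :
    ¬Stop k (natStep^[l] s) :=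
  Nat.notMem_of_lt_sInf (s := {l | Stop k (natStep^[l] s)}) hl

/-- For the least `j` that satisfies `stop_of_le`, minimality gives `δ² 2^(j - 1) < k log 2`;
squaring yields the bound on `2^(2j)`. -/
theorem two_pow_numLevels_le {k : ℕ} (hk : k ≠ 0) {s : ℕ × ℕ × ℕ} (h : s.1 + s.2.1 < s.2.2) :
    (2 : ℝ) ^ numLevels k s * gap s ^ 4 ≤ 4 * Real.log 2 ^ 2 * k ^ 2 := by
  have h1 : 0 < gap s := (gap_pos_iff (by omega)).2 h
  have h2 := abs_sub_le_one_sub_gap s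
  have h3 := abs_nonneg (fstR s - sndR s)
  have hk1 : (1 : ℝ) ≤ k := by exact_mod_cast Nat.one_le_iff_ne_zero.2 hk
  have hlog := Real.log_two_gt_d9
  have hex : ∃ j : ℕ, k * Real.log 2 ≤ gap s ^ 2 * 2 ^ j := by
    obtain ⟨j, hj⟩ := pow_unbounded_of_one_lt (k * Real.log 2 / gap s ^ 2) one_lt_two
    rw [div_lt_iff₀ (by positivity)] at hj
    exact ⟨j, by linarith⟩
  classical
  have hj := Nat.find_spec hex
  have hmin := fun i => Nat.find_min hex (m := i)
  generalize Nat.find hex = j at hj hmin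
  have hL : numLevels k s ≤ 2 * j := Nat.sInf_le (stop_of_le h j hj)
  -- For `j = 0` there is no predecessor; then a single instance suffices, and the bound holds as `4
  -- (log 2)² ≥ 1`, `k ≥ 1` and the gap is at most 1.
  rcases j with _ | j
  · rw [Nat.le_zero.1 hL, pow_zero, one_mul]
    have h6 : gap s ^ 4 ≤ 1 := pow_le_one₀ h1.le (by linarith)
    have h7 : (1 : ℝ) ≤ 4 * Real.log 2 ^ 2 := by nlinarith
    have h8 : (1 : ℝ) ≤ (k : ℝ) ^ 2 := one_le_pow₀ hk1
    nlinarith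
  · have h5 := not_le.1 (hmin j (by omega))
    calc (2 : ℝ) ^ numLevels k s * gap s ^ 4 ≤ 2 ^ (2 * (j + 1)) * gap s ^ 4 := by
          gcongr
          norm_num
      _ = 4 * (gap s ^ 2 * 2 ^ j) ^ 2 := by ring
      _ ≤ 4 * (k * Real.log 2) ^ 2 := by gcongr
      _ = _ := by ring

/-- At the end `p + q ≤ 2⁻ᵏ ≤ 1/2`, so the gap has grown to at least one half. -/
theorem half_le_two_pow_numLevels_mul {k : ℕ} (hk : k ≠ 0) {s : ℕ × ℕ × ℕ}
    (h : s.1 + s.2.1 < s.2.2) : 1 / 2 ≤ (2 : ℝ) ^ numLevels k s * gap s := by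
  refine le_trans ?_ (gap_iterate_le h _)
  have h1 := (stop_iff (iterate_natStep_lt h _)).1 (stop_numLevels k h)
  have h2 : (1 / 2 : ℝ) ^ k ≤ 1 / 2 := pow_le_of_le_one (by norm_num) (by norm_num) hk
  unfold gap
  linarith

/-! ## The advantages after all levels -/

/-- The item of a bit whose prediction advantage is `x`. -/
noncomputable def unitItem (x : ℝ) : Item := (ENNReal.ofReal x, ENNReal.ofReal (1 - x))

theorem comb_unitItem {x : ℝ} (h0 : 0 ≤ x) (h1 : x ≤ 1) (g : Bool) :
    Item.comb g (unitItem x) (unitItem x)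
      = unitItem (bif g then 1 - (1 - x) * (1 - x) else x * x) := by
  have h2 : 0 ≤ 1 - x := by linarith
  have h3 := mul_nonneg h0 h2
  have h4 := mul_nonneg h2 h0
  have h5 := mul_nonneg h0 h0
  have h6 := mul_nonneg h2 h2
  cases g <;> refine Prod.ext ?_ ?_ <;>
    simp only [Item.comb, unitItem, cond_true, cond_false, ← ENNReal.ofReal_mul h0,
      ← ENNReal.ofReal_mul h2]
  · rw [← ENNReal.ofReal_add h3 h4, ← ENNReal.ofReal_add (add_nonneg h3 h4) h6]
    congr 1; ring
  · rw [← ENNReal.ofReal_add h5 h3, ← ENNReal.ofReal_add (add_nonneg h5 h3) h4]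
    congr 1; ring
  · congr 1; ring

theorem fstR_add_sndR_lt {s : ℕ × ℕ × ℕ} (h : s.1 + s.2.1 < s.2.2) : fstR s + sndR s < 1 := by
  have : 0 < gap s := (gap_pos_iff (by omega)).2 h
  unfold gap at this
  linarith

/-- The first advantage concerns the receiver's bit, which is announced exactly on the levels where
the sender is silent; hence the negated gates. -/
theorem levelItem_fst : ∀ (l : ℕ) {s : ℕ × ℕ × ℕ}, s.1 + s.2.1 < s.2.2 →
    levelItem ((gatesOf s l).map not) (unitItem (fstR s)) = unitItem (fstR (natStep^[l] s))
  | 0, s, h => rfl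
  | l + 1, s, h => by
      have h1 := fstR_add_sndR_lt h
      have h2 := sndR_nonneg s
      rw [Function.iterate_succ_apply, ← levelItem_fst l (natStep_lt h), gatesOf, List.map_cons,
        levelItem, comb_unitItem (fstR_nonneg s) (by linarith), (natStep_fact h).1, natGate]
      by_cases hc : s.2.1 ≤ s.1 <;> simp [hc]

theorem levelItem_snd : ∀ (l : ℕ) {s : ℕ × ℕ × ℕ}, s.1 + s.2.1 < s.2.2 →
    levelItem (gatesOf s l) (unitItem (sndR s)) = unitItem (sndR (natStep^[l] s))
  | 0, s, h => rfl
  | l + 1, s, h => by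
      have h1 := fstR_add_sndR_lt h
      have h2 := fstR_nonneg s
      rw [Function.iterate_succ_apply, ← levelItem_snd l (natStep_lt h), gatesOf,
        levelItem, comb_unitItem (sndR_nonneg s) (by linarith), (natStep_fact h).2, natGate]
      by_cases hc : s.2.1 ≤ s.1 <;> simp [hc]

/-- Who announces in the rounds. -/
def roundGates (s : ℕ × ℕ × ℕ) (l i : ℕ) : Bool := (expand (gatesOf s l)).getD i false

theorem gval_roundGates {s : ℕ × ℕ × ℕ} (h : s.1 + s.2.1 < s.2.2) (l : ℕ) :
    gval (roundGates s l) (2 ^ l - 1)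
      (List.replicate (2 ^ l) (unitItem (sndR s)))
      = ENNReal.ofReal (sndR (natStep^[l] s)) := by
  have e := gval_expand (gatesOf s l) (roundGates s l)
    (unitItem (sndR s)) fun i _ => rfl
  rw [length_gatesOf] at e
  rw [e, levelItem_snd l h, unitItem]

theorem gval_not_roundGates {s : ℕ × ℕ × ℕ} (h : s.1 + s.2.1 < s.2.2) (l : ℕ) :
    gval (fun i => !roundGates s l i) (2 ^ l - 1)
      (List.replicate (2 ^ l) (unitItem (fstR s)))
      = ENNReal.ofReal (fstR (natStep^[l] s)) := by
  have e := gval_expand ((gatesOf s l).map not) (fun i => !roundGates s l i)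
    (unitItem (fstR s)) fun i hi => by
      have hl := length_expand (gatesOf s l)
      rw [List.length_map] at hi
      rw [expand_map_not, roundGates, List.getD_eq_getElem _ _ (by omega),
        List.getD_eq_getElem _ _ (by simp; omega), List.getElem_map]
  rw [List.length_map, length_gatesOf] at e
  rw [e, levelItem_fst l h, unitItem]

end WeakOT

namespace WeakOT

/-! ## Programs whose registers are given by a list -/

/-- The registers with the contents in the list, all others being `0`. -/
def st (l : List ℕ) (i : ℕ) : ℕ := l.getD i 0

theorem update_st (l : List ℕ) {x : ℕ} (hx : x < l.length) (v : ℕ) :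
    Function.update (st l) x v = st (l.set x v) := by
  funext i
  by_cases h : i = x
  · subst h; simp [st, hx]
  · simp [st, h, Ne.symm h]

theorem st_append_zeros (l : List ℕ) (r : ℕ) : st (l ++ List.replicate r 0) = st l := by
  funext i
  unfold st
  rcases lt_or_ge i l.length with h | h
  · rw [List.getD_append _ _ _ _ h]
  · rw [List.getD_append_right _ _ _ _ h, List.getD_eq_default _ _ h]
    by_cases h' : i - l.length < r <;> simp [h']

namespace Prog

/-- The effect of a program without loops. -/
def exec : Prog → List ℕ → List ℕ
  | const x c, l => l.set x c
  | add x y z, l => l.set x (l.getD y 0 + l.getD z 0)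
  | sub x y z, l => l.set x (l.getD y 0 - l.getD z 0)
  | mul x y z, l => l.set x (l.getD y 0 * l.getD z 0)
  | div x y z, l => l.set x (l.getD y 0 / l.getD z 0)
  | seq P Q, l => Q.exec (P.exec l)
  | branch x P Q, l => if l.getD x 0 ≠ 0 then P.exec l else Q.exec l
  | loop _ _, l => l

/-- The program has no loops and writes only to registers below `m`. -/
def simple (m : ℕ) : Prog → Bool
  | const x _ => x < m
  | add x _ _ => x < m
  | sub x _ _ => x < m
  | mul x _ _ => x < m
  | div x _ _ => x < m
  | seq P Q => P.simple m && Q.simple m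
  | branch _ P Q => P.simple m && Q.simple m
  | loop _ _ => false

/-- A factor for the cost of a program without loops. -/
def factor : Prog → ℕ
  | const _ c => 1 + Nat.size c
  | seq P Q => P.factor + Q.factor * P.factor + Q.factor
  | branch _ P Q => 1 + P.factor + Q.factor
  | _ => 2

theorem length_exec : ∀ (P : Prog) (l : List ℕ), (P.exec l).length = l.length
  | const _ _, _ => List.length_set
  | add _ _ _, _ => List.length_set
  | sub _ _ _, _ => List.length_set
  | mul _ _ _, _ => List.length_set
  | div _ _ _, _ => List.length_set
  | seq P Q, l => (length_exec Q _).trans (length_exec P l)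
  | branch x P Q, l => by
      unfold exec
      split_ifs
      · exact length_exec P l
      · exact length_exec Q l
  | loop _ _, _ => rfl

/-- Every number in the list has at most `B` bits. -/
def SizeLe (l : List ℕ) (B : ℕ) : Prop := ∀ v ∈ l, Nat.size v ≤ B

theorem SizeLe.mono {l : List ℕ} {B B' : ℕ} (h : SizeLe l B) (hB : B ≤ B') : SizeLe l B' :=
  fun v hv => (h v hv).trans hB

theorem SizeLe.getD {l : List ℕ} {B : ℕ} (h : SizeLe l B) (i : ℕ) :
    Nat.size (l.getD i 0) ≤ B := by
  rcases lt_or_ge i l.length with hi | hi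
  · rw [List.getD_eq_getElem _ _ hi]; exact h _ (List.getElem_mem hi)
  · rw [List.getD_eq_default _ _ hi]; simp

theorem SizeLe.set {l : List ℕ} {B : ℕ} (h : SizeLe l B) (x : ℕ) {v : ℕ} (hv : Nat.size v ≤ B) :
    SizeLe (l.set x v) B := fun w hw => by
  rcases List.mem_or_eq_of_mem_set hw with hw | rfl
  · exact h w hw
  · exact hv

theorem size_add_le {a b B : ℕ} (ha : Nat.size a ≤ B) (hb : Nat.size b ≤ B) :
    Nat.size (a + b) ≤ B + 1 := by
  rw [Nat.size_le] at *
  rw [pow_succ]; omega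

theorem size_mul_le {a b B B' : ℕ} (ha : Nat.size a ≤ B) (hb : Nat.size b ≤ B') :
    Nat.size (a * b) ≤ B + B' := by
  rw [Nat.size_le] at *
  rw [pow_add]; exact Nat.mul_lt_mul'' ha hb

/-- A program without loops takes time proportional to the length of the numbers it starts with. -/
theorem runs_exec {m : ℕ} : ∀ (P : Prog) (l : List ℕ) (B : ℕ), P.simple m = true →
    l.length = m → SizeLe l B →
    ∃ t ≤ P.factor * (B + 1), P.Runs (st l) (st (P.exec l)) t ∧
      SizeLe (P.exec l) (P.factor * (B + 1) + B)
  | const x c, l, B, hP, hl, hB => by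
      have hx : x < l.length := by simpa [simple, hl] using hP
      refine ⟨_, ?_, by rw [exec, ← update_st l hx]; exact Runs.const x c _, ?_⟩
      · exact Nat.le_mul_of_pos_right _ (Nat.succ_pos _)
      · refine (hB.mono (Nat.le_add_left _ _)).set x ?_
        calc Nat.size c ≤ 1 + Nat.size c := by omega
          _ ≤ (1 + Nat.size c) * (B + 1) := Nat.le_mul_of_pos_right _ (Nat.succ_pos _)
          _ ≤ _ := Nat.le_add_right _ _
  | add x y z, l, B, hP, hl, hB => by
      have hx : x < l.length := by simpa [simple, hl] using hP
      have h1 := hB.getD y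
      have h2 := hB.getD z
      refine ⟨_, ?_, by rw [exec, ← update_st l hx]; exact Runs.add x y z _, ?_⟩
      · unfold st factor; omega
      · refine (hB.mono (Nat.le_add_left _ _)).set x ((size_add_le h1 h2).trans ?_)
        unfold factor; omega
  | sub x y z, l, B, hP, hl, hB => by
      have hx : x < l.length := by simpa [simple, hl] using hP
      have h1 := hB.getD y
      have h2 := hB.getD z
      refine ⟨_, ?_, by rw [exec, ← update_st l hx]; exact Runs.sub x y z _, ?_⟩
      · unfold st factor; omega
      · refine (hB.mono (Nat.le_add_left _ _)).set x
          ((Nat.size_le_size (Nat.sub_le _ _)).trans (h1.trans ?_))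
        unfold factor; omega
  | mul x y z, l, B, hP, hl, hB => by
      have hx : x < l.length := by simpa [simple, hl] using hP
      have h1 := hB.getD y
      have h2 := hB.getD z
      refine ⟨_, ?_, by rw [exec, ← update_st l hx]; exact Runs.mul x y z _, ?_⟩
      · unfold st factor; omega
      · refine (hB.mono (Nat.le_add_left _ _)).set x ((size_mul_le h1 h2).trans ?_)
        unfold factor; omega
  | div x y z, l, B, hP, hl, hB => by
      have hx : x < l.length := by simpa [simple, hl] using hP
      have h1 := hB.getD y
      have h2 := hB.getD z
      refine ⟨_, ?_, by rw [exec, ← update_st l hx]; exact Runs.div x y z _, ?_⟩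
      · unfold st factor; omega
      · refine (hB.mono (Nat.le_add_left _ _)).set x
          ((Nat.size_le_size (Nat.div_le_self _ _)).trans (h1.trans ?_))
        unfold factor; omega
  | seq P Q, l, B, hP, hl, hB => by
      simp only [simple, Bool.and_eq_true] at hP
      obtain ⟨t, ht, hr, hs⟩ := runs_exec P l B hP.1 hl hB
      obtain ⟨t', ht', hr', hs'⟩ := runs_exec Q (P.exec l) _ hP.2 ((length_exec P l).trans hl) hs
      have e : (seq P Q).factor * (B + 1) = P.factor * (B + 1) +
          Q.factor * (P.factor * (B + 1) + B + 1) := by rw [factor]; ring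
      refine ⟨t + t', ?_, Runs.seq hr hr', hs'.mono ?_⟩ <;> rw [e] <;> omega
  | branch x P Q, l, B, hP, hl, hB => by
      simp only [simple, Bool.and_eq_true] at hP
      have h1 := hB.getD x
      have e : (branch x P Q).factor * (B + 1) = (B + 1) + P.factor * (B + 1) +
          Q.factor * (B + 1) := by rw [factor]; ring
      by_cases hx : l.getD x 0 ≠ 0
      · obtain ⟨t, ht, hr, hs⟩ := runs_exec P l B hP.1 hl hB
        refine ⟨_, ?_, by rw [exec, if_pos hx]; exact Runs.branch_pos hx hr, ?_⟩
        · rw [e]; unfold st; omega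
        · rw [exec, if_pos hx, e]; exact hs.mono (by omega)
      · obtain ⟨t, ht, hr, hs⟩ := runs_exec Q l B hP.2 hl hB
        refine ⟨_, ?_, by rw [exec, if_neg hx]; exact Runs.branch_zero (not_ne_iff.1 hx) hr, ?_⟩
        · rw [e]; omega
        · rw [exec, if_neg hx, e]; exact hs.mono (by omega)

/-- The program leads from the first to the second list in time at most `T`. -/
def Reach (P : Prog) (l l' : List ℕ) (T : ℕ) : Prop := ∃ t ≤ T, P.Runs (st l) (st l') t

theorem Reach.mono {P : Prog} {l l' : List ℕ} {T T' : ℕ} (h : P.Reach l l' T) (hT : T ≤ T') :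
    P.Reach l l' T' := by
  obtain ⟨t, ht, hr⟩ := h
  exact ⟨t, ht.trans hT, hr⟩

theorem Reach.seq {P Q : Prog} {l l' l'' : List ℕ} {T T' : ℕ} (h : P.Reach l l' T)
    (h' : Q.Reach l' l'' T') : (P.seq Q).Reach l l'' (T + T') := by
  obtain ⟨t, ht, hr⟩ := h
  obtain ⟨t', ht', hr'⟩ := h'
  exact ⟨t + t', by omega, hr.seq hr'⟩

theorem reach_exec {P : Prog} {l l' : List ℕ} {B m : ℕ} (hP : P.simple m = true)
    (hl : l.length = m) (hB : SizeLe l B) (h : P.exec l = l') :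
    P.Reach l l' (P.factor * (B + 1)) := by
  obtain ⟨t, ht, hr, -⟩ := runs_exec P l B hP hl hB
  exact ⟨t, ht, h ▸ hr⟩

theorem Reach.branch_pos {P Q : Prog} {x : ℕ} {l l' : List ℕ} {T B : ℕ} (hx : l.getD x 0 ≠ 0)
    (hB : Nat.size (l.getD x 0) ≤ B) (h : P.Reach l l' T) :
    (branch x P Q).Reach l l' (1 + B + T) := by
  obtain ⟨t, ht, hr⟩ := h
  exact ⟨_, by unfold st; omega, Runs.branch_pos hx hr⟩

theorem Reach.branch_zero {P Q : Prog} {x : ℕ} {l l' : List ℕ} {T : ℕ} (hx : l.getD x 0 = 0)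
    (h : Q.Reach l l' T) : (branch x P Q).Reach l l' (1 + T) := by
  obtain ⟨t, ht, hr⟩ := h
  exact ⟨_, by omega, Runs.branch_zero hx hr⟩

/-- A loop that goes through the given states. -/
theorem reach_loop {P : Prog} {x B T : ℕ} (f : ℕ → List ℕ) : ∀ N : ℕ,
    (∀ i < N, (f i).getD x 0 ≠ 0) → (∀ i < N, Nat.size ((f i).getD x 0) ≤ B) →
    (f N).getD x 0 = 0 → (∀ i < N, P.Reach (f i) (f (i + 1)) T) →
    (loop x P).Reach (f 0) (f N) (N * (1 + B + T) + 1)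
  | 0, _, _, h0, _ => ⟨1, by omega, Runs.loop_stop h0⟩
  | N + 1, hne, hB, h0, hP => by
      obtain ⟨t, ht, hr⟩ := reach_loop (fun i => f (i + 1)) N (fun i hi => hne _ (by omega))
        (fun i hi => hB _ (by omega)) h0 (fun i hi => hP _ (by omega))
      obtain ⟨t', ht', hr'⟩ := hP 0 (by omega)
      have h1 := hB 0 (by omega)
      refine ⟨_, ?_, Runs.loop_step (hne 0 (by omega)) hr' hr⟩
      rw [add_mul, one_mul]
      unfold st
      omega

/-! ## Calling a program -/

/-- The program with all registers moved by `m`. -/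
def shift (m : ℕ) : Prog → Prog
  | const x c => const (x + m) c
  | add x y z => add (x + m) (y + m) (z + m)
  | sub x y z => sub (x + m) (y + m) (z + m)
  | mul x y z => mul (x + m) (y + m) (z + m)
  | div x y z => div (x + m) (y + m) (z + m)
  | seq P Q => seq (P.shift m) (Q.shift m)
  | branch x P Q => branch (x + m) (P.shift m) (Q.shift m)
  | loop x P => loop (x + m) (P.shift m)

/-- A number above all registers to which the program writes. -/
def top : Prog → ℕ
  | const x _ => x + 1
  | add x _ _ => x + 1
  | sub x _ _ => x + 1
  | mul x _ _ => x + 1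
  | div x _ _ => x + 1
  | seq P Q => max P.top Q.top
  | branch _ P Q => max P.top Q.top
  | loop _ P => P.top

theorem Runs.above {P : Prog} {s s' : ℕ → ℕ} {t : ℕ} (h : P.Runs s s' t) :
    ∀ i, P.top ≤ i → s' i = s i := by
  induction h with
  | const x c s => intro i hi; exact Function.update_of_ne (by unfold top at hi; omega) _ _
  | add x y z s => intro i hi; exact Function.update_of_ne (by unfold top at hi; omega) _ _
  | sub x y z s => intro i hi; exact Function.update_of_ne (by unfold top at hi; omega) _ _
  | mul x y z s => intro i hi; exact Function.update_of_ne (by unfold top at hi; omega) _ _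
  | div x y z s => intro i hi; exact Function.update_of_ne (by unfold top at hi; omega) _ _
  | seq _ _ ih ih' =>
    intro i hi
    rw [top, max_le_iff] at hi
    rw [ih' i hi.2, ih i hi.1]
  | branch_pos _ _ ih => intro i hi; rw [top, max_le_iff] at hi; exact ih i hi.1
  | branch_zero _ _ ih => intro i hi; rw [top, max_le_iff] at hi; exact ih i hi.2
  | loop_stop => intro i _; rfl
  | loop_step _ _ _ ih ih' => intro i hi; rw [ih' i hi, ih i hi]

/-- Each assignment is charged the lengths of its operands, which covers the length of the number
written. -/
theorem Runs.size_le {P : Prog} {s s' : ℕ → ℕ} {t : ℕ} (h : P.Runs s s' t) :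
    ∀ i, Nat.size (s' i) ≤ Nat.size (s i) + t := by
  have upd : ∀ (s : ℕ → ℕ) (x v T : ℕ), Nat.size v ≤ T →
      ∀ i, Nat.size (Function.update s x v i) ≤ Nat.size (s i) + T := by
    intro s x v T h i
    by_cases hi : i = x
    · subst hi; rw [Function.update_self]; omega
    · rw [Function.update_of_ne hi]; omega
  induction h with
  | const x c s => exact upd _ _ _ _ (by omega)
  | add x y z s =>
    refine upd _ _ _ _ ((size_add_le (Nat.le_add_right _ (Nat.size (s z)))
      (Nat.le_add_left _ (Nat.size (s y)))).trans (by omega))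
  | sub x y z s =>
    exact upd _ _ _ _ ((Nat.size_le_size (Nat.sub_le _ _)).trans (by omega))
  | mul x y z s => exact upd _ _ _ _ ((size_mul_le le_rfl le_rfl).trans (by omega))
  | div x y z s =>
    exact upd _ _ _ _ ((Nat.size_le_size (Nat.div_le_self _ _)).trans (by omega))
  | seq _ _ ih ih' => intro i; have := ih i; have := ih' i; omega
  | branch_pos _ _ ih => intro i; have := ih i; omega
  | branch_zero _ _ ih => intro i; have := ih i; omega
  | loop_stop => intro i; omega
  | loop_step _ _ _ ih ih' => intro i; have := ih i; have := ih' i; omega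

theorem Runs.shift {P : Prog} {s s' : ℕ → ℕ} {t : ℕ} (m : ℕ) (h : P.Runs s s' t) :
    ∀ u : ℕ → ℕ, (∀ i, u (i + m) = s i) →
      ∃ u', (P.shift m).Runs u u' t ∧ (∀ i, u' (i + m) = s' i) ∧ ∀ j < m, u' j = u j := by
  have upd : ∀ (s u : ℕ → ℕ) (x v : ℕ), (∀ i, u (i + m) = s i) →
      (∀ i, Function.update u (x + m) v (i + m) = Function.update s x v i) ∧
        ∀ j < m, Function.update u (x + m) v j = u j := by
    intro s u x v hu
    refine ⟨fun i => ?_, fun j hj => Function.update_of_ne (by omega) _ _⟩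
    by_cases hi : i = x
    · subst hi; simp
    · rw [Function.update_of_ne hi, Function.update_of_ne (by omega), hu]
  induction h with
  | const x c s =>
    intro u hu
    exact ⟨_, Runs.const _ _ _, upd s u x _ hu⟩
  | add x y z s =>
    intro u hu
    rw [← hu y, ← hu z]
    exact ⟨_, Runs.add _ _ _ _, upd s u x _ hu⟩
  | sub x y z s =>
    intro u hu
    rw [← hu y, ← hu z]
    exact ⟨_, Runs.sub _ _ _ _, upd s u x _ hu⟩
  | mul x y z s =>
    intro u hu
    rw [← hu y, ← hu z]
    exact ⟨_, Runs.mul _ _ _ _, upd s u x _ hu⟩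
  | div x y z s =>
    intro u hu
    rw [← hu y, ← hu z]
    exact ⟨_, Runs.div _ _ _ _, upd s u x _ hu⟩
  | seq _ _ ih ih' =>
    intro u hu
    obtain ⟨v, hr, hv, hv'⟩ := ih u hu
    obtain ⟨w, hr', hw, hw'⟩ := ih' v hv
    exact ⟨w, hr.seq hr', hw, fun j hj => (hw' j hj).trans (hv' j hj)⟩
  | branch_pos hx _ ih =>
    intro u hu
    obtain ⟨v, hr, hv⟩ := ih u hu
    rw [← hu] at hx ⊢
    exact ⟨v, Runs.branch_pos hx hr, hv⟩
  | branch_zero hx _ ih =>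
    intro u hu
    obtain ⟨v, hr, hv⟩ := ih u hu
    rw [← hu] at hx
    exact ⟨v, Runs.branch_zero hx hr, hv⟩
  | loop_stop hx =>
    intro u hu
    rw [← hu] at hx
    exact ⟨u, Runs.loop_stop hx, hu, fun _ _ => rfl⟩
  | loop_step hx _ _ ih ih' =>
    intro u hu
    obtain ⟨v, hr, hv, hv'⟩ := ih u hu
    obtain ⟨w, hr', hw, hw'⟩ := ih' v hv
    rw [← hu] at hx ⊢
    exact ⟨w, Runs.loop_step hx hr hr', hw, fun j hj => (hw' j hj).trans (hv' j hj)⟩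

/-- Set the `r` registers from `m` on to `0`. -/
def clear (m : ℕ) : ℕ → Prog
  | 0 => const m 0
  | r + 1 => seq (clear m r) (const (m + r) 0)

/-- `clear m 0` is not empty but writes one zero; this explains the separate case. -/
theorem exec_clear (l : List ℕ) : ∀ (r : ℕ) (g : List ℕ), r ≤ g.length → 0 < g.length →
    (clear l.length r).exec (l ++ g)
      = if r = 0 then l ++ g.set 0 0 else l ++ (List.replicate r 0 ++ g.drop r)
  | 0, g, _, h => by
      simp [clear, exec, List.set_append_right]
  | r + 1, g, hr, h => by
      have ih := exec_clear l r g (by omega) h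
      rw [clear, exec, ih]
      have hd : g.drop r = g[r] :: g.drop (r + 1) := List.drop_eq_getElem_cons (by omega)
      by_cases h0 : r = 0
      · subst h0
        rw [if_pos rfl, if_neg (by omega)]
        match g, h with
        | a :: g, _ => simp [exec, List.set_append_right]
      · rw [if_neg h0, if_neg (by omega), exec, List.set_append_right _ _ (by omega),
          List.set_append_right _ _ (by simp)]
        simp only [List.length_replicate, Nat.add_sub_cancel_left, Nat.sub_self, hd,
          List.replicate_succ', List.append_assoc]
        rfl

theorem simple_clear (m N : ℕ) : ∀ r, m + r ≤ N → m < N → (clear m r).simple N = true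
  | 0, _, h => by simpa [clear, simple] using h
  | r + 1, hr, h => by simp [clear, simple, simple_clear m N r (by omega) h]; omega

/-- Call `P` with the arguments in registers `x` and `y`; the result is put into register `z`.  The
registers from `m` on are used by `P`; register `m - 1` must contain `0`. -/
def call (m : ℕ) (P : Prog) (x y z : ℕ) : Prog :=
  seq (seq (add m x (m - 1)) (add (m + 1) y (m - 1)))
    (seq (P.shift m) (seq (add z m (m - 1)) (clear m (P.top + 2))))

/-- Registers beyond the list read `0`, so the list may be padded to provide a fresh workspace for
the callee. Register `m - 1` serves as the zero operand that turns additions into copies. -/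
theorem reach_call {m : ℕ} (P : Prog) {l : List ℕ} (hl : l.length = m)
    {x y z : ℕ} (hz : z < m - 1) (hx : x < m) (hy : y < m) (h0 : l.getD (m - 1) 0 = 0)
    {a T B : ℕ} (hP : P.Computes [l.getD x 0, l.getD y 0] a T) (hB : SizeLe l B) :
    (call m P x y z).Reach l (l.set z a) ((call m P x y z).factor * (B + T + 1) + T) := by
  obtain ⟨s, t, hr, hs, ht⟩ := hP
  set X := l.getD x 0 with hX
  set Y := l.getD y 0 with hY
  have hm : m + 1 < (l ++ List.replicate (P.top + 2) 0).length := by simp [hl]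
  have hB0 : SizeLe (l ++ List.replicate (P.top + 2) 0) B := fun v hv => by
    rcases List.mem_append.1 hv with hv | hv
    · exact hB v hv
    · rw [List.eq_of_mem_replicate hv]; simp
  have g1 : ∀ (g : List ℕ) (i : ℕ), i < m → (l ++ g).getD i 0 = l.getD i 0 := fun g i hi =>
    List.getD_append _ _ _ _ (by omega)
  have r1 : (seq (add m x (m - 1)) (add (m + 1) y (m - 1))).Reach
      (l ++ List.replicate (P.top + 2) 0) (l ++ X :: Y :: List.replicate P.top 0)
      ((seq (add m x (m - 1)) (add (m + 1) y (m - 1))).factor * (B + 1)) := by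
    refine reach_exec (m := m + P.top + 2) (by simp [simple]; omega) (by simp [hl]; omega) hB0 ?_
    have e : (l ++ List.replicate (P.top + 2) 0).set m X
        = l ++ X :: 0 :: List.replicate P.top 0 := by
      rw [List.set_append_right _ _ hl.le, hl, Nat.sub_self]; rfl
    have e' : (add m x (m - 1)).exec (l ++ List.replicate (P.top + 2) 0)
        = l ++ X :: 0 :: List.replicate P.top 0 := by
      rw [exec, g1 _ _ hx, g1 _ _ (by omega), h0, ← hX, Nat.add_zero X, e]
    rw [exec, e', exec, g1 _ _ hy,
      g1 _ _ (by omega), h0, ← hY, Nat.add_zero Y, List.set_append_right _ _ (by omega), hl,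
      Nat.add_sub_cancel_left]
    rfl
  obtain ⟨u, hu, hus, hul⟩ := hr.shift m (st (l ++ X :: Y :: List.replicate P.top 0)) fun i => by
    unfold st
    rw [List.getD_append_right _ _ _ _ (by omega), hl, Nat.add_sub_cancel]
    match i with
    | 0 => rfl
    | 1 => rfl
    | i + 2 =>
      rw [List.getD_eq_default [X, Y] _ (by simp)]
      simp [List.getElem?_replicate]
      split_ifs <;> rfl
  -- Beyond `P.top + 2` the workspace is still zero: there the callee neither writes nor has
  -- arguments.
  set g := List.ofFn (n := P.top + 2) fun i => s i with hg
  have hgl : g.length = P.top + 2 := by simp [hg]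
  have hu' : u = st (l ++ g) := by
    funext j
    unfold st
    rcases lt_or_ge j m with hj | hj
    · rw [hul j hj, st, g1 _ _ hj, g1 _ _ hj]
    · obtain ⟨i, rfl⟩ := Nat.exists_eq_add_of_le' hj
      rw [hus, List.getD_append_right _ _ _ _ (by omega), hl, Nat.add_sub_cancel]
      rcases lt_or_ge i (P.top + 2) with hi | hi
      · rw [List.getD_eq_getElem _ _ (by omega)]; simp only [hg, List.getElem_ofFn]
      · rw [hr.above i (by omega), List.getD_eq_default _ _ (by simp; omega),
          List.getD_eq_default _ _ (by omega)]
  have hB1 : SizeLe (l ++ g) (B + T) := fun v hv => by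
    rcases List.mem_append.1 hv with hv | hv
    · exact (hB v hv).trans (Nat.le_add_right _ _)
    · obtain ⟨i, rfl⟩ := List.mem_ofFn.1 hv
      refine (hr.size_le i).trans (Nat.add_le_add ?_ ht)
      match (i : ℕ) with
      | 0 => exact hB.getD x
      | 1 => exact hB.getD y
      | i + 2 => simp
  have ga : g.getD 0 0 = a := by
    rw [← hs, List.getD_eq_getElem _ _ (by omega)]
    simp only [hg, List.getElem_ofFn]
  -- The result is copied back and the workspace erased, so the state is again a list of length `m`.
  have r3 : (seq (add z m (m - 1)) (clear m (P.top + 2))).Reach (l ++ g)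
      (l.set z a ++ List.replicate (P.top + 2) 0)
      ((seq (add z m (m - 1)) (clear m (P.top + 2))).factor * (B + T + 1)) := by
    refine reach_exec (m := m + P.top + 2) ?_ (by simp [hl, hgl]; omega) hB1 ?_
    · rw [simple, simple_clear _ _ _ (by omega) (by omega)]
      simp [simple]; omega
    · rw [exec, exec, List.getD_append_right _ _ _ _ hl.le, hl, Nat.sub_self, ga,
        g1 _ _ (by omega), h0, Nat.add_zero, List.set_append_left _ _ (by omega)]
      have := exec_clear (l.set z a) (P.top + 2) g (by omega) (by omega)
      rw [List.length_set, hl, if_neg (by omega), List.drop_of_length_le (by omega),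
        List.append_nil] at this
      exact this
  obtain ⟨t1, ht1, hr1⟩ := r1
  obtain ⟨t3, ht3, hr3⟩ := r3
  rw [st_append_zeros] at hr1
  rw [st_append_zeros, ← hu'] at hr3
  refine ⟨_, ?_, hr1.seq (hu.seq hr3)⟩
  generalize hF : (seq (add m x (m - 1)) (add (m + 1) y (m - 1))).factor = F at ht1
  generalize hG : (seq (add z m (m - 1)) (clear m (P.top + 2))).factor = G at ht3
  have e : (call m P x y z).factor * (B + T + 1) = F * (B + T + 1) + G * (B + T + 1) +
      ((P.shift m).factor + G * (P.shift m).factor +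
        ((P.shift m).factor + G * (P.shift m).factor + G) * F) * (B + T + 1) := by
    rw [call, factor, hF, factor, hG]; ring
  have e1 : F * (B + 1) ≤ F * (B + T + 1) := Nat.mul_le_mul_left _ (by omega)
  rw [e]
  omega

end Prog

end WeakOT

namespace WeakOT

/-! ## The schedule from approximations of the two advantages -/

/-- The numbers `A m` and `B m` approximate `p` and `q` up to `1 / 2 ^ m`. -/
structure Approx (A B : ℕ → ℕ) (p q : ℝ) : Prop where
  fst_nonneg : 0 ≤ p
  snd_nonneg : 0 ≤ q
  lt_one : p + q < 1
  fst_approx : ∀ m, |(A m : ℝ) / 2 ^ m - p| ≤ 1 / 2 ^ m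
  snd_approx : ∀ m, |(B m : ℝ) / 2 ^ m - q| ≤ 1 / 2 ^ m

/-- The precision that is used. -/
noncomputable def prec (A B : ℕ → ℕ) : ℕ := sInf {m | 1 ≤ m ∧ A m + B m + 1002 ≤ 2 ^ m}

/-- Upper bounds on the two advantages, with a common denominator. -/
noncomputable def start (A B : ℕ → ℕ) : ℕ × ℕ × ℕ :=
  (A (prec A B) + 1, B (prec A B) + 1, 2 ^ prec A B)

theorem approx_bounds {a m : ℕ} {p : ℝ} (h : |(a : ℝ) / 2 ^ m - p| ≤ 1 / 2 ^ m) :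
    (a : ℝ) ≤ p * 2 ^ m + 1 ∧ p * 2 ^ m ≤ a + 1 := by
  have hD : (0 : ℝ) < 2 ^ m := by positivity
  obtain ⟨h1, h2⟩ := abs_le.1 h
  constructor
  · have : (a : ℝ) / 2 ^ m ≤ p + 1 / 2 ^ m := by linarith
    rw [div_le_iff₀ hD, add_mul, div_mul_cancel₀ _ hD.ne'] at this
    exact this
  · have : p ≤ ((a : ℝ) + 1) / 2 ^ m := by rw [add_div]; linarith
    rwa [le_div_iff₀ hD] at this

namespace Approx

variable {A B : ℕ → ℕ} {p q : ℝ}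

theorem fst_le (h : Approx A B p q) (m : ℕ) : A m ≤ 2 ^ m + 1 := by
  have h1 := (approx_bounds (h.fst_approx m)).1
  have h2 := h.snd_nonneg
  have h3 := h.lt_one
  have : (0 : ℝ) < 2 ^ m := by positivity
  have : (A m : ℝ) ≤ 2 ^ m + 1 := by nlinarith
  exact_mod_cast this

theorem snd_le (h : Approx A B p q) (m : ℕ) : B m ≤ 2 ^ m + 1 := by
  have h1 := (approx_bounds (h.snd_approx m)).1
  have h2 := h.fst_nonneg
  have h3 := h.lt_one
  have : (0 : ℝ) < 2 ^ m := by positivity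
  have : (B m : ℝ) ≤ 2 ^ m + 1 := by nlinarith
  exact_mod_cast this

theorem exists_prec (h : Approx A B p q) : ∃ m, 1 ≤ m ∧ A m + B m + 1002 ≤ 2 ^ m := by
  have hδ : 0 < 1 - p - q := by linarith [h.lt_one]
  -- The two approximations are each off by at most one unit, hence `1004 = 1002 + 2`.
  obtain ⟨m, hm⟩ := pow_unbounded_of_one_lt (1004 / (1 - p - q)) (one_lt_two (α := ℝ))
  rw [div_lt_iff₀ hδ] at hm
  have hm' : (1004 : ℝ) < 2 ^ (m + 1) * (1 - p - q) := by
    rw [pow_succ]; nlinarith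
  have h1 := (approx_bounds (h.fst_approx (m + 1))).1
  have h2 := (approx_bounds (h.snd_approx (m + 1))).1
  refine ⟨m + 1, by omega, ?_⟩
  have : (A (m + 1) : ℝ) + B (m + 1) + 1002 ≤ 2 ^ (m + 1) := by linarith
  exact_mod_cast this

theorem prec_spec (h : Approx A B p q) :
    1 ≤ prec A B ∧ A (prec A B) + B (prec A B) + 1002 ≤ 2 ^ prec A B :=
  Nat.sInf_mem h.exists_prec

theorem lt_of_lt_prec {m : ℕ} (hm : 1 ≤ m) (hlt : m < prec A B) :
    2 ^ m < A m + B m + 1002 := by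
  have := Nat.notMem_of_lt_sInf hlt
  exact not_le.1 fun h => this ⟨hm, h⟩

theorem start_lt (h : Approx A B p q) : (start A B).1 + (start A B).2.1 < (start A B).2.2 := by
  have := h.prec_spec.2
  simp only [start]
  omega

theorem le_fstR_start (h : Approx A B p q) : p ≤ fstR (start A B) := by
  unfold fstR start
  rw [le_div_iff₀ (by positivity)]
  push_cast
  exact (approx_bounds (h.fst_approx _)).2

theorem le_sndR_start (h : Approx A B p q) : q ≤ sndR (start A B) := by
  unfold sndR start
  rw [le_div_iff₀ (by positivity)]
  push_cast
  exact (approx_bounds (h.snd_approx _)).2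

/-- In units of `2 ^ (-prec)`, rounding up costs at most 4 of the true gap, while the rounded gap
still has at least `1002 - 2 = 1000` units. -/
theorem le_gap_start (h : Approx A B p q) : 1 - p - q ≤ 1.004 * gap (start A B) := by
  have h0 : (A (prec A B) : ℝ) + B (prec A B) + 1002 ≤ 2 ^ prec A B := by
    exact_mod_cast h.prec_spec.2
  have h1 := (approx_bounds (h.fst_approx (prec A B))).1
  have h2 := (approx_bounds (h.snd_approx (prec A B))).1
  have hD : (0 : ℝ) < 2 ^ prec A B := by positivity
  have e : gap (start A B) = (2 ^ prec A B - A (prec A B) - B (prec A B) - 2) / 2 ^ prec A B := by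
    unfold gap fstR sndR start
    push_cast
    field_simp
    ring
  rw [e, ← mul_div_assoc, le_div_iff₀ hD]
  linarith

/-- The rounding loss enters with the fourth power; `1.004⁴ · 4 (log 2)²` is about `1.953`, below 2.
-/
theorem two_pow_numLevels_le (h : Approx A B p q) {k : ℕ} (hk : k ≠ 0) :
    (2 : ℝ) ^ numLevels k (start A B) ≤ 2 * k ^ 2 / (1 - p - q) ^ 4 := by
  have hδ : 0 < 1 - p - q := by linarith [h.lt_one]
  rw [le_div_iff₀ (by positivity)]
  have h1 := WeakOT.two_pow_numLevels_le hk h.start_lt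
  have h2 := Real.log_two_lt_d9
  have h3 := Real.log_two_gt_d9
  calc (2 : ℝ) ^ numLevels k (start A B) * (1 - p - q) ^ 4
      ≤ 2 ^ numLevels k (start A B) * (1.004 * gap (start A B)) ^ 4 := by
        gcongr
        exact h.le_gap_start
    _ = 1.004 ^ 4 * (2 ^ numLevels k (start A B) * gap (start A B) ^ 4) := by ring
    _ ≤ 1.004 ^ 4 * (4 * Real.log 2 ^ 2 * k ^ 2) := by gcongr
    _ ≤ 1.004 ^ 4 * (4 * 0.6931471808 ^ 2 * k ^ 2) := by gcongr
    _ ≤ 2 * k ^ 2 := by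
        have : (0 : ℝ) ≤ (k : ℝ) ^ 2 := by positivity
        norm_num
        nlinarith

/-- One bit less precision fails, so `2^(prec - 1) (1 - p - q) < 1004`. Since `2^numLevels` times
the gap is at least `1/2`, it follows that `2^(prec - 1) < 2008 · 2^numLevels`, and `2008 < 2^11`.
-/
theorem prec_le (h : Approx A B p q) {k : ℕ} (hk : k ≠ 0) :
    prec A B ≤ numLevels k (start A B) + 11 := by
  by_contra! hlt
  obtain ⟨m, hm⟩ : ∃ m, prec A B = m + 1 := ⟨prec A B - 1, by omega⟩
  have h0 : (2 : ℝ) ^ m < A m + B m + 1002 := by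
    exact_mod_cast lt_of_lt_prec (A := A) (B := B) (m := m) (by omega) (by omega)
  have h1 := (approx_bounds (h.fst_approx m)).1
  have h2 := (approx_bounds (h.snd_approx m)).1
  have h3 := half_le_two_pow_numLevels_mul hk h.start_lt
  have h4 : gap (start A B) ≤ 1 - p - q := by
    have := h.le_fstR_start
    have := h.le_sndR_start
    unfold gap
    linarith
  have h5 : (2 : ℝ) ^ (numLevels k (start A B) + 11) ≤ 2 ^ m :=
    pow_le_pow_right₀ one_le_two (by omega)
  rw [pow_add] at h5
  have hδ : 0 < 1 - p - q := by linarith [h.lt_one]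
  have hl : (0 : ℝ) < 2 ^ numLevels k (start A B) := by positivity
  nlinarith

end Approx

/-! ## The gates as a number -/

/-- The number with the given bits, least significant first. -/
def num : List Bool → ℕ
  | [] => 0
  | g :: gs => 2 * num gs + g.toNat

/-- The program computes the gates from the first level on and adds each as a new top bit, so that
the players can later read them from the low end. -/
theorem num_gatesOf_succ : ∀ (l : ℕ) (s : ℕ × ℕ × ℕ),
    num (gatesOf s (l + 1)) = num (gatesOf s l) + 2 ^ l * (natGate (natStep^[l] s)).toNat
  | 0, s => by simp [gatesOf, num]
  | l + 1, s => by
      rw [gatesOf, num, num_gatesOf_succ l (natStep s), gatesOf, num, Function.iterate_succ_apply,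
        pow_succ]
      ring

theorem num_lt : ∀ gs : List Bool, num gs < 2 ^ gs.length
  | [] => by simp [num]
  | g :: gs => by
      have := num_lt gs
      have := Bool.toNat_lt g
      rw [num, List.length_cons, pow_succ]
      omega

theorem natStep_den (s : ℕ × ℕ × ℕ) : (natStep s).2.2 = s.2.2 * s.2.2 := by
  unfold natStep; split_ifs <;> rfl

/-- The length doubles on each level, so it stays linear in the number `2 ^ l` of instances. -/
theorem iterate_natStep_den (s : ℕ × ℕ × ℕ) {M : ℕ} (h : s.2.2 = 2 ^ M) :
    ∀ l, (natStep^[l] s).2.2 = 2 ^ (M * 2 ^ l)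
  | 0 => by simpa using h
  | l + 1 => by
      rw [Function.iterate_succ_apply', natStep_den, iterate_natStep_den s h l, ← pow_add, pow_succ]
      congr 1; ring

/-! ## Polynomial bounds -/

/-- The function is bounded by a polynomial. -/
def PolyBdd (f : ℕ → ℕ) : Prop := ∃ P : Polynomial ℕ, ∀ x, f x ≤ P.eval x

namespace PolyBdd

theorem const (c : ℕ) : PolyBdd fun _ => c := ⟨Polynomial.C c, fun x => by simp⟩

theorem id : PolyBdd fun x => x := ⟨Polynomial.X, fun x => by simp⟩

theorem add {f g : ℕ → ℕ} (hf : PolyBdd f) (hg : PolyBdd g) : PolyBdd fun x => f x + g x := by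
  obtain ⟨P, hP⟩ := hf
  obtain ⟨Q, hQ⟩ := hg
  exact ⟨P + Q, fun x => by rw [Polynomial.eval_add]; exact Nat.add_le_add (hP x) (hQ x)⟩

theorem mul {f g : ℕ → ℕ} (hf : PolyBdd f) (hg : PolyBdd g) : PolyBdd fun x => f x * g x := by
  obtain ⟨P, hP⟩ := hf
  obtain ⟨Q, hQ⟩ := hg
  exact ⟨P * Q, fun x => by rw [Polynomial.eval_mul]; exact Nat.mul_le_mul (hP x) (hQ x)⟩

theorem eval (P : Polynomial ℕ) (c : ℕ) : PolyBdd fun x => P.eval (x + x + c) :=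
  ⟨P.comp (Polynomial.X + Polynomial.X + Polynomial.C c), fun x => by simp⟩

end PolyBdd

theorem eval_mono (P : Polynomial ℕ) : Monotone fun x => P.eval x := fun x y h => by
  simp only [Polynomial.eval_eq_sum, Polynomial.sum]
  exact Finset.sum_le_sum fun i _ => Nat.mul_le_mul_left _ (Nat.pow_le_pow_left h i)

end WeakOT

namespace WeakOT

namespace Prog

/-- The programs in the list, one after the other. -/
def block : List Prog → Prog
  | [] => const 31 0
  | P :: Ps => seq P (block Ps)

/-! ## The program for the schedule -/

/-- The registers during the computation of the schedule. -/
def regs (k w c r M a b D n G K x y : ℕ) : List ℕ :=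
  [k, w, c, r, M, a, b, D, n, G, K, x, 1, 2, y, 0, 0, 0, 0, 0, 0, 0, 0, 0, 0, 0, 0, 0, 0, 0, 0, 0]

theorem sizeLe_regs {k w c r M a b D n G K x y X : ℕ} (hk : k.size ≤ X) (hw : w.size ≤ X)
    (hc : c.size ≤ X) (hr : r.size ≤ X) (hM : M.size ≤ X) (ha : a.size ≤ X) (hb : b.size ≤ X)
    (hD : D.size ≤ X) (hn : n.size ≤ X) (hG : G.size ≤ X) (hK : K.size ≤ X) (hx : x.size ≤ X)
    (hy : y.size ≤ X) (h2 : 2 ≤ X) : SizeLe (regs k w c r M a b D n G K x y) X := by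
  intro v hv
  simp only [regs, List.mem_cons, List.not_mem_nil, or_false] at hv
  rcases hv with rfl | rfl | rfl | rfl | rfl | rfl | rfl | rfl | rfl | rfl | rfl | rfl | rfl | rfl |
    rfl | hv
  any_goals assumption
  · rw [Nat.size_one]; omega
  · have : v = 0 := by tauto
    rw [this, Nat.size_zero]; omega

/-- The constants and the state before the search for the precision. -/
def initBlock : Prog := block [const 7 1, const 11 1, const 12 1, const 13 2, const 14 1002]

/-- The approximations with one more bit are computed. -/
def precBody (P Q : Prog) : Prog :=
  block [add 4 4 12, add 7 7 7, call 32 P 0 4 5, call 32 Q 0 4 6,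
    block [add 11 5 6, add 11 11 14, sub 11 11 7]]

/-- The numerators become upper bounds, and register 4 counts down from `k`. -/
def powInit : Prog := block [add 5 5 12, add 6 6 12, const 10 1, add 4 0 31]

/-- One step in the computation of `2 ^ k`. -/
def powBody : Prog := block [add 10 10 10, sub 4 4 12]

/-- The state before the first level. -/
def levelInit : Prog := block [const 8 1, add 11 5 6, mul 11 11 10, sub 11 11 7]

/-- One level; its gate is added to register 9. -/
def levelBody : Prog :=
  block [sub 15 6 5,
    branch 15 (block [add 16 7 7, sub 16 16 5, mul 5 5 16, mul 6 6 6])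
      (block [add 16 7 7, sub 16 16 6, mul 6 6 16, mul 5 5 5, add 9 9 8]),
    block [mul 7 7 7, add 8 8 8, add 11 5 6, mul 11 11 10, sub 11 11 7, const 15 0, const 16 0]]

/-- Registers that are not needed any more are set to `0`. -/
def cleanBlock : Prog :=
  block [const 5 0, const 6 0, const 7 0, const 10 0, const 11 0, const 14 0]

/-- The number of instances and the gates are put into registers 8 and 9. -/
def setup (P Q : Prog) : Prog :=
  block [initBlock, loop 11 (precBody P Q), powInit, loop 4 powBody, levelInit, loop 11 levelBody,
    cleanBlock]

theorem exec_levelBody (k w c r a b D n G K x y : ℕ) :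
    levelBody.exec (regs k w c r 0 a b D n G K x y)
      = regs k w c r 0 (natStep (a, b, D)).1 (natStep (a, b, D)).2.1 (natStep (a, b, D)).2.2 (n + n)
          (G + n * (natGate (a, b, D)).toNat) K
          (((natStep (a, b, D)).1 + (natStep (a, b, D)).2.1) * K - (natStep (a, b, D)).2.2) y := by
  by_cases h : b ≤ a
  · have h' : b - a = 0 := by omega
    simp [levelBody, block, exec, regs, natStep, natGate, h, h', two_mul]
  · have h' : b - a ≠ 0 := by omega
    simp [levelBody, block, exec, regs, natStep, natGate, h, h', two_mul]


/-- Register 31 always contains `0`, so the last instruction of a block has no effect. -/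
theorem Reach.block_nil {l : List ℕ} (hl : l.length = 32) (h : l.getD 31 0 = 0) :
    (block []).Reach l l 1 := by
  refine ⟨_, le_rfl, ?_⟩
  have := Runs.const 31 0 (st l)
  rw [update_st l (by omega)] at this
  have e : l.set 31 0 = l := by
    rw [List.getD_eq_getElem _ _ (by omega)] at h
    rw [← h, List.set_getElem_self]
  rwa [e] at this

theorem size_le_of_lt {v X : ℕ} (h : v < 2 ^ X) : v.size ≤ X := Nat.size_le.2 h

theorem size_le_of_le_two_pow {v m X : ℕ} (h : v ≤ 2 ^ m) (hm : m < X) : v.size ≤ X :=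
  Nat.size_le.2 (h.trans_lt (Nat.pow_lt_pow_right one_lt_two hm))

/-- The time for the schedule, where all numbers have at most `Y` bits, and calls take time `T`. -/
def setupTime (P Q : Prog) (Y T N : ℕ) : ℕ :=
  (Y + 1) * (100 + initBlock.factor + powInit.factor + levelInit.factor + cleanBlock.factor) +
  (Y + 1) * (1 + Y + ((call 32 P 0 4 5).factor * (Y + T + 1) + T +
    ((call 32 Q 0 4 6).factor * (Y + T + 1) + T) + 100 * (Y + 1))) +
  Y * (1 + Y + powBody.factor * (Y + 1)) + N * (1 + Y + levelBody.factor * (Y + 1))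

theorem reach_precBody {P Q : Prog} {k w c r i a b a' b' x T Y : ℕ}
    (hP : P.Computes [k, i + 1] a T) (hQ : Q.Computes [k, i + 1] b T)
    (hY : SizeLe (regs k w c r i a' b' (2 ^ i) 0 0 0 x 1002) Y)
    (h1 : (i + 1).size ≤ Y) (h2 : (2 ^ (i + 1)).size ≤ Y) (h3 : a.size ≤ Y) (h4 : b.size ≤ Y) :
    (precBody P Q).Reach (regs k w c r i a' b' (2 ^ i) 0 0 0 x 1002)
      (regs k w c r (i + 1) a b (2 ^ (i + 1)) 0 0 0 (a + b + 1002 - 2 ^ (i + 1)) 1002)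
      ((call 32 P 0 4 5).factor * (Y + T + 1) + T +
        ((call 32 Q 0 4 6).factor * (Y + T + 1) + T) + 100 * (Y + 1)) := by
  have hY1 : SizeLe (regs k w c r (i + 1) a' b' (2 ^ i) 0 0 0 x 1002) Y := hY.set 4 h1
  have hY2 : SizeLe (regs k w c r (i + 1) a' b' (2 ^ (i + 1)) 0 0 0 x 1002) Y := hY1.set 7 h2
  have hY3 : SizeLe (regs k w c r (i + 1) a b' (2 ^ (i + 1)) 0 0 0 x 1002) Y := hY2.set 5 h3
  have hY4 : SizeLe (regs k w c r (i + 1) a b (2 ^ (i + 1)) 0 0 0 x 1002) Y := hY3.set 6 h4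
  have r1 : (add 4 4 12).Reach (regs k w c r i a' b' (2 ^ i) 0 0 0 x 1002)
      (regs k w c r (i + 1) a' b' (2 ^ i) 0 0 0 x 1002) _ := reach_exec (m := 32) rfl rfl hY rfl
  have r2 : (add 7 7 7).Reach (regs k w c r (i + 1) a' b' (2 ^ i) 0 0 0 x 1002)
      (regs k w c r (i + 1) a' b' (2 ^ (i + 1)) 0 0 0 x 1002) _ :=
    reach_exec (m := 32) rfl rfl hY1 (by rw [pow_succ, mul_two]; rfl)
  have r3 : (call 32 P 0 4 5).Reach (regs k w c r (i + 1) a' b' (2 ^ (i + 1)) 0 0 0 x 1002)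
      (regs k w c r (i + 1) a b' (2 ^ (i + 1)) 0 0 0 x 1002) _ :=
    reach_call (m := 32) (l := regs k w c r (i + 1) a' b' (2 ^ (i + 1)) 0 0 0 x 1002) P
      rfl (by omega) (by omega) (by omega) rfl hP hY2
  have r4 : (call 32 Q 0 4 6).Reach (regs k w c r (i + 1) a b' (2 ^ (i + 1)) 0 0 0 x 1002)
      (regs k w c r (i + 1) a b (2 ^ (i + 1)) 0 0 0 x 1002) _ :=
    reach_call (m := 32) (l := regs k w c r (i + 1) a b' (2 ^ (i + 1)) 0 0 0 x 1002) Q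
      rfl (by omega) (by omega) (by omega) rfl hQ hY3
  have r5 : (block [add 11 5 6, add 11 11 14, sub 11 11 7]).Reach
      (regs k w c r (i + 1) a b (2 ^ (i + 1)) 0 0 0 x 1002)
      (regs k w c r (i + 1) a b (2 ^ (i + 1)) 0 0 0 (a + b + 1002 - 2 ^ (i + 1)) 1002) _ :=
    reach_exec (m := 32) rfl rfl hY4 rfl
  refine (r1.seq (r2.seq (r3.seq (r4.seq (r5.seq (Reach.block_nil rfl rfl)))))).mono ?_
  have e : (block [add 11 5 6, add 11 11 14, sub 11 11 7]).factor = 53 := rfl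
  have e' : (add 4 4 12).factor = 2 := rfl
  have e'' : (add 7 7 7).factor = 2 := rfl
  rw [e, e', e'']
  omega


theorem size_le_of_le {v X : ℕ} (h : v ≤ X) : v.size ≤ X :=
  Nat.size_le.2 (h.trans_lt Nat.lt_two_pow_self)

theorem reach_precLoop {P Q : Prog} {k w c r T Y : ℕ} {A B : ℕ → ℕ} {p q : ℝ}
    (h : Approx A B p q)
    (hP : ∀ i ≤ prec A B, P.Computes [k, i] (A i) T)
    (hQ : ∀ i ≤ prec A B, Q.Computes [k, i] (B i) T)
    (hw : w.size ≤ Y) (hc : c.size ≤ Y) (hr : r.size ≤ Y) (hk : k ≤ Y) (hM : prec A B + 20 ≤ Y) :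
    (loop 11 (precBody P Q)).Reach (regs k w c r 0 0 0 1 0 0 0 1 1002)
      (regs k w c r (prec A B) (A (prec A B)) (B (prec A B)) (2 ^ prec A B) 0 0 0 0 1002)
      (prec A B * (1 + Y + ((call 32 P 0 4 5).factor * (Y + T + 1) + T +
        ((call 32 Q 0 4 6).factor * (Y + T + 1) + T) + 100 * (Y + 1))) + 1) := by
  have hA : ∀ i ≤ prec A B, (A i).size ≤ Y := fun i hi =>
    size_le_of_le_two_pow (m := i + 1)
      ((h.fst_le i).trans (by have := Nat.one_le_two_pow (n := i); rw [pow_succ]; omega)) (by omega)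
  have hB : ∀ i ≤ prec A B, (B i).size ≤ Y := fun i hi =>
    size_le_of_le_two_pow (m := i + 1)
      ((h.snd_le i).trans (by have := Nat.one_le_two_pow (n := i); rw [pow_succ]; omega)) (by omega)
  have h2 : ∀ i ≤ prec A B, (2 ^ i).size ≤ Y := fun i hi =>
    size_le_of_le_two_pow (m := i) le_rfl (by omega)
  -- The numerators are at most `2^i + 1` each, so the sum is at most `2^(i+1) + 1004 ≤ 2^(i+11)`.
  have hF : ∀ i ≤ prec A B, (A i + B i + 1002 - 2 ^ i).size ≤ Y := fun i hi =>
    size_le_of_le_two_pow (m := i + 11) (by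
      have := Nat.one_le_two_pow (n := i)
      have := h.fst_le i
      have := h.snd_le i
      rw [pow_add]
      omega) (by omega)
  have h1002 : Nat.size 1002 ≤ Y := size_le_of_le_two_pow (m := 10) (by norm_num) (by omega)
  -- Before the first pass nothing has been computed, and the loop register is set to 1 to force
  -- entry. This is why `prec` only admits precisions of at least 1.
  set f : ℕ → List ℕ := fun i => regs k w c r i (if i = 0 then 0 else A i)
    (if i = 0 then 0 else B i) (2 ^ i) 0 0 0 (if i = 0 then 1 else A i + B i + 1002 - 2 ^ i) 1002
    with hf
  have hY : ∀ i ≤ prec A B, SizeLe (f i) Y := fun i hi => by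
    refine sizeLe_regs (size_le_of_le hk) hw hc hr (size_le_of_le (by omega)) ?_ ?_ (h2 i hi)
      (by simp) (by simp) (by simp) ?_ h1002 (by omega)
    · split_ifs
      · simp
      · exact hA i hi
    · split_ifs
      · simp
      · exact hB i hi
    · split_ifs
      · rw [Nat.size_one]; omega
      · exact hF i hi
  have hM1 := h.prec_spec
  have := reach_loop (P := precBody P Q) (x := 11) (B := Y) f (prec A B) (fun i hi => by
      change (if i = 0 then 1 else A i + B i + 1002 - 2 ^ i) ≠ 0
      split_ifs with h0
      · exact one_ne_zero
      · have := Approx.lt_of_lt_prec (A := A) (B := B) (m := i) (by omega) hi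
        omega) (fun i hi => (hY i hi.le).getD 11) (by
      change (if prec A B = 0 then 1 else A (prec A B) + B (prec A B) + 1002 - 2 ^ prec A B) = 0
      rw [if_neg (by omega)]
      omega) (fun i hi => reach_precBody (hP (i + 1) hi) (hQ (i + 1) hi) (hY i hi.le)
        (size_le_of_le (by omega)) (h2 _ hi) (hA _ hi) (hB _ hi))
  have e : A (prec A B) + B (prec A B) + 1002 - 2 ^ prec A B = 0 := by omega
  simp only [hf, if_neg (show prec A B ≠ 0 by omega), e] at this
  exact this

theorem reach_powLoop {k w c r a b D Y : ℕ}
    (hY : ∀ i ≤ k, SizeLe (regs k w c r (k - i) a b D 0 0 (2 ^ i) 0 1002) Y) :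
    (loop 4 powBody).Reach (regs k w c r k a b D 0 0 1 0 1002)
      (regs k w c r 0 a b D 0 0 (2 ^ k) 0 1002)
      (k * (1 + Y + powBody.factor * (Y + 1)) + 1) := by
  have := reach_loop (P := powBody) (x := 4) (B := Y)
    (fun i => regs k w c r (k - i) a b D 0 0 (2 ^ i) 0 1002) k (fun i hi => by
      change k - i ≠ 0
      omega) (fun i hi => (hY i hi.le).getD 4) (Nat.sub_self k)
    (fun i hi => reach_exec (m := 32) rfl rfl (hY i hi.le) (by
      rw [show k - (i + 1) = k - i - 1 by omega, pow_succ, mul_two]; rfl))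
  simpa using this

theorem reach_levelLoop {k w c r Y : ℕ} {s : ℕ × ℕ × ℕ}
    (hY : ∀ i ≤ numLevels k s, SizeLe (regs k w c r 0 (natStep^[i] s).1 (natStep^[i] s).2.1
      (natStep^[i] s).2.2 (2 ^ i) (num (gatesOf s i)) (2 ^ k)
      (((natStep^[i] s).1 + (natStep^[i] s).2.1) * 2 ^ k - (natStep^[i] s).2.2) 1002) Y)
    (h : s.1 + s.2.1 < s.2.2) :
    (loop 11 levelBody).Reach
      (regs k w c r 0 s.1 s.2.1 s.2.2 1 0 (2 ^ k) ((s.1 + s.2.1) * 2 ^ k - s.2.2) 1002)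
      (regs k w c r 0 (natStep^[numLevels k s] s).1 (natStep^[numLevels k s] s).2.1
        (natStep^[numLevels k s] s).2.2 (2 ^ numLevels k s) (num (gatesOf s (numLevels k s)))
        (2 ^ k) 0 1002)
      (numLevels k s * (1 + Y + levelBody.factor * (Y + 1)) + 1) := by
  have hs := stop_numLevels k h
  have e : ((natStep^[numLevels k s] s).1 + (natStep^[numLevels k s] s).2.1) * 2 ^ k -
      (natStep^[numLevels k s] s).2.2 = 0 := Nat.sub_eq_zero_of_le hs
  have := reach_loop (P := levelBody) (x := 11) (B := Y)
    (fun i => regs k w c r 0 (natStep^[i] s).1 (natStep^[i] s).2.1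
      (natStep^[i] s).2.2 (2 ^ i) (num (gatesOf s i)) (2 ^ k)
      (((natStep^[i] s).1 + (natStep^[i] s).2.1) * 2 ^ k - (natStep^[i] s).2.2) 1002) (numLevels k s)
    (fun i hi => by
      have := not_stop_of_lt hi
      change ((natStep^[i] s).1 + (natStep^[i] s).2.1) * 2 ^ k - (natStep^[i] s).2.2 ≠ 0
      unfold Stop at this
      omega) (fun i hi => (hY i hi.le).getD 11) e
    (fun i hi => reach_exec (m := 32) rfl rfl (hY i hi.le) (by
      rw [exec_levelBody, num_gatesOf_succ, Function.iterate_succ_apply', pow_succ, mul_two]))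
  rw [e] at this
  exact this

theorem reach_setup {P Q : Prog} {k w c r T Y : ℕ} (hk : k ≠ 0) {A B : ℕ → ℕ} {p q : ℝ}
    (h : Approx A B p q)
    (hP : ∀ i ≤ prec A B, P.Computes [k, i] (A i) T)
    (hQ : ∀ i ≤ prec A B, Q.Computes [k, i] (B i) T)
    (hw : w.size ≤ Y) (hc : c.size ≤ Y) (hr : r.size ≤ Y)
    (hY : (prec A B + 3) * (2 ^ numLevels k (start A B) + k) + 20 ≤ Y) :
    (setup P Q).Reach [k, w, c, r]
      (regs k w c r 0 0 0 0 (2 ^ numLevels k (start A B))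
        (num (gatesOf (start A B) (numLevels k (start A B)))) 0 0 0)
      (setupTime P Q Y T (2 ^ numLevels k (start A B))) := by
  have hN1 := Nat.one_le_two_pow (n := numLevels k (start A B))
  have hl := Nat.lt_two_pow_self (n := numLevels k (start A B))
  have hlt := h.start_lt
  have hden : (start A B).2.2 = 2 ^ prec A B := rfl
  have hE : prec A B * 2 ^ numLevels k (start A B) + prec A B +
      3 * 2 ^ numLevels k (start A B) + 3 * k + 20 ≤ Y := by
    have : prec A B * 1 ≤ prec A B * k := Nat.mul_le_mul_left _ (by omega)
    nlinarith
  have h1002 : Nat.size 1002 ≤ Y := size_le_of_le_two_pow (m := 10) (by norm_num) (by omega)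
  have hks : k.size ≤ Y := size_le_of_le (by omega)
  have hpow : ∀ i ≤ k, (2 ^ i).size ≤ Y := fun i hi =>
    size_le_of_le_two_pow le_rfl (by omega)
  have h0 : Nat.size 0 ≤ Y := by simp
  have h1 : Nat.size 1 ≤ Y := by simp; omega
  -- Every number on level `i`, including the test value, is at most the denominator `2^(prec ·
  -- 2^i)` times `2^k`.
  have hS : ∀ i ≤ numLevels k (start A B), ∀ e ≤ k, ∀ v : ℕ,
      v ≤ (natStep^[i] (start A B)).2.2 * 2 ^ e → v.size ≤ Y := fun i hi e he v hv => by
    rw [iterate_natStep_den _ hden, ← pow_add] at hv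
    refine size_le_of_le_two_pow hv ?_
    have : prec A B * 2 ^ i ≤ prec A B * 2 ^ numLevels k (start A B) :=
      Nat.mul_le_mul_left _ (Nat.pow_le_pow_right (by norm_num) hi)
    omega
  have hS0 : ∀ i ≤ numLevels k (start A B), ∀ v : ℕ,
      v ≤ (natStep^[i] (start A B)).2.2 → v.size ≤ Y := fun i hi v hv =>
    hS i hi 0 (Nat.zero_le _) v (by simpa using hv)
  have hL : ∀ i ≤ numLevels k (start A B), SizeLe (regs k w c r 0 (natStep^[i] (start A B)).1
      (natStep^[i] (start A B)).2.1 (natStep^[i] (start A B)).2.2 (2 ^ i)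
      (num (gatesOf (start A B) i)) (2 ^ k) (((natStep^[i] (start A B)).1 +
        (natStep^[i] (start A B)).2.1) * 2 ^ k - (natStep^[i] (start A B)).2.2) 1002) Y :=
    fun i hi => by
      have hi' := iterate_natStep_lt hlt i
      have hn := num_lt (gatesOf (start A B) i)
      rw [length_gatesOf] at hn
      refine sizeLe_regs hks hw hc hr h0 (hS0 i hi _ (by omega)) (hS0 i hi _ (by omega))
        (hS0 i hi _ le_rfl) (size_le_of_le_two_pow le_rfl (by omega))
        (size_le_of_le_two_pow hn.le (by omega)) (hpow k le_rfl)
        (hS i hi k le_rfl _ ((Nat.sub_le _ _).trans (Nat.mul_le_mul_right _ hi'.le))) h1002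
        (by omega)
  have hS1 : ∀ v ≤ 2 ^ prec A B, v.size ≤ Y := fun v hv => size_le_of_le_two_pow hv (by omega)
  have hM := h.prec_spec
  have hpz : ∀ M K a b n x, M ≤ k → K ≤ k → a ≤ 2 ^ prec A B → b ≤ 2 ^ prec A B →
      n ≤ 1 → x.size ≤ Y →
      SizeLe (regs k w c r M a b (2 ^ prec A B) n 0 (2 ^ K) x 1002) Y :=
    fun M K a b n x hM' hK ha hb hn hx => sizeLe_regs hks hw hc hr (size_le_of_le (by omega))
      (hS1 _ ha) (hS1 _ hb) (hS1 _ le_rfl) (size_le_of_le (by omega)) h0 (hpow K hK) hx h1002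
      (by omega)
  have r1 : initBlock.Reach [k, w, c, r] (regs k w c r 0 0 0 1 0 0 0 1 1002)
      (initBlock.factor * (Y + 1)) := by
    -- The input is padded with zeros to the 32 registers used throughout.
    have := reach_exec (P := initBlock) (l := [k, w, c, r] ++ List.replicate 28 0)
      (l' := regs k w c r 0 0 0 1 0 0 0 1 1002) (m := 32) (B := Y) rfl rfl (fun v hv => by
        rcases List.mem_append.1 hv with hv | hv
        · simp only [List.mem_cons, List.not_mem_nil, or_false] at hv
          rcases hv with rfl | rfl | rfl | rfl <;> assumption
        · rw [List.eq_of_mem_replicate hv]; exact h0) rfl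
    obtain ⟨t, ht, hr⟩ := this
    rw [st_append_zeros] at hr
    exact ⟨t, ht, hr⟩
  have r2 := reach_precLoop h hP hQ hw hc hr (show k ≤ Y by omega) (by omega)
  have r3 : powInit.Reach
      (regs k w c r (prec A B) (A (prec A B)) (B (prec A B)) (2 ^ prec A B) 0 0 0 0 1002)
      (regs k w c r k (A (prec A B) + 1) (B (prec A B) + 1) (2 ^ prec A B) 0 0 1 0 1002)
      (powInit.factor * (Y + 1)) :=
    reach_exec (m := 32) rfl rfl (sizeLe_regs hks hw hc hr (size_le_of_le (by omega))
      (hS1 _ (by omega)) (hS1 _ (by omega)) (hS1 _ le_rfl) h0 h0 h0 h0 h1002 (by omega)) rfl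
  have r4 := reach_powLoop (k := k) (w := w) (c := c) (r := r) (a := A (prec A B) + 1)
    (b := B (prec A B) + 1) (D := 2 ^ prec A B) (Y := Y) fun i hi =>
      hpz _ _ _ _ _ _ (Nat.sub_le _ _) hi (by omega) (by omega) (by omega) h0
  have r5 : levelInit.Reach
      (regs k w c r 0 (A (prec A B) + 1) (B (prec A B) + 1) (2 ^ prec A B) 0 0 (2 ^ k) 0 1002)
      (regs k w c r 0 (start A B).1 (start A B).2.1 (start A B).2.2 1 0 (2 ^ k)
        (((start A B).1 + (start A B).2.1) * 2 ^ k - (start A B).2.2) 1002)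
      (levelInit.factor * (Y + 1)) :=
    reach_exec (m := 32) rfl rfl
      (hpz _ _ _ _ _ _ (Nat.zero_le _) le_rfl (by omega) (by omega) (by omega) h0) rfl
  have r6 := reach_levelLoop (w := w) (c := c) (r := r) hL hlt
  have r7 : cleanBlock.Reach (regs k w c r 0 (natStep^[numLevels k (start A B)] (start A B)).1
      (natStep^[numLevels k (start A B)] (start A B)).2.1
      (natStep^[numLevels k (start A B)] (start A B)).2.2 (2 ^ numLevels k (start A B))
      (num (gatesOf (start A B) (numLevels k (start A B)))) (2 ^ k) 0 1002)
      (regs k w c r 0 0 0 0 (2 ^ numLevels k (start A B))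
        (num (gatesOf (start A B) (numLevels k (start A B)))) 0 0 0)
      (cleanBlock.factor * (Y + 1)) :=
    reach_exec (m := 32) rfl rfl ((hL _ le_rfl).set 11 (v := 0) h0) rfl
  refine (r1.seq (r2.seq (r3.seq (r4.seq (r5.seq (r6.seq (r7.seq
    (Reach.block_nil rfl rfl)))))))).mono ?_
  unfold setupTime
  have b1 : prec A B * (1 + Y + ((call 32 P 0 4 5).factor * (Y + T + 1) + T +
      ((call 32 Q 0 4 6).factor * (Y + T + 1) + T) + 100 * (Y + 1))) ≤ (Y + 1) * (1 + Y +
      ((call 32 P 0 4 5).factor * (Y + T + 1) + T + ((call 32 Q 0 4 6).factor * (Y + T + 1) + T) +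
        100 * (Y + 1))) := Nat.mul_le_mul_right _ (by omega)
  have b2 : k * (1 + Y + powBody.factor * (Y + 1)) ≤ Y * (1 + Y + powBody.factor * (Y + 1)) :=
    Nat.mul_le_mul_right _ (by omega)
  have b3 : numLevels k (start A B) * (1 + Y + levelBody.factor * (Y + 1)) ≤
      2 ^ numLevels k (start A B) * (1 + Y + levelBody.factor * (Y + 1)) :=
    Nat.mul_le_mul_right _ hl.le
  rw [mul_add (Y + 1), mul_add (Y + 1), mul_add (Y + 1), mul_add (Y + 1)]
  rw [mul_comm (Y + 1) 100, mul_comm (Y + 1) (initBlock.factor),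
    mul_comm (Y + 1) (powInit.factor), mul_comm (Y + 1) (levelInit.factor),
    mul_comm (Y + 1) (cleanBlock.factor)]
  omega

end Prog
end WeakOT

namespace WeakOT

/-! ## Lists of bits as numbers -/

theorem encodeBits_lt : ∀ l : List Bool, encodeBits l < 2 ^ (l.length + 1)
  | [] => by simp [encodeBits]
  | b :: l => by
      have := encodeBits_lt l
      have := Bool.toNat_lt b
      rw [encodeBits, List.length_cons, pow_succ]
      omega

theorem encodePairs_lt (l : List (Bool × Bool)) : encodePairs l < 2 ^ (2 * l.length + 1) := by
  have := encodeBits_lt (l.flatMap fun x => [x.1, x.2])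
  have e : (l.flatMap fun x => [x.1, x.2]).length = 2 * l.length := by
    simp [List.length_flatMap, mul_comm]
  rwa [e] at this

theorem one_le_encodeBits : ∀ l : List Bool, 1 ≤ encodeBits l
  | [] => le_rfl
  | b :: l => by have := one_le_encodeBits l; rw [encodeBits]; omega

theorem encodeBits_le_append : ∀ l l' : List Bool, encodeBits l' ≤ encodeBits (l ++ l')
  | [], _ => le_rfl
  | b :: l, l' => by
      have := encodeBits_le_append l l'
      rw [List.cons_append, encodeBits]
      omega

/-- Besides adding two bits, the leading 1 moves up two places, which contributes `4 - 1 = 3` times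
`4 ^ l.length`. -/
theorem encodePairs_append_singleton (x : Bool × Bool) : ∀ l : List (Bool × Bool),
    encodePairs (l ++ [x])
      = encodePairs l + (x.1.toNat + (x.2.toNat + x.2.toNat) + 3) * 4 ^ l.length
  | [] => by
      change 2 * (2 * 1 + x.2.toNat) + x.1.toNat = 1 + _ * 1
      omega
  | y :: l => by
      have := encodePairs_append_singleton x l
      change 2 * (2 * encodePairs (l ++ [x]) + y.2.toNat) + y.1.toNat
        = 2 * (2 * encodePairs l + y.2.toNat) + y.1.toNat + _
      rw [this, List.length_cons, pow_succ]
      ring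

/-- The remainder after division by 2. -/
def md (x : ℕ) : ℕ := x - (x / 2 + x / 2)

theorem md_eq (x : ℕ) : md x = x % 2 := by unfold md; omega

theorem half_bit (x : ℕ) (b : Bool) : (2 * x + b.toNat) / 2 = x := by
  have := Bool.toNat_lt b; omega

theorem md_bit (x : ℕ) (b : Bool) : md (2 * x + b.toNat) = b.toNat := by
  have := Bool.toNat_lt b; rw [md_eq]; omega

namespace Prog

/-! ## The programs of the players -/

/-- The registers of a player. -/
def pregs (k w c r Q W h e n G x θ φ y : ℕ) : List ℕ :=
  [k, w, c, r, Q, W, h, e, n, G, x, θ, 1, 2, φ, 4, 16, 3, 0, 0, 0, 0, 0, 0, 0, 0, 0, y, 0, 0, 0, 0]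

/-- Register `x` modulo 2, where `t` is free. -/
def mod2 (x t : ℕ) : Prog := block [div t x 13, add t t t, sub x x t]

/-- Split register `x` into its last bit (in `y`) and the rest (in `q`). -/
def split (x q y : ℕ) : Prog := block [div q x 13, add y q q, sub y x y]

/-- The state before the outputs of the instances are converted. -/
def playerInit (f : Bool) (θ : ℕ) : Prog :=
  block [const 4 1, const 5 1, div 6 8 13, add 7 6 31, sub 10 1 12, const 11 θ, const 14 f.toNat,
    const 15 4, const 16 16, const 17 3]

/-- The outputs of one instance are converted and put at the end of the queue. -/
def convBody : Prog :=
  block [split 1 18 19, add 21 18 31, split 18 1 20, sub 21 12 14, mul 22 21 20, add 22 22 19,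
    mod2 22 23, mul 24 14 20, mul 25 21 19, add 24 24 25, add 24 24 24, add 22 22 24, add 22 22 17,
    mul 22 22 5, add 4 4 22, mul 5 5 15, const 18 0, const 19 0, const 20 0, const 21 0,
    const 22 0, const 23 0, const 24 0, const 25 0, sub 10 1 12]

/-- Register 10 tells whether there are messages left. -/
def playerMid : Prog := sub 10 3 11

/-- Two pairs in the queue are combined. -/
def stepBlock : Prog :=
  block [split 4 18 19, split 18 20 21, split 20 22 23, split 22 4 24, div 5 5 16, split 3 25 26,
    add 3 25 31, div 27 9 13, add 28 9 14, mod2 28 29, sub 29 12 28, mul 30 29 23, add 19 19 30,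
    mod2 19 18, mul 30 30 26, add 21 21 24, add 21 21 30, mod2 21 18, add 21 21 21, add 19 19 21,
    add 19 19 17, mul 19 19 5, add 4 4 19, mul 5 5 15, sub 7 7 12, const 18 0, const 19 0,
    const 20 0, const 21 0, const 22 0, const 23 0, const 24 0, const 25 0, const 26 0, const 28 0,
    const 29 0, const 30 0, sub 10 3 11]

/-- One round; after the last round of a level the next level begins. -/
def stepBody : Prog :=
  seq stepBlock (branch 7 (const 27 0) (block [div 6 6 13, add 7 6 31, add 9 27 31, const 27 0]))

/-- The next message. -/
def msgBlock : Prog :=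
  block [div 18 4 15, add 18 18 4, mod2 18 19, add 20 9 14, mod2 20 19, sub 21 12 14, add 21 21 3,
    div 21 21 13, mul 0 18 20, mul 0 0 21]

/-- The output. -/
def outBlock : Prog :=
  block [split 4 18 19, mod2 18 20, sub 20 12 14, mul 21 14 19, mul 22 20 18, add 21 21 22,
    mul 22 20 19, add 18 18 22, mod2 18 23, add 18 18 18, add 21 21 18, add 0 21 15]

theorem exec_convBody (k w c r Q W h e n G x θ φ : ℕ) :
    convBody.exec (pregs k w c r Q W h e n G x θ φ 0)
      = pregs k (w / 2 / 2) c r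
          (Q + (md ((1 - φ) * md (w / 2) + md w) + ((φ * md (w / 2) + (1 - φ) * md w) +
            (φ * md (w / 2) + (1 - φ) * md w)) + 3) * W)
          (W * 4) h e n G (w / 2 / 2 - 1) θ φ 0 := by
  simp only [convBody, split, mod2, block, exec, pregs,
    List.getD_cons_succ, List.getD_cons_zero, List.set_cons_succ, List.set_cons_zero, md,
    Nat.add_zero]

theorem exec_stepBlock (k w c r Q W h e n G x θ φ : ℕ) :
    stepBlock.exec (pregs k w c r Q W h e n G x θ φ 0)
      = pregs k w c (r / 2)
          (Q / 2 / 2 / 2 / 2 + (md (md Q + (1 - md (G + φ)) * md (Q / 2 / 2)) +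
            (md (md (Q / 2) + md (Q / 2 / 2 / 2) + (1 - md (G + φ)) * md (Q / 2 / 2) * md r) +
             md (md (Q / 2) + md (Q / 2 / 2 / 2) + (1 - md (G + φ)) * md (Q / 2 / 2) * md r)) + 3)
              * (W / 16))
          (W / 16 * 4) h (e - 1) n G (r / 2 - θ) θ φ (G / 2) := by
  simp only [stepBlock, split, mod2, block, exec, pregs,
    List.getD_cons_succ, List.getD_cons_zero, List.set_cons_succ, List.set_cons_zero, md,
    Nat.add_zero]

theorem exec_msgBlock (k w c r Q W h e n G x θ φ : ℕ) :
    (msgBlock.exec (pregs k w c r Q W h e n G x θ φ 0)).getD 0 0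
      = md (Q / 4 + Q) * md (G + φ) * ((1 - φ + r) / 2) := by
  simp only [msgBlock, mod2, block, exec, pregs,
    List.getD_cons_succ, List.getD_cons_zero, List.set_cons_succ, List.set_cons_zero, md]

theorem exec_outBlock (k w c r Q W h e n G x θ φ : ℕ) :
    (outBlock.exec (pregs k w c r Q W h e n G x θ φ 0)).getD 0 0
      = φ * md Q + (1 - φ) * md (Q / 2) + (md (md (Q / 2) + (1 - φ) * md Q) +
          md (md (Q / 2) + (1 - φ) * md Q)) + 4 := by
  simp only [outBlock, split, mod2, block, exec, pregs,
    List.getD_cons_succ, List.getD_cons_zero, List.set_cons_succ, List.set_cons_zero, md]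

end Prog
end WeakOT

namespace WeakOT

/-! ## The remaining gates -/

/-- The remaining gates, if `e` rounds of the current level are left, and `gs` are the gates of the
current level and of all further levels. -/
def remGates (gs : List Bool) (e : ℕ) : List Bool :=
  List.replicate e (gs.headD false) ++ expand gs.tail

theorem remGates_half : ∀ gs : List Bool, remGates gs (2 ^ gs.length / 2) = expand gs
  | [] => rfl
  | g :: gs => by simp [remGates, expand, pow_succ]

theorem remGates_succ (g : Bool) (gs : List Bool) (e : ℕ) :
    remGates (g :: gs) (e + 1) = g :: remGates (g :: gs) e := rfl

/-- The pair for the outputs of an instance, for the sender (`f = false`) and the receiver. -/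
def conv (f : Bool) (x : Bool × Bool) : Bool × Bool := bif f then x else toPair x

namespace Prog

theorem Reach.loop_stop {P : Prog} {x : ℕ} {l : List ℕ} (h : l.getD x 0 = 0) :
    (loop x P).Reach l l 1 := ⟨1, le_rfl, Runs.loop_stop h⟩

theorem Reach.loop_step {P : Prog} {x B T T' : ℕ} {l l' l'' : List ℕ} (hx : l.getD x 0 ≠ 0)
    (hB : SizeLe l B) (h : P.Reach l l' T) (h' : (loop x P).Reach l' l'' T') :
    (loop x P).Reach l l'' (1 + B + T + T') := by
  obtain ⟨t, ht, hr⟩ := h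
  obtain ⟨t', ht', hr'⟩ := h'
  have := hB.getD x
  exact ⟨_, by unfold st; omega, Runs.loop_step hx hr hr'⟩

theorem sizeLe_pregs {k w c r Q W h e n G x θ φ y X : ℕ} (hk : k.size ≤ X) (hw : w.size ≤ X)
    (hc : c.size ≤ X) (hr : r.size ≤ X) (hQ : Q.size ≤ X) (hW : W.size ≤ X) (hh : h.size ≤ X)
    (he : e.size ≤ X) (hn : n.size ≤ X) (hG : G.size ≤ X) (hx : x.size ≤ X) (hθ : θ.size ≤ X)
    (hφ : φ.size ≤ X) (hy : y.size ≤ X) (hX : 5 ≤ X) :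
    SizeLe (pregs k w c r Q W h e n G x θ φ y) X := by
  have h1 : Nat.size 1 ≤ X := by rw [Nat.size_one]; omega
  have h2 : Nat.size 2 ≤ X := size_le_of_le (by omega)
  have h4 : Nat.size 4 ≤ X := size_le_of_le (by omega)
  have h16 : Nat.size 16 ≤ X := size_le_of_le_two_pow (m := 4) (by norm_num) (by omega)
  have h3 : Nat.size 3 ≤ X := size_le_of_le (by omega)
  have h0 : Nat.size 0 ≤ X := by simp
  intro v hv
  simp only [pregs, List.mem_cons, List.not_mem_nil, or_false] at hv
  rcases hv with rfl | rfl | rfl | rfl | rfl | rfl | rfl | rfl | rfl | rfl | rfl | rfl | rfl | rfl |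
    rfl | rfl | rfl | rfl | rfl | rfl | rfl | rfl | rfl | rfl | rfl | rfl | rfl | rfl | rfl | rfl |
    rfl | rfl <;> assumption

theorem conv_eq (f : Bool) (x : Bool × Bool) :
    md ((1 - f.toNat) * x.2.toNat + x.1.toNat) = (conv f x).1.toNat ∧
    f.toNat * x.2.toNat + (1 - f.toNat) * x.1.toNat = (conv f x).2.toNat := by
  obtain ⟨a, b⟩ := x
  cases f <;> cases a <;> cases b <;> decide

/-- The registers with which the outputs of the instances are converted. -/
def convRegs (k c r h e n G θ : ℕ) (f : Bool) (q ws : List (Bool × Bool)) : List ℕ :=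
  pregs k (encodePairs ws) c r (encodePairs q) (4 ^ q.length) h e n G (encodePairs ws - 1) θ
    f.toNat 0

theorem exec_convBody_convRegs (k c r h e n G θ : ℕ) (f : Bool) (x : Bool × Bool)
    (q ws : List (Bool × Bool)) :
    convBody.exec (convRegs k c r h e n G θ f q (x :: ws))
      = convRegs k c r h e n G θ f (q ++ [conv f x]) ws := by
  have e1 : encodePairs (x :: ws) = 2 * (2 * encodePairs ws + x.2.toNat) + x.1.toNat := rfl
  unfold convRegs
  rw [exec_convBody, e1, half_bit, half_bit, md_bit, md_bit, (conv_eq f x).1, (conv_eq f x).2,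
    encodePairs_append_singleton, List.length_append, List.length_singleton, pow_succ]

/-- The loop register holds the encoding minus 1, which vanishes exactly when no outputs are left.
-/
theorem reach_convLoop {k c r h e n G θ Y : ℕ} {f : Bool} : ∀ (ws q : List (Bool × Bool)),
    (∀ q' ws', q'.length + ws'.length = q.length + ws.length →
      SizeLe (convRegs k c r h e n G θ f q' ws') Y) →
    (loop 10 convBody).Reach (convRegs k c r h e n G θ f q ws)
      (convRegs k c r h e n G θ f (q ++ ws.map (conv f)) [])
      (ws.length * (1 + Y + convBody.factor * (Y + 1)) + 1)
  | [], q, _ => by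
      rw [List.map_nil, List.append_nil]
      exact (Reach.loop_stop rfl).mono (by simp)
  | x :: ws, q, hY => by
      have ih := reach_convLoop ws (q ++ [conv f x]) fun q' ws' h => hY q' ws' (by
        simp only [List.length_append, List.length_nil, List.length_cons] at h ⊢; omega)
      rw [List.append_assoc] at ih
      have hs := hY q (x :: ws) rfl
      refine (Reach.loop_step ?_ hs (reach_exec (m := 32) rfl rfl hs
        (exec_convBody_convRegs ..)) ih).mono ?_
      · change encodePairs (x :: ws) - 1 ≠ 0
        have e1 : encodePairs (x :: ws) = 2 * (2 * encodePairs ws + x.2.toNat) + x.1.toNat := rfl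
        have : 1 ≤ encodePairs ws := one_le_encodeBits _
        omega
      · rw [List.length_cons, add_mul]
        omega

theorem comb_eq (f g d : Bool) (u v : Bool × Bool) (G : ℕ) :
    md (2 * G + g.toNat + f.toNat) = (xor f g).toNat ∧
    md (u.1.toNat + (1 - (xor f g).toNat) * v.1.toNat) = (comb (xor f g) d u v).1.toNat ∧
    md (u.2.toNat + v.2.toNat + (1 - (xor f g).toNat) * v.1.toNat * d.toNat)
      = (comb (xor f g) d u v).2.toNat := by
  obtain ⟨u1, u2⟩ := u
  obtain ⟨v1, v2⟩ := v
  refine ⟨?_, ?_⟩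
  · rw [md_eq]
    cases f <;> cases g <;> simp only [Bool.xor_false, Bool.xor_true, Bool.not_true,
      Bool.not_false, Bool.toNat_true, Bool.toNat_false] <;> omega
  · generalize xor f g = a
    revert a d u1 u2 v1 v2
    decide

/-- The registers in the rounds. -/
def roundRegs (k c n θ : ℕ) (f : Bool) (q : List (Bool × Bool)) (gs : List Bool) (e : ℕ)
    (rs : List Bool) : List ℕ :=
  pregs k 1 c (encodeBits rs) (encodePairs q) (4 ^ q.length) (2 ^ gs.length / 2) e n (num gs)
    (encodeBits rs - θ) θ f.toNat 0

theorem exec_stepBlock_roundRegs (k c n θ : ℕ) (f : Bool) (u v : Bool × Bool)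
    (q : List (Bool × Bool)) (g : Bool) (gs : List Bool) (e : ℕ) (d : Bool) (rs : List Bool) :
    stepBlock.exec (roundRegs k c n θ f (u :: v :: q) (g :: gs) e (d :: rs))
      = pregs k 1 c (encodeBits rs) (encodePairs (q ++ [comb (xor f g) d u v])) (4 ^ (q.length + 1))
          (2 ^ (gs.length + 1) / 2) (e - 1) n (num (g :: gs)) (encodeBits rs - θ) θ f.toNat
          (num gs) := by
  have e1 : encodePairs (u :: v :: q) = 2 * (2 * (2 * (2 * encodePairs q + v.2.toNat) +
      v.1.toNat) + u.2.toNat) + u.1.toNat := rfl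
  have e2 : 4 ^ (u :: v :: q).length / 16 = 4 ^ q.length := by
    rw [List.length_cons, List.length_cons, pow_succ, pow_succ]; omega
  have e3 : encodeBits (d :: rs) = 2 * encodeBits rs + d.toNat := rfl
  obtain ⟨c1, c2, c3⟩ := comb_eq f g d u v (num gs)
  unfold roundRegs
  rw [exec_stepBlock, e1, e2, e3, num]
  simp only [half_bit, md_bit, c1, c2, c3, encodePairs_append_singleton, List.length_cons, pow_succ]

theorem reach_stepBody {k c n θ Y e : ℕ} {f g d : Bool} {u v : Bool × Bool}
    {q : List (Bool × Bool)} {gs rs : List Bool}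
    (h1 : SizeLe (roundRegs k c n θ f (u :: v :: q) (g :: gs) (e + 1) (d :: rs)) Y)
    (h2 : SizeLe (roundRegs k c n θ f (q ++ [comb (xor f g) d u v]) (g :: gs) e rs) Y)
    (hgs : (num gs).size ≤ Y) :
    stepBody.Reach (roundRegs k c n θ f (u :: v :: q) (g :: gs) (e + 1) (d :: rs))
      (if e = 0 then
        roundRegs k c n θ f (q ++ [comb (xor f g) d u v]) gs (2 ^ gs.length / 2) rs
      else roundRegs k c n θ f (q ++ [comb (xor f g) d u v]) (g :: gs) e rs)
      ((stepBlock.factor + 200) * (Y + 1)) := by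
  have r1 := reach_exec (m := 32) rfl rfl h1 (exec_stepBlock_roundRegs k c n θ f u v q g gs (e + 1)
    d rs)
  have h3 : SizeLe (pregs k 1 c (encodeBits rs) (encodePairs (q ++ [comb (xor f g) d u v]))
      (4 ^ (q.length + 1)) (2 ^ (gs.length + 1) / 2) e n (num (g :: gs)) (encodeBits rs - θ) θ
      f.toNat (num gs)) Y := by
    have := h2.set 27 hgs
    unfold roundRegs at this
    rw [List.length_append, List.length_singleton, List.length_cons] at this
    exact this
  -- When the round counter of a level reaches 0, the number of rounds is halved and the gates are
  -- shifted by one bit; otherwise the shifted gates in register 27 are discarded.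
  by_cases he : e = 0
  · subst he
    rw [if_pos rfl]
    have r2 : (block [div 6 6 13, add 7 6 31, add 9 27 31, const 27 0]).Reach
        (pregs k 1 c (encodeBits rs) (encodePairs (q ++ [comb (xor f g) d u v]))
          (4 ^ (q.length + 1)) (2 ^ (gs.length + 1) / 2) 0 n (num (g :: gs))
          (encodeBits rs - θ) θ f.toNat (num gs))
        (roundRegs k c n θ f (q ++ [comb (xor f g) d u v]) gs (2 ^ gs.length / 2) rs) _ :=
      reach_exec (m := 32) rfl rfl h3 (by
        unfold roundRegs
        rw [List.length_append, List.length_singleton, pow_succ 2 gs.length,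
          Nat.mul_div_cancel _ (by norm_num : 0 < 2)]
        rfl)
    refine (r1.seq (Reach.branch_zero rfl r2)).mono ?_
    have : (block [div 6 6 13, add 7 6 31, add 9 27 31, const 27 0]).factor ≤ 199 := by decide
    have := Nat.mul_le_mul_right (Y + 1) this
    rw [add_mul]
    omega
  · rw [if_neg he]
    have r2 : (const 27 0).Reach
        (pregs k 1 c (encodeBits rs) (encodePairs (q ++ [comb (xor f g) d u v]))
          (4 ^ (q.length + 1)) (2 ^ (gs.length + 1) / 2) e n (num (g :: gs))
          (encodeBits rs - θ) θ f.toNat (num gs))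
        (roundRegs k c n θ f (q ++ [comb (xor f g) d u v]) (g :: gs) e rs) _ :=
      reach_exec (m := 32) rfl rfl h3 (by
        unfold roundRegs
        rw [List.length_append, List.length_singleton, List.length_cons]
        rfl)
    refine (r1.seq (Reach.branch_pos (x := 7) he (h3.getD 7) r2)).mono ?_
    have : (const 27 0).factor = 1 := by simp [factor]
    rw [this, add_mul]
    omega

/-- Messages are consumed from the low end until their encoding is at most `θ`; the two conditions
on `θ` say that this happens exactly when `rest` remains. The queue is always one longer than the
list of remaining gates, and the counter `e` vanishes only after the last level. -/
theorem reach_stepLoop {k c n θ Y : ℕ} {f : Bool} {rest : List Bool} (hθ : encodeBits rest ≤ θ)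
    {N : ℕ} (hY : ∀ (q : List (Bool × Bool)) (gs : List Bool) (e : ℕ) (ds : List Bool),
      q.length ≤ N → 2 ^ gs.length ≤ N → e ≤ N → ds.length ≤ N →
        SizeLe (roundRegs k c n θ f q gs e (ds ++ rest)) Y ∧ (num gs).size ≤ Y) :
    ∀ (ds : List Bool) (q : List (Bool × Bool)) (gs : List Bool) (e : ℕ) (γ : ℕ → Bool),
    (gs = [] ↔ e = 0) → (remGates gs e).length + 1 = q.length → ds.length < q.length →
    (∀ i, γ i = (remGates gs e).getD i false) → (ds ≠ [] → θ < 2 * encodeBits rest) →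
    q.length ≤ N → 2 ^ gs.length ≤ N →
    ∃ gs' e', (loop 10 stepBody).Reach (roundRegs k c n θ f q gs e (ds ++ rest))
      (roundRegs k c n θ f (proc f γ q ds) gs' e' rest)
      (ds.length * (1 + Y + (stepBlock.factor + 200) * (Y + 1)) + 1) ∧
      gs'.headD false = γ ds.length ∧
      SizeLe (roundRegs k c n θ f (proc f γ q ds) gs' e' rest) Y
  | [], q, gs, e, γ, h0, hl, hq, hγ, hr, hqN, hgN => by
      have he : e ≤ N := by
        simp only [remGates, List.length_append, List.length_replicate] at hl; omega
      refine ⟨gs, e, (Reach.loop_stop ?_).mono (by simp), ?_, (hY q gs e [] hqN hgN he (by simp)).1⟩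
      · change encodeBits rest - θ = 0
        omega
      · rw [hγ]
        cases gs with
        | nil => simp [remGates, h0.1 rfl, expand]
        | cons g gs =>
          obtain ⟨e, rfl⟩ := Nat.exists_eq_succ_of_ne_zero fun h => List.cons_ne_nil _ _ (h0.2 h)
          rfl
  | d :: ds, q, gs, e, γ, h0, hl, hq, hγ, hr, hqN, hgN => by
      have he : e ≤ N := by
        simp only [remGates, List.length_append, List.length_replicate] at hl; omega
      obtain ⟨u, v, q, rfl⟩ : ∃ u v q', q = u :: v :: q' := by
        match q, hq with
        | [u], h => simp at h
        | u :: v :: q, _ => exact ⟨u, v, q, rfl⟩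
      match gs, e, h0 with
      -- Without gates the queue would have length one, but two pairs are present.
      | [], e, h0 => rw [h0.1 rfl] at hl; simp [remGates, expand] at hl
      | g :: gs, 0, h0 => exact absurd (h0.2 rfl) (List.cons_ne_nil _ _)
      | g :: gs, e + 1, h0 =>
        rw [remGates_succ] at hl hγ
        have hγ0 : γ 0 = g := hγ 0
        simp only [List.length_cons] at hq hqN hl hgN
        have hp := Nat.one_le_two_pow (n := gs.length)
        rw [pow_succ] at hgN
        have hql : (q ++ [comb (xor f g) d u v]).length = q.length + 1 := by simp
        obtain ⟨gs', e', hge, hlast, hstep⟩ : ∃ gs' e', (gs' = [] ↔ e' = 0) ∧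
            (remGates gs' e' = remGates (g :: gs) e ∧ 2 ^ gs'.length ≤ N) ∧
            stepBody.Reach (roundRegs k c n θ f (u :: v :: q) (g :: gs) (e + 1) (d :: ds ++ rest))
              (roundRegs k c n θ f (q ++ [comb (xor f g) d u v]) gs' e' (ds ++ rest))
              ((stepBlock.factor + 200) * (Y + 1)) := by
          have hs := reach_stepBody
            (hY (u :: v :: q) (g :: gs) (e + 1) (d :: ds) (by simpa using hqN)
              (by rw [List.length_cons, pow_succ]; omega) he (by simp; omega)).1
            (hY (q ++ [comb (xor f g) d u v]) (g :: gs) e ds (by omega)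
              (by rw [List.length_cons, pow_succ]; omega) (by omega) (by omega)).1
            (hY [] gs 0 [] (by simp) (by omega) (by omega) (by simp)).2
          by_cases he0 : e = 0
          · subst he0
            rw [if_pos rfl] at hs
            refine ⟨gs, 2 ^ gs.length / 2, ?_, ⟨?_, by omega⟩, hs⟩
            · cases gs with
              | nil => simp
              | cons a gs =>
                have := Nat.one_le_two_pow (n := gs.length)
                simp [pow_succ]
            · rw [remGates_half]; rfl
          · rw [if_neg he0] at hs
            exact ⟨g :: gs, e, by simp [he0], ⟨rfl, by rw [List.length_cons, pow_succ]; omega⟩, hs⟩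
        obtain ⟨gs₁, e₁, h2, h3, h4⟩ := reach_stepLoop hθ hY ds (q ++ [comb (xor f g) d u v])
          gs' e' (fun i => γ (i + 1)) hge (by rw [hlast.1]; omega) (by omega)
          (fun i => by rw [hγ, hlast.1]; rfl) (fun _ => hr (List.cons_ne_nil _ _)) (by omega)
          hlast.2
        refine ⟨gs₁, e₁, ?_, h3, ?_⟩
        · rw [proc, hγ0]
          refine (Reach.loop_step ?_ (hY (u :: v :: q) (g :: gs) (e + 1) (d :: ds)
            (by simpa using hqN) (by rw [List.length_cons, pow_succ]; omega) he
            (by simp; omega)).1 hstep h2).mono ?_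
          · change encodeBits (d :: (ds ++ rest)) - θ ≠ 0
            have := encodeBits_le_append ds rest
            have := hr (List.cons_ne_nil _ _)
            rw [encodeBits]
            omega
          · rw [List.length_cons, Nat.succ_mul ds.length]
            omega
        · rw [proc, hγ0]
          exact h4

end Prog
end WeakOT

/-! ### The complete program of a player and its time -/

namespace WeakOT
namespace Prog

/-- The program of a player with the given last step, and the given program for `k = 0`. -/
def player (P Q : Prog) (f : Bool) (θ : ℕ) (fin zero : Prog) : Prog :=
  branch 0 (seq (setup P Q) (seq (playerInit f θ) (seq (loop 10 convBody) (seq playerMid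
    (seq (loop 10 stepBody) fin))))) zero

/-- A bound on the length of all numbers, where `X` bounds `k + n`. -/
def numSize (X : ℕ) : ℕ := (X + 14) * X + 20

/-- A bound on the time of a player's program. -/
def playerTime (P Q : Prog) (T : ℕ → ℕ) (f : Bool) (θ : ℕ) (fin : Prog) (X : ℕ) : ℕ :=
  1 + numSize X + (setupTime P Q (numSize X) (T X) X + (playerInit f θ).factor * (numSize X + 1) +
    (X * (1 + numSize X + convBody.factor * (numSize X + 1)) + 1) + 2 * (numSize X + 1) +
    (X * (1 + numSize X + (stepBlock.factor + 200) * (numSize X + 1)) + 1) +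
    fin.factor * (numSize X + 1))

theorem setupTime_mono (P Q : Prog) (Y T : ℕ) {N N' : ℕ} (h : N ≤ N') :
    setupTime P Q Y T N ≤ setupTime P Q Y T N' :=
  Nat.add_le_add_left (Nat.mul_le_mul_right _ h) _

/-- By `Approx.prec_le` the precision is controlled by the number of levels, so `X` alone bounds all
lengths. -/
theorem prec_add_mul_le {A B : ℕ → ℕ} {p q : ℝ} (h : Approx A B p q) {k X : ℕ} (hk : k ≠ 0)
    (hX : k + 2 ^ numLevels k (start A B) ≤ X) :
    prec A B ≤ X + 11 ∧
    (prec A B + 3) * (2 ^ numLevels k (start A B) + k) + 20 ≤ numSize X := by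
  have h1 := h.prec_le hk
  have h2 := Nat.lt_two_pow_self (n := numLevels k (start A B))
  exact ⟨by omega, Nat.add_le_add_right (Nat.mul_le_mul (by omega) (by omega)) _⟩

/-- Schedule, conversion of the outputs and rounds are the same for messages and outputs; only the
final block differs. The messages in `rest` stay unprocessed and are visible to that block. -/
theorem reach_player {P Q : Prog} {k X : ℕ} {T : ℕ → ℕ} (hk : k ≠ 0) {A B : ℕ → ℕ} {p q : ℝ}
    (h : Approx A B p q) (hX : k + 2 ^ numLevels k (start A B) ≤ X)
    (hP : ∀ i ≤ X + 11, P.Computes [k, i] (A i) (T X))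
    (hQ : ∀ i ≤ X + 11, Q.Computes [k, i] (B i) (T X)) (f : Bool) {θ : ℕ} (hθ3 : θ ≤ 3)
    {fin zero : Prog} (hfin : fin.simple 32 = true)
    {ws : List (Bool × Bool)} (hws : ws.length = 2 ^ numLevels k (start A B))
    {ds rest : List Bool} (hlen : (ds ++ rest).length < 2 ^ numLevels k (start A B))
    (hθ : encodeBits rest ≤ θ) (hr : ds ≠ [] → θ < 2 * encodeBits rest) {out : ℕ}
    (hout : ∀ gs' e', gs'.headD false
        = roundGates (start A B) (numLevels k (start A B)) ds.length →
      (fin.exec (roundRegs k 1 (2 ^ numLevels k (start A B)) θ f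
        (proc f (roundGates (start A B) (numLevels k (start A B))) (ws.map (conv f)) ds)
        gs' e' rest)).getD 0 0 = out) :
    (player P Q f θ fin zero).Computes
      [k, encodePairs ws, encodeBits [], encodeBits (ds ++ rest)] out
      (playerTime P Q T f θ fin X) := by
  obtain ⟨hp1, hp2⟩ := prec_add_mul_le h hk hX
  set l := numLevels k (start A B) with hl
  set Y := numSize X with hYdef
  have hl2 := Nat.lt_two_pow_self (n := l)
  have hYX : 14 * X + 20 ≤ Y := by
    have : Y = X * X + 14 * X + 20 := by rw [hYdef]; unfold numSize; ring
    omega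
  have hk1 : k.size ≤ Y := size_le_of_le (by omega)
  have h0 : Nat.size 0 ≤ Y := by simp
  have h1 : Nat.size 1 ≤ Y := size_le_of_le (by omega)
  have hf : f.toNat.size ≤ Y := size_le_of_le (by have := Bool.toNat_lt f; omega)
  have hθs : θ.size ≤ Y := size_le_of_le (by omega)
  have henc : ∀ q : List (Bool × Bool), q.length ≤ 2 ^ l → (encodePairs q).size ≤ Y := fun q hq =>
    size_le_of_le_two_pow (encodePairs_lt q).le (by omega)
  have hencs : ∀ (q : List (Bool × Bool)) (j : ℕ), q.length ≤ 2 ^ l → (encodePairs q - j).size ≤ Y :=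
    fun q j hq => (Nat.size_le_size (Nat.sub_le _ _)).trans (henc q hq)
  have h4 : ∀ i ≤ 2 ^ l, (4 ^ i).size ≤ Y := fun i hi => by
    rw [show 4 = 2 ^ 2 by norm_num, ← pow_mul]
    exact size_le_of_le_two_pow le_rfl (by omega)
  have hrs : ∀ rs : List Bool, rs.length < 2 * 2 ^ l → (encodeBits rs).size ≤ Y := fun rs hrs =>
    size_le_of_le_two_pow (encodeBits_lt rs).le (by omega)
  have hrss : ∀ (rs : List Bool) (j : ℕ), rs.length < 2 * 2 ^ l → (encodeBits rs - j).size ≤ Y :=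
    fun rs j h => (Nat.size_le_size (Nat.sub_le _ _)).trans (hrs rs h)
  have hnum : ∀ gs : List Bool, 2 ^ gs.length ≤ 2 ^ l → (num gs).size ≤ Y := fun gs hgs =>
    size_le_of_le ((num_lt gs).le.trans (hgs.trans (by omega)))
  have hn : (2 ^ l).size ≤ Y := size_le_of_le (by omega)
  have hhalf : ∀ i : ℕ, 2 ^ i ≤ 2 ^ l → (2 ^ i / 2).size ≤ Y := fun i hi =>
    size_le_of_le ((Nat.div_le_self _ _).trans (by omega))
  set gs := gatesOf (start A B) l with hgs
  have hgl : gs.length = l := length_gatesOf l _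
  have hc : encodeBits [] = 1 := rfl
  rw [hc]
  have r1 := reach_setup (w := encodePairs ws) (c := 1) (r := encodeBits (ds ++ rest)) hk h
    (fun i hi => hP i (hi.trans hp1)) (fun i hi => hQ i (hi.trans hp1))
    (henc ws hws.le) h1 (hrs _ (by omega)) hp2
  have r2 : (playerInit f θ).Reach
      (regs k (encodePairs ws) 1 (encodeBits (ds ++ rest)) 0 0 0 0 (2 ^ l) (num gs) 0 0 0)
      (convRegs k 1 (encodeBits (ds ++ rest)) (2 ^ gs.length / 2) (2 ^ gs.length / 2) (2 ^ l)
        (num gs) θ f [] ws) ((playerInit f θ).factor * (Y + 1)) :=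
    reach_exec (m := 32) rfl rfl (sizeLe_regs hk1 (henc ws hws.le) h1 (hrs _ (by omega)) h0 h0 h0
      h0 hn (hnum gs (by rw [hgl])) h0 h0 h0 (by omega)) (by rw [hgl]; rfl)
  have r3 := reach_convLoop (k := k) (c := 1) (r := encodeBits (ds ++ rest))
    (h := 2 ^ gs.length / 2) (e := 2 ^ gs.length / 2) (n := 2 ^ l) (G := num gs) (θ := θ) (Y := Y)
    (f := f) ws [] fun q' ws' hq => by
      rw [List.length_nil] at hq
      exact sizeLe_pregs hk1 (henc _ (by omega)) h1 (hrs _ (by omega)) (henc _ (by omega))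
        (h4 _ (by omega)) (hhalf _ (by rw [hgl])) (hhalf _ (by rw [hgl])) hn
        (hnum gs (by rw [hgl])) (hencs _ _ (by omega)) hθs hf h0 (by omega)
  rw [List.nil_append] at r3
  have r4 : playerMid.Reach (convRegs k 1 (encodeBits (ds ++ rest)) (2 ^ gs.length / 2)
        (2 ^ gs.length / 2) (2 ^ l) (num gs) θ f (ws.map (conv f)) [])
      (roundRegs k 1 (2 ^ l) θ f (ws.map (conv f)) gs (2 ^ gs.length / 2) (ds ++ rest))
      (2 * (Y + 1)) :=
    reach_exec (P := playerMid) (m := 32) rfl rfl (sizeLe_pregs hk1 (henc _ (by simp)) h1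
      (hrs _ (by omega)) (henc _ (by simp; omega)) (h4 _ (by simp; omega))
      (hhalf _ (by rw [hgl])) (hhalf _ (by rw [hgl])) hn
      (hnum gs (by rw [hgl])) (hencs _ _ (by simp)) hθs hf h0 (by omega)) rfl
  obtain ⟨gs', e', r5, hhead, hsize⟩ := reach_stepLoop (k := k) (c := 1) (n := 2 ^ l) (θ := θ)
    (Y := Y) (f := f) (rest := rest) hθ (N := 2 ^ l) (fun q gs e ds' hq hg he hd =>
      ⟨sizeLe_pregs hk1 h1 h1 (hrs _ (by simp at hlen ⊢; omega)) (henc _ hq) (h4 _ hq)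
        (hhalf _ hg) (size_le_of_le (by omega)) hn (hnum gs hg)
        (hrss _ _ (by simp at hlen ⊢; omega)) hθs hf h0 (by omega), hnum gs hg⟩) ds
    (ws.map (conv f)) gs (2 ^ gs.length / 2) (roundGates (start A B) l)
    (by
      rcases gs with _ | ⟨g, gs⟩
      · simp
      · have := Nat.one_le_two_pow (n := gs.length)
        simp [pow_succ])
    (by
      have := Nat.one_le_two_pow (n := l)
      rw [remGates_half, length_expand, hgl, List.length_map, hws]; omega)
    (by rw [List.length_map, hws]; simp at hlen; omega)
    (fun i => by rw [remGates_half]; rfl) hr (by rw [List.length_map, hws]) (by rw [hgl])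
  have r6 : fin.Reach _ _ (fin.factor * (Y + 1)) := reach_exec (m := 32) hfin rfl hsize rfl
  obtain ⟨t, ht, hr⟩ := Reach.branch_pos (x := 0)
    (l := [k, encodePairs ws, 1, encodeBits (ds ++ rest)]) (P := seq (setup P Q) (seq (playerInit f θ)
    (seq (loop 10 convBody) (seq playerMid (seq (loop 10 stepBody) fin))))) (Q := zero) hk hk1
    (r1.seq (r2.seq (r3.seq (r4.seq (r5.seq r6)))))
  refine ⟨_, t, hr, hout gs' e' hhead, ht.trans ?_⟩
  unfold playerTime
  rw [← hYdef]
  have b1 := setupTime_mono P Q Y (T X) (show 2 ^ numLevels k (start A B) ≤ X by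
    rw [← hl]; omega)
  have b2 : ws.length * (1 + Y + convBody.factor * (Y + 1)) ≤
      X * (1 + Y + convBody.factor * (Y + 1)) := Nat.mul_le_mul_right _ (by omega)
  have b3 : ds.length * (1 + Y + (stepBlock.factor + 200) * (Y + 1)) ≤
      X * (1 + Y + (stepBlock.factor + 200) * (Y + 1)) :=
    Nat.mul_le_mul_right _ (by simp at hlen; omega)
  omega

end Prog
end WeakOT

/-! ### What the final blocks of the programs compute -/

namespace WeakOT

theorem length_proc (f : Bool) : ∀ (ds : List Bool) (γ : ℕ → Bool) (q : List (Bool × Bool)),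
    ds.length < q.length → (proc f γ q ds).length = q.length - ds.length
  | [], _, _, _ => rfl
  | d :: ds, γ, u :: v :: q, h => by
      have := length_proc f ds (fun i => γ (i + 1)) (qstep (xor f (γ 0)) d (u :: v :: q))
        (by simp [qstep] at h ⊢; omega)
      rw [proc, this]
      simp [qstep]
  | _ :: _, _, [_], h => by simp at h

theorem encodePairs_cons (x : Bool × Bool) (l : List (Bool × Bool)) :
    encodePairs (x :: l) = 2 * (2 * encodePairs l + x.2.toNat) + x.1.toNat := rfl

/-- After the last round the default value makes the sender silent, which matters when his message
function is evaluated on a complete conversation. -/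
theorem roundGates_eq_false {s : ℕ × ℕ × ℕ} {l i : ℕ} (h : 2 ^ l - 1 ≤ i) :
    roundGates s l i = false :=
  List.getD_eq_default _ _ (by rw [length_expand, length_gatesOf]; exact h)

namespace Prog

theorem md_num (f : Bool) (gs : List Bool) :
    md (num gs + f.toNat) = (xor f (gs.headD false)).toNat := by
  cases gs with
  | nil => cases f <;> rfl
  | cons g gs => exact (comb_eq f g false (false, false) (false, false) (num gs)).1

/-- For a queue of one pair the division would expose the leading 1 of the encoding instead of a
second bit; the condition on the gate discards that value. -/
theorem md_mul_eq_qmsg (a : Bool) {q : List (Bool × Bool)} (hq : q ≠ [])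
    (ha : q.length = 1 → a = false) :
    md (encodePairs q / 4 + encodePairs q) * a.toNat = (qmsg a q).toNat := by
  match q with
  | [u] => rw [ha rfl]; simp [qmsg]
  | u :: v :: q =>
    have : md (encodePairs (u :: v :: q) / 4 + encodePairs (u :: v :: q))
        = (xor u.1 v.1).toNat := by
      rw [md_eq, encodePairs_cons, encodePairs_cons]
      obtain ⟨u1, u2⟩ := u
      obtain ⟨v1, v2⟩ := v
      generalize encodePairs q = E
      cases u1 <;> cases u2 <;> cases v1 <;> cases v2 <;> simp <;> omega
    rw [this]
    cases a <;> simp [qmsg]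

theorem out_eq (f : Bool) (u : Bool × Bool) (E : ℕ) :
    f.toNat * md (2 * (2 * E + u.2.toNat) + u.1.toNat) +
        (1 - f.toNat) * md ((2 * (2 * E + u.2.toNat) + u.1.toNat) / 2) +
        (md (md ((2 * (2 * E + u.2.toNat) + u.1.toNat) / 2) +
            (1 - f.toNat) * md (2 * (2 * E + u.2.toNat) + u.1.toNat)) +
          md (md ((2 * (2 * E + u.2.toNat) + u.1.toNat) / 2) +
            (1 - f.toNat) * md (2 * (2 * E + u.2.toNat) + u.1.toNat))) + 4
      = encodePairs [bif f then u else ofPair u] := by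
  rw [half_bit, md_bit, md_bit]
  obtain ⟨a, b⟩ := u
  cases f <;> cases a <;> cases b <;> decide

/-! ## The programs for `k = 0` -/

/-- The first coin is the message. -/
def msgZero : Prog := block [const 13 2, add 0 2 31, mod2 0 18]

/-- The output of the sender from his coins and the message. -/
def outZeroA : Prog :=
  block [const 12 1, const 13 2, const 15 4, split 2 18 19, mod2 18 20, sub 20 3 13, sub 21 12 20,
    mul 22 20 18, mul 23 21 19, add 22 22 23, mul 23 20 19, mul 24 21 18, add 23 23 24,
    add 23 23 23, add 22 22 23, add 0 22 15]

/-- The output of the receiver from his coin and the message. -/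
def outZeroB : Prog :=
  block [const 13 2, const 15 4, split 2 18 19, sub 20 3 13, add 20 20 20, add 19 19 20,
    add 0 19 15]

theorem computes_zero {P zero : Prog} {w c r : ℕ} (hz : zero.simple 32 = true) (hw : w < 8)
    (hc : c < 8) (hr : r < 8) :
    (branch 0 P zero).Computes [0, w, c, r]
      ((zero.exec ([0, w, c, r] ++ List.replicate 28 0)).getD 0 0) (1 + zero.factor * 4) := by
  have hB : SizeLe ([0, w, c, r] ++ List.replicate 28 0) 3 := fun v hv => by
    refine size_le_of_lt (X := 3) ?_
    rcases List.mem_append.1 hv with hv | hv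
    · simp only [List.mem_cons, List.not_mem_nil, or_false] at hv
      rcases hv with rfl | rfl | rfl | rfl <;> omega
    · rw [List.eq_of_mem_replicate hv]; omega
  obtain ⟨t, ht, hr⟩ := reach_exec (m := 32) hz rfl hB rfl
  rw [st_append_zeros] at hr
  exact ⟨_, _, Runs.branch_zero rfl hr, rfl, by omega⟩

theorem exec_msgZero (w c r : ℕ) :
    (msgZero.exec ([0, w, c, r] ++ List.replicate 28 0)).getD 0 0 = md c := by
  simp only [msgZero, mod2, block, exec, List.cons_append, List.nil_append, List.replicate,
    List.getD_cons_succ, List.getD_cons_zero, List.set_cons_succ, List.set_cons_zero, md,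
    Nat.add_zero]

theorem exec_outZeroA (w c r : ℕ) :
    (outZeroA.exec ([0, w, c, r] ++ List.replicate 28 0)).getD 0 0
      = (r - 2) * md (c / 2) + (1 - (r - 2)) * md c + ((r - 2) * md c + (1 - (r - 2)) * md (c / 2) +
          ((r - 2) * md c + (1 - (r - 2)) * md (c / 2))) + 4 := by
  simp only [outZeroA, split, mod2, block, exec, List.cons_append, List.nil_append, List.replicate,
    List.getD_cons_succ, List.getD_cons_zero, List.set_cons_succ, List.set_cons_zero, md]

theorem exec_outZeroB (w c r : ℕ) :
    (outZeroB.exec ([0, w, c, r] ++ List.replicate 28 0)).getD 0 0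
      = md c + ((r - 2) + (r - 2)) + 4 := by
  simp only [outZeroB, split, block, exec, List.cons_append, List.nil_append, List.replicate,
    List.getD_cons_succ, List.getD_cons_zero, List.set_cons_succ, List.set_cons_zero, md]

/-! ## The programs without inputs from the instances -/

/-- With only `k` as input the other registers read `0`, so the schedule program applies with zero
arguments. -/
theorem computes_schedule {P Q : Prog} {k X : ℕ} {T : ℕ → ℕ} (hk : k ≠ 0) {A B : ℕ → ℕ} {p q : ℝ}
    (h : Approx A B p q) (hX : k + 2 ^ numLevels k (start A B) ≤ X)
    (hP : ∀ i ≤ X + 11, P.Computes [k, i] (A i) (T X))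
    (hQ : ∀ i ≤ X + 11, Q.Computes [k, i] (B i) (T X))
    {fin zero : Prog} (hfin : fin.simple 32 = true) :
    (branch 0 (seq (setup P Q) fin) zero).Computes [k]
      ((fin.exec (regs k 0 0 0 0 0 0 0 (2 ^ numLevels k (start A B))
        (num (gatesOf (start A B) (numLevels k (start A B)))) 0 0 0)).getD 0 0)
      (1 + numSize X + (setupTime P Q (numSize X) (T X) X + fin.factor * (numSize X + 1))) := by
  obtain ⟨hp1, hp2⟩ := prec_add_mul_le h hk hX
  have hY : 14 * X + 20 ≤ numSize X := by
    have : numSize X = X * X + 14 * X + 20 := by unfold numSize; ring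
    omega
  have h0 : Nat.size 0 ≤ numSize X := by simp
  have r1 := reach_setup (w := 0) (c := 0) (r := 0) hk h (fun i hi => hP i (hi.trans hp1))
    (fun i hi => hQ i (hi.trans hp1)) h0 h0 h0 hp2
  have hn := num_lt (gatesOf (start A B) (numLevels k (start A B)))
  rw [length_gatesOf] at hn
  have hk1 : k.size ≤ numSize X := size_le_of_le (by omega)
  have r2 : fin.Reach (regs k 0 0 0 0 0 0 0 (2 ^ numLevels k (start A B))
      (num (gatesOf (start A B) (numLevels k (start A B)))) 0 0 0) _
      (fin.factor * (numSize X + 1)) := reach_exec (m := 32) hfin rfl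
    (sizeLe_regs hk1 h0 h0 h0 h0 h0 h0 h0 (size_le_of_le (by omega)) (size_le_of_le (by omega))
      h0 h0 h0 (by omega)) rfl
  obtain ⟨t, ht, hr⟩ := Reach.branch_pos (x := 0) (l := [k, 0, 0, 0]) (P := seq (setup P Q) fin)
    (Q := zero) hk hk1 (r1.seq r2)
  rw [show [k, 0, 0, 0] = [k] ++ List.replicate 3 0 from rfl, st_append_zeros] at hr
  have := setupTime_mono P Q (numSize X) (T X) (show 2 ^ numLevels k (start A B) ≤ X by omega)
  exact ⟨_, t, hr, rfl, by omega⟩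

theorem computes_const {k a b : ℕ} : (branch 0 (const 0 a) (const 0 b)).Computes [k]
    (if k = 0 then b else a) (2 + k + Nat.size a + Nat.size b) := by
  split_ifs with hk
  · exact ⟨_, _, Runs.branch_zero hk (Runs.const 0 b _), Function.update_self .., by omega⟩
  · refine ⟨_, _, Runs.branch_pos hk (Runs.const 0 a _), Function.update_self .., ?_⟩
    have : Nat.size ([k].getD 0 0) ≤ k := size_le_of_le le_rfl
    omega

end Prog
end WeakOT

/-! ### Efficiency of the protocol -/

namespace WeakOT

/-- The number of instances. -/
noncomputable def instances (A B : ℕ → ℕ → ℕ) (k : ℕ) : ℕ :=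
  if k = 0 then 0 else 2 ^ numLevels k (start (A k) (B k))

/-- The gates in the rounds. -/
noncomputable def gates (A B : ℕ → ℕ → ℕ) (k : ℕ) : ℕ → Bool :=
  roundGates (start (A k) (B k)) (numLevels k (start (A k) (B k)))

namespace Prog

theorem polyBdd_numSize : PolyBdd numSize :=
  ((PolyBdd.id.add (.const 14)).mul .id).add (.const 20)

theorem polyBdd_setupTime (P Q : Prog) {T : ℕ → ℕ} (hT : PolyBdd T) :
    PolyBdd fun X => setupTime P Q (numSize X) (T X) X := by
  have h := polyBdd_numSize
  unfold setupTime
  generalize initBlock.factor = c1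
  generalize powInit.factor = c2
  generalize levelInit.factor = c3
  generalize cleanBlock.factor = c4
  generalize (call 32 P 0 4 5).factor = c5
  generalize (call 32 Q 0 4 6).factor = c6
  generalize powBody.factor = c7
  generalize levelBody.factor = c8
  with_reducible
    repeat' first | exact h | exact hT | exact .const _ | exact .id | apply PolyBdd.add |
      apply PolyBdd.mul

theorem polyBdd_playerTime (P Q : Prog) {T : ℕ → ℕ} (hT : PolyBdd T) (f : Bool) (θ : ℕ)
    (fin : Prog) : PolyBdd (playerTime P Q T f θ fin) := by
  have h := polyBdd_numSize
  have h' := polyBdd_setupTime P Q hT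
  unfold playerTime
  generalize (playerInit f θ).factor = c1
  generalize convBody.factor = c2
  generalize stepBlock.factor = c3
  generalize fin.factor = c4
  with_reducible
    repeat' first | exact h' | exact h | exact hT | exact .const _ | exact .id |
      apply PolyBdd.add | apply PolyBdd.mul

theorem Computes.mono {P : Prog} {l : List ℕ} {a T T' : ℕ} (h : P.Computes l a T) (hT : T ≤ T') :
    P.Computes l a T' := by
  obtain ⟨s, t, hr, ha, ht⟩ := h
  exact ⟨s, t, hr, ha, ht.trans hT⟩

/-- The hypothesis `hF` splits the received bits into those to be processed and a rest recognized by
`θ`. The separate program for `k = 0` sees at most two coins and one message. -/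
theorem computable_player {P Q : Prog} {A B : ℕ → ℕ → ℕ} {p q : ℕ → ℝ} {T : ℕ → ℕ}
    (h : ∀ k, Approx (A k) (B k) (p k) (q k))
    (hP : ∀ X k i, k ≤ X → i ≤ X + 11 → P.Computes [k, i] (A k i) (T X))
    (hQ : ∀ X k i, k ≤ X → i ≤ X + 11 → Q.Computes [k, i] (B k i) (T X))
    {α : Type} {enc : α → ℕ} {nc : ℕ → ℕ} {F : ℕ → List (Bool × Bool) → List Bool → List Bool → α}
    (f : Bool) {θ : ℕ} {fin zero : Prog} (hnc : ∀ k, k ≠ 0 → nc k = 0)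
    (hθ3 : θ ≤ 3) (hfin : fin.simple 32 = true)
    (hzero : zero.simple 32 = true) (hnc0 : nc 0 ≤ 2)
    (h0 : ∀ c r, c.length = nc 0 → r.length ≤ 1 →
      (zero.exec ([0, encodePairs [], encodeBits c, encodeBits r] ++ List.replicate 28 0)).getD 0 0
        = enc (F 0 [] c r))
    (hF : ∀ k ws r, k ≠ 0 → ws.length = instances A B k → r.length < instances A B k →
      ∃ ds rest, r = ds ++ rest ∧ encodeBits rest ≤ θ ∧ (ds ≠ [] → θ < 2 * encodeBits rest) ∧
        ∀ gs' e', gs'.headD false = gates A B k ds.length →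
          (fin.exec (roundRegs k 1 (instances A B k) θ f
            (proc f (gates A B k) (ws.map (conv f)) ds) gs' e' rest)).getD 0 0
            = enc (F k ws [] r))
    {time : ℕ → ℕ} (htime : ∀ k, playerTime P Q T f θ fin (k + instances A B k) +
      (1 + zero.factor * 4) ≤ time k) :
    Protocol.PlayerComputable enc (instances A B) nc
      (fun k => if k = 0 then 1 else instances A B k - 1) time F := by
  refine ⟨player P Q f θ fin zero, fun k ws c r hws hc hr => ?_⟩
  have ht := htime k
  by_cases hk : k = 0
  · subst hk
    rw [instances, if_pos rfl, List.length_eq_zero_iff] at hws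
    subst hws
    simp only [if_pos] at hr
    rw [← h0 c r hc hr]
    have hc' : encodeBits c < 8 := (encodeBits_lt c).trans_le
      (show 2 ^ (c.length + 1) ≤ 2 ^ 3 from Nat.pow_le_pow_right (by norm_num) (by omega))
    have hr' : encodeBits r < 8 := (encodeBits_lt r).trans_le
      (show 2 ^ (r.length + 1) ≤ 2 ^ 3 from Nat.pow_le_pow_right (by norm_num) (by omega))
    exact (computes_zero hzero (by decide) hc' hr').mono (by omega)
  · simp only [if_neg hk] at hr
    rw [hnc k hk, List.length_eq_zero_iff] at hc
    subst hc
    have hN : instances A B k = 2 ^ numLevels k (start (A k) (B k)) := if_neg hk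
    have hN1 := Nat.one_le_two_pow (n := numLevels k (start (A k) (B k)))
    have hr1 : r.length < instances A B k := by omega
    obtain ⟨ds, rest, rfl, h1, h2, h3⟩ := hF k ws r hk hws hr1
    rw [hN] at h3 hws hr1 ht
    exact (reach_player (X := k + 2 ^ numLevels k (start (A k) (B k))) hk (h k) le_rfl
      (fun i hi => hP _ k i (Nat.le_add_right _ _) hi)
      (fun i hi => hQ _ k i (Nat.le_add_right _ _) hi) f hθ3 hfin hws hr1 h1 h2 h3).mono (by omega)

theorem exec_msgBlock_roundRegs (k c n θ : ℕ) (f : Bool) {q : List (Bool × Bool)} (gs : List Bool)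
    (e : ℕ) (rs : List Bool) (hq : q ≠ [])
    (ha : q.length = 1 → xor f (gs.headD false) = false) :
    (msgBlock.exec (roundRegs k c n θ f q gs e rs)).getD 0 0
      = (qmsg (xor f (gs.headD false)) q).toNat * ((1 - f.toNat + encodeBits rs) / 2) := by
  unfold roundRegs
  rw [exec_msgBlock, md_num, md_mul_eq_qmsg _ hq ha]

theorem exec_outBlock_roundRegs (k c n θ : ℕ) (f : Bool) {q : List (Bool × Bool)} (gs : List Bool)
    (e : ℕ) (rs : List Bool) (hq : q ≠ []) :
    (outBlock.exec (roundRegs k c n θ f q gs e rs)).getD 0 0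
      = encodePairs [bif f then q.headD (false, false) else ofPair (q.headD (false, false))] := by
  obtain ⟨u, q, rfl⟩ := List.exists_cons_of_ne_nil hq
  unfold roundRegs
  rw [exec_outBlock, encodePairs_cons, out_eq]
  rfl

theorem length_le_one {r : List Bool} (h : r.length ≤ 1) : r = [] ∨ ∃ b, r = [b] := by
  match r with
  | [] => exact .inl rfl
  | [b] => exact .inr ⟨b, rfl⟩

end Prog

open Prog

theorem efficient_otProtocol {P Q : Prog} {A B : ℕ → ℕ → ℕ} {p q : ℕ → ℝ} {T : ℕ → ℕ}
    (h : ∀ k, Approx (A k) (B k) (p k) (q k)) (hT : PolyBdd T)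
    (hP : ∀ X k i, k ≤ X → i ≤ X + 11 → P.Computes [k, i] (A k i) (T X))
    (hQ : ∀ X k i, k ≤ X → i ≤ X + 11 → Q.Computes [k, i] (B k i) (T X)) :
    (otProtocol (instances A B) (gates A B)).Efficient := by
  -- One bound for all programs is the sum of their separate time bounds.
  set tm : ℕ → ℕ := fun X => (playerTime P Q T false 1 msgBlock X + (1 + msgZero.factor * 4)) +
    (playerTime P Q T true 3 msgBlock X + (1 + msgZero.factor * 4)) +
    (playerTime P Q T false 1 outBlock X + (1 + outZeroA.factor * 4)) +
    (playerTime P Q T true 1 outBlock X + (1 + outZeroB.factor * 4)) +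
    (1 + numSize X + (setupTime P Q (numSize X) (T X) X + (add 0 8 31).factor * (numSize X + 1))) +
    (1 + numSize X + (setupTime P Q (numSize X) (T X) X + (sub 0 8 12).factor * (numSize X + 1))) +
    (X + 20) with htm
  have hB : PolyBdd tm := by
    have h1 := polyBdd_numSize
    have h2 := polyBdd_setupTime P Q hT
    have h3 := fun f θ fin => polyBdd_playerTime P Q hT f θ fin
    rw [htm]
    generalize msgZero.factor = c1
    generalize outZeroA.factor = c2
    generalize outZeroB.factor = c3
    generalize (add 0 8 31).factor = c4
    generalize (sub 0 8 12).factor = c5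
    with_reducible
      repeat' first | exact h1 | exact h2 | exact h3 _ _ _ | exact .const _ | exact .id |
        apply PolyBdd.add | apply PolyBdd.mul
  obtain ⟨poly, hpoly⟩ := hB
  have hN : ∀ k, k ≠ 0 → instances A B k = 2 ^ numLevels k (start (A k) (B k)) := fun k hk =>
    if_neg hk
  have hle : ∀ k, tm (k + instances A B k) ≤ poly.eval (k + instances A B k) := fun k => hpoly _
  have hproc : ∀ (f : Bool) (γ : ℕ → Bool) (ws : List (Bool × Bool)) (ds : List Bool),
      ds.length < ws.length → (proc f γ (ws.map (conv f)) ds).length = ws.length - ds.length :=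
    fun f γ ws ds hd => by rw [length_proc _ _ _ _ (by simpa using hd), List.length_map]
  have hne : ∀ (f : Bool) (γ : ℕ → Bool) (ws : List (Bool × Bool)) (ds : List Bool),
      ds.length < ws.length → proc f γ (ws.map (conv f)) ds ≠ [] := fun f γ ws ds hd h0 => by
    have := hproc f γ ws ds hd
    rw [h0, List.length_nil] at this
    omega
  have hconvA : ∀ ws : List (Bool × Bool), ws.map (conv false) = ws.map toPair := fun _ => rfl
  have hconvB : ∀ ws : List (Bool × Bool), ws.map (conv true) = ws := fun ws => List.map_id ws
  refine ⟨poly, fun k => ?_, ?_, ?_, ?_, ?_, ?_, ?_, ?_, ?_⟩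
  · have := hle k
    have : k + instances A B k + 20 ≤ tm (k + instances A B k) := Nat.le_add_left _ _
    simp only [otProtocol]
    refine ⟨?_, ?_, ?_⟩ <;> split_ifs <;> omega
  · refine ⟨branch 0 (seq (setup P Q) (add 0 8 31)) (const 0 0), fun k => ?_⟩
    have := hle k
    simp only [htm] at this
    by_cases hk : k = 0
    · subst hk
      exact ⟨_, _, Runs.branch_zero rfl (Runs.const 0 0 _),
        (Function.update_self ..).trans (if_pos rfl : instances A B 0 = 0).symm, by
          simp only [otProtocol, Nat.size_zero]; omega⟩
    · have hX : k + 2 ^ numLevels k (start (A k) (B k)) ≤ k + instances A B k := by rw [hN k hk]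
      obtain ⟨s, t, hr, ha, ht⟩ := computes_schedule (zero := const 0 0) hk (h k) hX
        (fun i hi => hP _ k i (Nat.le_add_right _ _) hi)
        (fun i hi => hQ _ k i (Nat.le_add_right _ _) hi) (fin := add 0 8 31) rfl
      refine ⟨s, t, hr, ha.trans (hN k hk).symm, ht.trans (le_trans ?_ this)⟩
      omega
  · refine ⟨branch 0 (seq (setup P Q) (sub 0 8 12)) (const 0 1), fun k => ?_⟩
    have := hle k
    simp only [htm] at this
    by_cases hk : k = 0
    · subst hk
      exact ⟨_, _, Runs.branch_zero rfl (Runs.const 0 1 _),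
        (Function.update_self ..).trans 
          (if_pos rfl : (if 0 = 0 then 1 else instances A B 0 - 1) = 1).symm, by
          simp only [otProtocol, Nat.size_one]; omega⟩
    · have hX : k + 2 ^ numLevels k (start (A k) (B k)) ≤ k + instances A B k := by rw [hN k hk]
      obtain ⟨s, t, hr, ha, ht⟩ := computes_schedule (zero := const 0 1) hk (h k) hX
        (fun i hi => hP _ k i (Nat.le_add_right _ _) hi)
        (fun i hi => hQ _ k i (Nat.le_add_right _ _) hi) (fin := sub 0 8 12) rfl
      have e : (otProtocol (instances A B) (gates A B)).rounds k
          = 2 ^ numLevels k (start (A k) (B k)) - 1 := by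
        simp only [otProtocol, if_neg hk, hN k hk]
      refine ⟨s, t, hr, ha.trans e.symm, ht.trans (le_trans ?_ this)⟩
      omega
  · refine ⟨_, fun k => (computes_const (a := 0) (b := 2)).mono ?_⟩
    have := hle k
    have : k + instances A B k + 20 ≤ tm (k + instances A B k) := Nat.le_add_left _ _
    have : Nat.size 2 ≤ 2 := by decide
    simp only [otProtocol, Nat.size_zero]
    omega
  · refine ⟨_, fun k => (computes_const (a := 0) (b := 1)).mono ?_⟩
    have := hle k
    have : k + instances A B k + 20 ≤ tm (k + instances A B k) := Nat.le_add_left _ _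
    simp only [otProtocol, Nat.size_zero, Nat.size_one]
    omega
  · refine computable_player (θ := 1) (fin := msgBlock) (zero := msgZero) h hP hQ false
      (fun k hk => if_neg hk) (by omega) rfl rfl le_rfl ?_ ?_ fun k => ?_
    · intro c r hc _
      rw [exec_msgZero]
      match c, hc with
      | [a, b], _ => exact md_bit _ _
    · intro k ws r hk hws hr
      -- The sender speaks first in a round, so all bits he has received belong to finished rounds;
      -- `θ = 1` is the encoding of the empty rest.
      refine ⟨r, [], (List.append_nil r).symm, le_rfl, fun _ => by decide, fun gs' e' hg => ?_⟩
      rw [← hws] at hr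
      rw [exec_msgBlock_roundRegs _ _ _ _ _ _ _ _ (hne _ _ _ _ hr), hg]
      · simp [otProtocol, hk, encodeBits, hconvA]
      · intro h1
        rw [hproc _ _ _ _ hr] at h1
        rw [hg, gates, roundGates_eq_false (by rw [← hN k hk]; omega)]
        rfl
    · have := hle k
      simp only [htm] at this
      simp only [otProtocol]
      omega
  · refine computable_player (θ := 3) (fin := msgBlock) (zero := msgZero) h hP hQ true
      (fun k hk => if_neg hk) (by omega) rfl rfl (by simp) ?_ ?_ fun k => ?_
    · intro c r hc _
      rw [exec_msgZero]
      match c, hc with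
      | [a], _ => exact md_bit _ _
    · intro k ws r hk hws hr
      rw [← hws] at hr
      rcases List.eq_nil_or_concat r with rfl | ⟨ds, d, rfl⟩
      -- For the receiver the factor `(1 - φ + r) / 2` is `1 / 2 = 0` when nothing has been
      -- received, which matches the default message.
      · refine ⟨[], [], rfl, by decide, fun h => absurd rfl h, fun gs' e' hg => ?_⟩
        unfold roundRegs
        rw [exec_msgBlock]
        simp [otProtocol, hk, encodeBits]
      · rw [List.concat_eq_append] at hr ⊢
        have hd : encodeBits [d] = 2 + d.toNat := by simp [encodeBits]
        have hd' := Bool.toNat_lt d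
        simp only [List.length_append, List.length_singleton] at hr
        -- The encoding of one bit is 2 or 3 and that of more bits at least 4, so `θ = 3` keeps back
        -- exactly the message of the current round.
        refine ⟨ds, [d], rfl, by omega, fun _ => by omega, fun gs' e' hg => ?_⟩
        rw [exec_msgBlock_roundRegs _ _ _ _ _ _ _ _ (hne _ _ _ _ (by omega)), hg, hd]
        · have e1 : (1 - true.toNat + (2 + d.toNat)) / 2 = 1 := by simp; omega
          rw [e1, mul_one, hconvB]
          simp [otProtocol, hk]
        · intro h1
          rw [hproc _ _ _ _ (by omega)] at h1
          omega
    · have := hle k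
      simp only [htm] at this
      simp only [otProtocol]
      omega
  · refine computable_player (θ := 1) (fin := outBlock) (zero := outZeroA) h hP hQ false
      (fun k hk => if_neg hk) (by omega) rfl rfl le_rfl ?_ ?_ fun k => ?_
    · intro c r hc hr
      rw [exec_outZeroA]
      match c, hc with
      | [a, b], _ =>
        change _ = encodePairs [freeOutA [a, b] r]
        rcases length_le_one hr with rfl | ⟨d, rfl⟩
        · cases a <;> cases b <;> decide
        · cases a <;> cases b <;> cases d <;> decide
    · intro k ws r hk hws hr
      refine ⟨r, [], (List.append_nil r).symm, le_rfl, fun _ => by decide, fun gs' e' hg => ?_⟩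
      rw [← hws] at hr
      rw [exec_outBlock_roundRegs _ _ _ _ _ _ _ _ (hne _ _ _ _ hr)]
      simp [otProtocol, hk, hconvA]
    · have := hle k
      simp only [htm] at this
      simp only [otProtocol]
      omega
  · refine computable_player (θ := 1) (fin := outBlock) (zero := outZeroB) h hP hQ true
      (fun k hk => if_neg hk) (by omega) rfl rfl (by simp) ?_ ?_ fun k => ?_
    · intro c r hc hr
      rw [exec_outZeroB]
      match c, hc with
      | [a], _ =>
        change _ = encodePairs [(a, r.headD false)]
        rcases length_le_one hr with rfl | ⟨d, rfl⟩
        · cases a <;> decide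
        · cases a <;> cases d <;> decide
    · intro k ws r hk hws hr
      refine ⟨r, [], (List.append_nil r).symm, le_rfl, fun _ => by decide, fun gs' e' hg => ?_⟩
      rw [← hws] at hr
      rw [exec_outBlock_roundRegs _ _ _ _ _ _ _ _ (hne _ _ _ _ hr)]
      simp [otProtocol, hk, hconvB]
    · have := hle k
      simp only [htm] at this
      simp only [otProtocol]
      omega

end WeakOT

/-! ### The bounds on the number of instances and on the advantages -/

open scoped ENNReal
namespace WeakOT

section

variable {A B : ℕ → ℕ → ℕ} {p q : ℕ → ℝ}

theorem numWOT_eq (A B : ℕ → ℕ → ℕ) {k : ℕ} (hk : k ≠ 0) :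
    (otProtocol (instances A B) (gates A B)).numWOT k
      = 2 ^ numLevels k (start (A k) (B k)) - 1 + 1 := by
  have := Nat.one_le_two_pow (n := numLevels k (start (A k) (B k)))
  change instances A B k = _
  rw [instances, if_neg hk]
  omega

/-- For `k = 0` the bound is 0, which is why that case uses no instance. -/
theorem numWOT_le (h : ∀ k, Approx (A k) (B k) (p k) (q k)) (k : ℕ) :
    ((otProtocol (instances A B) (gates A B)).numWOT k : ℝ)
      ≤ 2 * (k : ℝ) ^ 2 / (1 - p k - q k) ^ 4 := by
  change ((instances A B k : ℕ) : ℝ) ≤ _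
  unfold instances
  split_ifs with hk
  · have := (h k).lt_one
    subst hk
    simp
  · exact_mod_cast (h k).two_pow_numLevels_le hk

theorem one_le_unitItem (x : ℝ) : 1 ≤ (unitItem x).1 + (unitItem x).2 := by
  unfold unitItem
  rw [← ENNReal.ofReal_one]
  refine le_trans (le_of_eq ?_) ENNReal.ofReal_add_le
  rw [add_sub_cancel]

/-- The stopping rule bounds the sum of both advantages by `2⁻ᵏ`, hence each of them. -/
theorem gval_gates_le (h : ∀ k, Approx (A k) (B k) (p k) (q k)) {k : ℕ} (hk : k ≠ 0) :
    gval (gates A B k) (2 ^ numLevels k (start (A k) (B k)) - 1)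
      (List.replicate ((otProtocol (instances A B) (gates A B)).numWOT k)
        (unitItem (sndR (start (A k) (B k))))) ≤ ENNReal.ofReal ((1 / 2 : ℝ) ^ k) := by
  have hlt := (h k).start_lt
  have hs := (stop_iff (iterate_natStep_lt hlt _)).1 (stop_numLevels k hlt)
  have h0 := fstR_nonneg (natStep^[numLevels k (start (A k) (B k))] (start (A k) (B k)))
  rw [show (otProtocol (instances A B) (gates A B)).numWOT k
    = 2 ^ numLevels k (start (A k) (B k)) from if_neg hk, gates, gval_roundGates hlt]
  exact ENNReal.ofReal_le_ofReal (by linarith)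

theorem gval_not_gates_le (h : ∀ k, Approx (A k) (B k) (p k) (q k)) {k : ℕ} (hk : k ≠ 0) :
    gval (fun i => !gates A B k i) (2 ^ numLevels k (start (A k) (B k)) - 1)
      (List.replicate ((otProtocol (instances A B) (gates A B)).numWOT k)
        (unitItem (fstR (start (A k) (B k))))) ≤ ENNReal.ofReal ((1 / 2 : ℝ) ^ k) := by
  have hlt := (h k).start_lt
  have hs := (stop_iff (iterate_natStep_lt hlt _)).1 (stop_numLevels k hlt)
  have h0 := sndR_nonneg (natStep^[numLevels k (start (A k) (B k))] (start (A k) (B k)))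
  rw [show (otProtocol (instances A B) (gates A B)).numWOT k
    = 2 ^ numLevels k (start (A k) (B k)) from if_neg hk]
  unfold gates
  rw [gval_not_roundGates hlt]
  exact ENNReal.ofReal_le_ofReal (by linarith)

theorem semiHonest_isWOT (h : ∀ k, Approx (A k) (B k) (p k) (q k)) (k : ℕ)
    (F : Fin ((otProtocol (instances A B) (gates A B)).numWOT k) → SemiHonestSystem)
    (hF : ∀ j, (F j).IsWOT (p k) (q k) 0) :
    ((otProtocol (instances A B) (gates A B)).semiHonest k F).IsWOT
      ((1 / 2 : ℝ) ^ k) ((1 / 2 : ℝ) ^ k) 0 := by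
  have ht : (0 : ℝ) ≤ (1 / 2) ^ k := by positivity
  refine ⟨semiHonest_correct _ _ (fun hk => numWOT_eq A B hk) F fun j => (hF j).correct, ?_, ?_⟩
  · by_cases hk : k = 0
    · subst hk
      rw [pow_zero]
      exact predAdv_le_one _ _ _
    · exact semiHonest_secureA _ _ hk (numWOT_eq A B hk) F (h k).snd_nonneg hF _ (one_le_unitItem _)
        (ENNReal.ofReal_le_ofReal (h k).le_sndR_start) ht (gval_gates_le h hk)
  · by_cases hk : k = 0
    · subst hk
      rw [pow_zero]
      exact predAdv_le_one _ _ _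
    · exact semiHonest_secureB _ _ hk (numWOT_eq A B hk) F (h k).fst_nonneg hF _ (one_le_unitItem _)
        (ENNReal.ofReal_le_ofReal (h k).le_fstR_start) ht (gval_not_gates_le h hk)

/-- Every advantage is at most 1, so only correctness has content for `k = 0`. Otherwise
monotonicity passes from the true advantages to the rounded ones that the schedule was computed for.
-/
theorem malicious_isWOT (h : ∀ k, Approx (A k) (B k) (p k) (q k)) (k : ℕ)
    (F : Fin ((otProtocol (instances A B) (gates A B)).numWOT k) → MaliciousSystem)
    (hF : ∀ j, (F j).IsWOT (p k) (q k)) :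
    ((otProtocol (instances A B) (gates A B)).malicious k F).IsWOT
      ((1 / 2 : ℝ) ^ k) ((1 / 2 : ℝ) ^ k) := by
  have ht : (0 : ℝ) ≤ (1 / 2) ^ k := by positivity
  refine ⟨?_, fun σ => ?_, fun σ => ?_⟩
  · have e : (fun j => (F j).honest) = fun _ => rot := funext fun j => (hF j).correct
    change (otProtocol (instances A B) (gates A B)).honestRun k (fun j => (F j).honest) = rot
    rw [e]
    exact honestRun_rot _ _ fun hk => numWOT_eq A B hk
  · by_cases hk : k = 0
    · subst hk
      rw [pow_zero]
      exact predAdv_le_one _ _ _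
    · rw [predAdv_le_iff _ _ _ ht]
      refine (advW_malicious_corruptB_le _ _ hk (numWOT_eq A B hk) F
        (unitItem (sndR (start (A k) (B k)))) (one_le_unitItem _) (fun j => ?_) σ).trans
        (gval_gates_le h hk)
      exact Sys.val_le_of_advW_le (fun y : Bool × Bool => xor y.1 y.2) _ fun σ =>
        ((predAdv_le_iff _ _ _ (h k).snd_nonneg).1 ((hF j).secureA σ)).trans
          (ENNReal.ofReal_le_ofReal (h k).le_sndR_start)
  · by_cases hk : k = 0
    · subst hk
      rw [pow_zero]
      exact predAdv_le_one _ _ _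
    · rw [predAdv_le_iff _ _ _ ht]
      refine (advW_malicious_corruptA_le _ _ hk (numWOT_eq A B hk) F
        (unitItem (fstR (start (A k) (B k)))) (one_le_unitItem _) (fun j => ?_) σ).trans
        (gval_not_gates_le h hk)
      exact Sys.val_le_of_advW_le (fun y : Bool × Bool => y.1) _ fun σ =>
        ((predAdv_le_iff _ _ _ (h k).fst_nonneg).1 ((hF j).secureB σ)).trans
          (ENNReal.ofReal_le_ofReal (h k).le_fstR_start)

end

end WeakOT

theorem mainTheorem6 (p q : ℕ → ℝ) (hp : ∀ k, 0 ≤ p k) (hq : ∀ k, 0 ≤ q k)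
    (hpq : ∀ k, p k + q k < 1)
    (hpc : WeakOT.PolyTimeComputable p) (hqc : WeakOT.PolyTimeComputable q) :
    ∃ P : WeakOT.Protocol, P.Efficient ∧
      ∀ k : ℕ,
        (P.numWOT k : ℝ) ≤ 2 * (k : ℝ) ^ 2 / (1 - p k - q k) ^ 4 ∧
        (∀ F : Fin (P.numWOT k) → WeakOT.SemiHonestSystem,
          (∀ j, (F j).IsWOT (p k) (q k) 0) →
            (P.semiHonest k F).IsWOT ((1 / 2 : ℝ) ^ k) ((1 / 2 : ℝ) ^ k) 0) ∧
        (∀ F : Fin (P.numWOT k) → WeakOT.MaliciousSystem,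
          (∀ j, (F j).IsWOT (p k) (q k)) →
            (P.malicious k F).IsWOT ((1 / 2 : ℝ) ^ k) ((1 / 2 : ℝ) ^ k)) := by
  obtain ⟨P, S, hA⟩ := hpc
  obtain ⟨Q, T, hB⟩ := hqc
  choose A hP hA using hA
  choose B hQ hB using hB
  have h : ∀ k, WeakOT.Approx (A k) (B k) (p k) (q k) := fun k =>
    ⟨hp k, hq k, hpq k, hA k, hB k⟩
  refine ⟨WeakOT.otProtocol (WeakOT.instances A B) (WeakOT.gates A B),
    WeakOT.efficient_otProtocol (P := P) (Q := Q) h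
      -- Precisions up to `X + 11` are requested for `k ≤ X`, so the programs for `p` and `q` are
      -- charged at `k + i ≤ X + X + 11`.
      ((WeakOT.PolyBdd.eval S 11).add (WeakOT.PolyBdd.eval T 11))
      (fun X k i hk hi => (hP k i).mono ?_) (fun X k i hk hi => (hQ k i).mono ?_),
    fun k => ⟨WeakOT.numWOT_le h k, WeakOT.semiHonest_isWOT h k, WeakOT.malicious_isWOT h k⟩⟩
  · exact (WeakOT.eval_mono S (by omega : k + i ≤ X + X + 11)).trans (Nat.le_add_right _ _)
  · exact (WeakOT.eval_mono T (by omega : k + i ≤ X + X + 11)).trans (Nat.le_add_left _ _)
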